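/- For integers $0 \le a \le m$ and $0 \le b \le n$, let $\mathcal{B}_{m,n}(a,b)$ be the bipartite rigidity matroid, i.e. the matroid on the ground set $[m]\times[n]$ given by the columns of the following $(an+bm)\times mn$ matrix over the field $\mathbb{C}(x_{ij},y_{k\ell})$ of rational functions in the variables $x_{ij}$, $(i,j)\in[m]\times[a]$, and $y_{k\ell}$, $(k,\ell)\in[n]\times[b]$. The rows are labeled by the disjoint union of $[a]\times[n]$ and $[b]\times[m]$ and the columns by $[m]\times[n]$. The row labeled by $(j,k)\in[a]\times[n]$ has the entry $x_{pj}$ in the column $(p,k)$ for each $p\in[m]$, and $0$ in all other columns. The row labeled by $(\ell,i)\in[b]\times[m]$ has the entry $y_{q\ell}$ in the column $(i,q)$ for each $q\in[n]$, and $0$ in all other columns. A subset of $[m]\times[n]$ is independent if the corresponding columns are linearly independent. **Theorem.** There is a deterministic algorithm (a single deterministic Turing machine) and a polynomial $p$ such that, for all integers $0\le a\le m$ and $0\le b\le n$ with $m-a\le 3$ and all subsets $X\subseteq[m]\times[n]$, the algorithm, given $(m,n,a,b,X)$ as input, outputs the rank of $X$ in $\mathcal{B}_{m,n}(a,b)$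 after at most $p(m+n)$ steps. -/

import Mathlib

open Computability (Γ')

/-- The column matroid of a matrix `A` over a field: the ground set is the (finite) set of all
column labels, and a set of labels is independent if and only if the columns of `A` with these
labels are linearly independent (as a family, so that equal columns are parallel elements). -/
def columnMatroid {K R C : Type*} [Field K] [Finite C] (A : Matrix R C K) : Matroid C :=
  (IndepMatroid.ofFinite (E := Set.univ) Set.finite_univ
    (fun S : Set C => LinearIndepOn K A.col S)
    (linearIndepOn_empty K A.col)
    (fun _ _ hJ hIJ => hJ.mono hIJ)
    (by
      intro I J hI hJ hlt
      by_contra! hcon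
      have hsub : A.col '' J ⊆ (Submodule.span K (A.col '' I) : Set (R → K)) := by
        rintro _ ⟨e, he, rfl⟩
        by_cases heI : e ∈ I
        · exact Submodule.subset_span (Set.mem_image_of_mem _ heI)
        · by_contra hne
          exact hcon e he heI ((linearIndepOn_insert heI).2 ⟨hI, hne⟩)
      have hfin : (A.col '' I).Finite := (Set.toFinite I).image _
      have := FiniteDimensional.span_of_finite K hfin
      have hle := Submodule.finrank_mono (Submodule.span_le.2 hsub)
      have hcard : ∀ S : Set C, LinearIndepOn K A.col S →
          Module.finrank K (Submodule.span K (A.col '' S)) = S.ncard := by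
        intro S hS
        have := Fintype.ofFinite S
        have h := finrank_span_eq_card hS
        rw [Set.image_eq_range, h, ← Nat.card_eq_fintype_card, Nat.card_coe_set_eq]
      rw [hcard I hI, hcard J hJ] at hle
      omega)
    (fun _ _ => Set.subset_univ _)).matroid

theorem columnMatroid_indep_iff {K R C : Type*} [Field K] [Finite C] (A : Matrix R C K)
    (S : Set C) : (columnMatroid A).Indep S ↔ LinearIndepOn K A.col S := Iff.rfl

/-- The field `ℂ(x_{ij}, y_{kl})` of rational functions, with `(i, j) ∈ [m] × [a]` and
`(k, l) ∈ [n] × [b]`. -/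
abbrev RigidityField (m n a b : ℕ) : Type :=
  FractionRing (MvPolynomial ((Fin m × Fin a) ⊕ (Fin n × Fin b)) ℂ)

/-- The variable `x_{ij}`, as a rational function. -/
noncomputable def rigidityX {m n a b : ℕ} (i : Fin m) (j : Fin a) : RigidityField m n a b :=
  algebraMap (MvPolynomial ((Fin m × Fin a) ⊕ (Fin n × Fin b)) ℂ) _ (MvPolynomial.X (Sum.inl (i, j)))

/-- The variable `y_{kl}`, as a rational function. -/
noncomputable def rigidityY {m n a b : ℕ} (k : Fin n) (l : Fin b) : RigidityField m n a b :=
  algebraMap (MvPolynomial ((Fin m × Fin a) ⊕ (Fin n × Fin b)) ℂ) _ (MvPolynomial.X (Sum.inr (k, l)))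

/-- The `(an + bm) × mn` bipartite rigidity matrix. The row `(j, k) ∈ [a] × [n]` has the entry
`x_{pj}` in column `(p, k)`; the row `(l, i) ∈ [b] × [m]` has the entry `y_{ql}` in column
`(i, q)`; all other entries are zero. -/
noncomputable def rigidityMatrix (m n a b : ℕ) :
    Matrix ((Fin a × Fin n) ⊕ (Fin b × Fin m)) (Fin m × Fin n) (RigidityField m n a b) :=
  Matrix.of fun row col =>
    match row with
    | Sum.inl (j, k) => if col.2 = k then rigidityX col.1 j else 0
    | Sum.inr (l, i) => if col.1 = i then rigidityY col.2 l else 0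

/-- The bipartite rigidity matroid `ℬ_{m,n}(a,b)` on `[m] × [n]`. -/
noncomputable def bipartiteRigidityMatroid (m n a b : ℕ) : Matroid (Fin m × Fin n) :=
  columnMatroid (rigidityMatrix m n a b)

/-- A number in unary, followed by a separator. -/
def encodeUnary (k : ℕ) : List Γ' :=
  List.replicate k (Γ'.bit true) ++ [Γ'.comma]

/-- The input word for `m, n, a, b` and `X ⊆ [m] × [n]`: the four numbers, then the `m × n`
zero-one incidence matrix of `X`, row by row, each row being followed by a separator. As running
times are measured in `m + n`, writing numbers `≤ m + n` in unary or in binary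
makes no difference. -/
def encodeInput (m n a b : ℕ) (X : Finset (Fin m × Fin n)) : List Γ' :=
  encodeUnary m ++ encodeUnary n ++ encodeUnary a ++ encodeUnary b ++
    (List.finRange m).flatMap fun i =>
      ((List.finRange n).map fun j => Γ'.bit (decide ((i, j) ∈ X))) ++ [Γ'.comma]

/-- The deterministic (multi-stack) Turing machine `M`, started on the word `input`, halts
after at most `t` steps with the word `output` as its output. -/
def HaltsWithOutput {Γ₀ Γ₁ : Type} (M : Turing.TM2ComputableAux Γ₀ Γ₁)
    (input : List Γ₀) (output : List Γ₁) (t : ℕ) : Prop :=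
  Nonempty (Turing.TM2OutputsInTime M.tm (input.map M.inputAlphabet.symm)
    (some (output.map M.outputAlphabet.symm)) t)

/-! The rank has a min formula: it is the least element of `rankBounds X a b`, a list of
polynomially many explicit numbers `q * b + ∑ j, min |X_j| (a + c j)`, where `X_j` is the set of
rows of `X` in column `j`. A machine computes each of them by counting and takes the minimum.

Since `m ≤ a + 3`, empty rows can be added until there are `a + 3` of them. Let `N` be the kernel of
`f ↦ ∑ i, f i • x i`, of dimension three for generic `x`, and let `S_j` be the complement of `X_j`.
A linear relation between the columns labelled by `X` is a family of vectors `g_j ∈ N` with `g_j`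
zero on `S_j`, subject to the `b` vector equations `∑ j, y j l • g_j = 0`.

Upper bounds: for a subspace `U` of the kernel, the families with `g_j ∈ U` supported on `X_j` have
to satisfy only `b * dim U` scalar equations (`sum_finrank_inf_coordSubspace_le`). Hence the rank is
at most `|X| - ∑ j, dim (U ⊓ K^{X_j}) + b * dim U`. Three kinds of `U` are used: zero; a space of
dimension `3 - |I|` vanishing on a set `I` of at most two rows; and a plane adapted to two pairs of
rows, which generically contains the line of vectors vanishing on either pair. They give the
elements of `rankBounds` (`columnRank_le_of_mem_rankBounds`), for all values of `x` and `y`.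

Lower bound: specialization does not increase the rank (`columnRank_le_generic`), so it suffices to
find, for given `X`, complex values for which the rank is at least one of the bounds. For `x` the
space `N` consists of the values of quadratic polynomials at points in general position
(`exists_inGeneralPosition_ker`). For `y` there are two constructions. If at most `n - b` columns
have `|S_j| ≥ 2`, the equations identify the `g_j` within each of `n - b` groups of columns and kill
the rest, so that a group contributes the vectors of `N` that vanish on the union of its `S_j`. If
at most `b` columns have `|S_j| ≤ 1`, the equations say that the `g_j` of each of `b` groups sum to
zero, and a group contributes the dimension of the span of its spaces of vectors vanishing on `S_j`.
One of the two cases always occurs (`exists_rankBound_le_columnRank`).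

In both cases the exceptional columns go to different groups, and the columns with `|S_j| = 1`,
respectively `|S_j| = 2`, are distributed by a min-max theorem for monotone submodular functions
(`exists_assignment`). Its minimizing set `A` of columns selects the bound: through the union of the
one-element sets `S_j`, or through the configuration of the pairs `S_j`, where three pairwise
disjoint pairs span `N` by general position.

On the machine side, a small language of loops over unary counters is compiled to a stack machine
with a polynomial time bound (`Prog.reach_code`), and the program that minimizes over `rankBounds`
is verified in that language (`Prog.run_rankProg`). -/

/-! ### A loop language over unary counters and its compilation to stack machines. -/

/-- Programs over unary counters indexed by `V` and a read-only tape with a movable head. -/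
inductive Prog (V : Type) : Type
  | skip : Prog V
  | inc : V → Prog V
  | dec : V → Prog V
  | left : Prog V
  | right : Prog V
  | seq : Prog V → Prog V → Prog V
  | ifz : V → Prog V → Prog V → Prog V
  | ifOne : Prog V → Prog V → Prog V
  | rep : V → Prog V → Prog V

/-- The state of a program: the counters and the position of the head. -/
@[ext]
structure ProgState (V : Type) : Type where
  /-- the values of the counters -/
  ctr : V → ℕ
  /-- the position of the head on the tape -/
  pos : ℕ

namespace Prog

variable {V : Type}

/-- The state transformation computed by a program on the tape `w`, where no loop is run through
more than `F` times. -/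
def eval [DecidableEq V] (w : List Γ') (F : ℕ) : Prog V → ProgState V → ProgState V
  | skip, s => s
  | inc v, s => ⟨Function.update s.ctr v (s.ctr v + 1), s.pos⟩
  | dec v, s => ⟨Function.update s.ctr v (s.ctr v - 1), s.pos⟩
  | left, s => ⟨s.ctr, s.pos - 1⟩
  | right, s => ⟨s.ctr, min (s.pos + 1) w.length⟩
  | seq p q, s => q.eval w F (p.eval w F s)
  | ifz v p q, s => if s.ctr v = 0 then p.eval w F s else q.eval w F s
  | ifOne p q, s => if w[s.pos]? = some (Γ'.bit true) then p.eval w F s else q.eval w F s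
  | rep v p, s => (p.eval w F)^[min (s.ctr v) F] s

/-- A bound for the running time, as a polynomial in the bound `F` for the loops. -/
noncomputable def cost : Prog V → Polynomial ℕ
  | skip => 1
  | inc _ => 1
  | dec _ => 1
  | left => 1
  | right => 1
  | seq p q => p.cost + q.cost
  | ifz _ p q => 1 + p.cost + q.cost
  | ifOne p q => 1 + p.cost + q.cost
  | rep _ p => Polynomial.X * p.cost + 3 * Polynomial.X + 4

theorem cost_eval_mono (p : Prog V) : Monotone fun F : ℕ => p.cost.eval F := by
  intro F G h
  induction p with
  | skip | inc | dec | left | right => simp [cost]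
  | seq p q hp hq | ifz v p q hp hq | ifOne p q hp hq =>
    simp only [cost, Polynomial.eval_add, Polynomial.eval_one] at *
    omega
  | rep v p hp =>
    simp only [cost, Polynomial.eval_add, Polynomial.eval_mul, Polynomial.eval_X,
      Polynomial.eval_ofNat] at *
    gcongr

/-- The stacks of the machine that runs a program. -/
inductive Stack (V : Type) : Type
  | reg : V → Stack V
  | aux : Stack V
  | fuel : Stack V
  | loop : Stack V
  | before : Stack V
  | behind : Stack V
  deriving DecidableEq, Fintype

/-- The alphabets of the stacks. -/
abbrev Sym : Stack V → Type
  | .before => Γ'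
  | .behind => Γ'
  | _ => Bool

/-- The stacks in a given state of the program. -/
def stackOf (w : List Γ') (F : ℕ) (lp : List Bool) (ax : ℕ) (s : ProgState V) :
    ∀ k : Stack V, List (Sym k)
  | .reg v => List.replicate (s.ctr v) true
  | .aux => List.replicate ax true
  | .fuel => List.replicate F true
  | .loop => lp
  | .before => (w.take s.pos).reverse
  | .behind => w.drop s.pos

/-- The labels of a compiled program. -/
abbrev Label : Prog V → Type
  | skip => Unit
  | inc _ => Unit
  | dec _ => Unit
  | left => Unit
  | right => Unit
  | seq p q => p.Label ⊕ q.Label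
  | ifz _ p q => Unit ⊕ (p.Label ⊕ q.Label)
  | ifOne p q => Unit ⊕ (p.Label ⊕ q.Label)
  | rep _ p => Fin 4 ⊕ p.Label

/-- A program has finitely many labels. -/
instance labelFintype : (p : Prog V) → Fintype p.Label
  | skip => inferInstanceAs (Fintype Unit)
  | inc _ => inferInstanceAs (Fintype Unit)
  | dec _ => inferInstanceAs (Fintype Unit)
  | left => inferInstanceAs (Fintype Unit)
  | right => inferInstanceAs (Fintype Unit)
  | seq p q =>
    have := p.labelFintype
    have := q.labelFintype
    inferInstanceAs (Fintype (p.Label ⊕ q.Label))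
  | ifz _ p q =>
    have := p.labelFintype
    have := q.labelFintype
    inferInstanceAs (Fintype (Unit ⊕ (p.Label ⊕ q.Label)))
  | ifOne p q =>
    have := p.labelFintype
    have := q.labelFintype
    inferInstanceAs (Fintype (Unit ⊕ (p.Label ⊕ q.Label)))
  | rep _ p =>
    have := p.labelFintype
    inferInstanceAs (Fintype (Fin 4 ⊕ p.Label))

/-- The entry point of a compiled program. -/
def entry : (p : Prog V) → p.Label
  | skip => ()
  | inc _ => ()
  | dec _ => ()
  | left => ()
  | right => ()
  | seq p _ => Sum.inl p.entry
  | ifz _ _ _ => Sum.inl ()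
  | ifOne _ _ => Sum.inl ()
  | rep _ _ => Sum.inl 0

section Compile

variable {Λ : Type}

/-- The statements of the machine. The internal state holds at most one symbol. -/
abbrev Code (V Λ : Type) : Type := Turing.TM2.Stmt (Sym (V := V)) Λ (Option Γ')

/-- Every jump forgets the internal state, so all configurations between two instructions carry the
value `none`. -/
def jump (l : Λ) : Code V Λ := .load (fun _ => none) (.goto fun _ => l)

/-- Pop a symbol, remembering only whether there was one. -/
def popTest (k : Stack V) (c₁ c₂ : Code V Λ) : Code V Λ :=
  .pop k (fun _ o => o.map fun _ => Γ'.blank) (.branch Option.isSome c₁ c₂)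

/-- The compiled program, with labels embedded in `Λ` by `ι`, that leaves by the label `out`. -/
def code : (p : Prog V) → (ι : p.Label → Λ) → (out : Λ) → p.Label → Code V Λ
  | skip, _, out, _ => jump out
  | inc v, _, out, _ => .push (.reg v) (fun _ => true) (jump out)
  | dec v, _, out, _ => .pop (.reg v) (fun _ _ => none) (jump out)
  | left, _, out, _ =>
    .pop .before (fun _ o => o)
      (.branch Option.isSome (.push .behind (fun o => o.getD Γ'.blank) (jump out)) (jump out))
  | right, _, out, _ =>
    .pop .behind (fun _ o => o)
      (.branch Option.isSome (.push .before (fun o => o.getD Γ'.blank) (jump out)) (jump out))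
  | seq p q, ι, out, l =>
    match l with
    | .inl l => p.code (fun l => ι (.inl l)) (ι (.inr q.entry)) l
    | .inr l => q.code (fun l => ι (.inr l)) out l
  | ifz v p q, ι, out, l =>
    match l with
    | .inl _ => .peek (.reg v) (fun _ o => o.map fun _ => Γ'.blank)
        (.branch Option.isSome (jump (ι (.inr (.inr q.entry)))) (jump (ι (.inr (.inl p.entry)))))
    | .inr (.inl l) => p.code (fun l => ι (.inr (.inl l))) out l
    | .inr (.inr l) => q.code (fun l => ι (.inr (.inr l))) out l
  | ifOne p q, ι, out, l =>
    match l with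
    | .inl _ => .peek .behind (fun _ o => o)
        (.branch (fun o => decide (o = some (Γ'.bit true)))
          (jump (ι (.inr (.inl p.entry)))) (jump (ι (.inr (.inr q.entry)))))
    | .inr (.inl l) => p.code (fun l => ι (.inr (.inl l))) out l
    | .inr (.inr l) => q.code (fun l => ι (.inr (.inr l))) out l
  | rep v p, ι, out, l =>
    match l with
    -- All nested loops share one stack. The symbol `false` marks the bottom of the frame of this
    -- loop; above it comes one `true` for each round still to be run.
    | .inl 0 => .push .loop (fun _ => false) (jump (ι (.inl 1)))
    | .inl 1 => popTest (.reg v)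
        (popTest .fuel
          (.push .aux (fun _ => true) (.push .loop (fun _ => true) (jump (ι (.inl 1)))))
          -- The fuel is exhausted here, so the symbol of `v` that was popped just before is
          -- returned.
          (.push (.reg v) (fun _ => true) (jump (ι (.inl 2)))))
        (jump (ι (.inl 2)))
    | .inl 2 => popTest .aux
        (.push (.reg v) (fun _ => true) (.push .fuel (fun _ => true) (jump (ι (.inl 2)))))
        (jump (ι (.inl 3)))
    | .inl 3 => .pop .loop (fun _ (o : Option Bool) => if o = some true then some Γ'.blank else none)
        (.branch Option.isSome (jump (ι (.inr p.entry))) (jump out))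
    | .inr l => p.code (fun l => ι (.inr l)) (ι (.inl 3)) l

/-- The machine `M` gets from the configuration `c` to `c'` within `t` steps. -/
def Reach [DecidableEq V] (M : Λ → Code V Λ) (c c' : Turing.TM2.Cfg (Sym (V := V)) Λ (Option Γ'))
    (t : ℕ) : Prop :=
  ∃ k ≤ t, (flip bind (Turing.TM2.step M))^[k] (some c) = some c'

variable [DecidableEq V] {M : Λ → Code V Λ}
  {c c' c'' : Turing.TM2.Cfg (Sym (V := V)) Λ (Option Γ')}

theorem Reach.refl (c) : Reach M c c 0 := ⟨0, le_rfl, rfl⟩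

theorem Reach.trans {t t' : ℕ} (h : Reach M c c' t) (h' : Reach M c' c'' t') :
    Reach M c c'' (t + t') := by
  obtain ⟨k, hk, e⟩ := h
  obtain ⟨k', hk', e'⟩ := h'
  exact ⟨k' + k, by omega, by rw [Function.iterate_add_apply, e, e']⟩

theorem Reach.mono {t t' : ℕ} (h : Reach M c c' t) (ht : t ≤ t') : Reach M c c' t' :=
  let ⟨k, hk, e⟩ := h
  ⟨k, hk.trans ht, e⟩

theorem Reach.single {l : Λ} {v S} (h : Turing.TM2.stepAux (M l) v S = c') :
    Reach M ⟨some l, v, S⟩ c' 1 :=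
  ⟨1, le_rfl, by rw [Function.iterate_one, ← h]; rfl⟩

end Compile

/-! ### Correctness and running time of the compiled code. -/

section Correct

variable [DecidableEq V] (w : List Γ') {Λ : Type} {M : Λ → Code V Λ}

/-- Set one counter. -/
def _root_.ProgState.set (s : ProgState V) (v : V) (x : ℕ) : ProgState V :=
  ⟨Function.update s.ctr v x, s.pos⟩

theorem stackOf_update_reg (F lp ax) (s : ProgState V) (v : V) (x : ℕ) :
    Function.update (stackOf w F lp ax s) (.reg v) (List.replicate x true) =
      stackOf w F lp ax (s.set v x) := by
  funext k
  cases k with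
  | reg u =>
    by_cases h : u = v
    · subst h; simp [stackOf, ProgState.set]
    · simp [stackOf, ProgState.set, h]
  | _ => simp [stackOf, ProgState.set]

theorem stackOf_update_aux (F lp ax) (s : ProgState V) (x : ℕ) :
    Function.update (stackOf w F lp ax s) .aux (List.replicate x true) = stackOf w F lp x s := by
  funext k
  cases k <;> simp [stackOf]

theorem stackOf_update_fuel (F lp ax) (s : ProgState V) (x : ℕ) :
    Function.update (stackOf w F lp ax s) .fuel (List.replicate x true) = stackOf w x lp ax s := by
  funext k
  cases k <;> simp [stackOf]

theorem stackOf_update_loop (F lp ax) (s : ProgState V) (lp' : List Bool) :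
    Function.update (stackOf w F lp ax s) .loop lp' = stackOf w F lp' ax s := by
  funext k
  cases k <;> simp [stackOf]

theorem stackOf_update_tape (F lp ax) (s : ProgState V) (i : ℕ) :
    Function.update (Function.update (stackOf w F lp ax s) .before (w.take i).reverse)
      .behind (w.drop i) = stackOf w F lp ax ⟨s.ctr, i⟩ := by
  funext k
  cases k <;> simp [stackOf]

theorem stackOf_update_tape' (F lp ax) (s : ProgState V) (i : ℕ) :
    Function.update (Function.update (stackOf w F lp ax s) .behind (w.drop i))
      .before (w.take i).reverse = stackOf w F lp ax ⟨s.ctr, i⟩ := by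
  funext k
  cases k <;> simp [stackOf]

theorem pop_reg {q : Code V Λ} {v : V} {f : Option Γ' → Option (Sym (.reg v)) → Option Γ'} {F lp ax}
    {s : ProgState V} {x : Option Γ'} :
    Turing.TM2.stepAux (.pop (.reg v) f q) x (stackOf w F lp ax s) =
      Turing.TM2.stepAux q (f x (stackOf w F lp ax s (.reg v)).head?)
        (stackOf w F lp ax (s.set v (s.ctr v - 1))) := by
  rw [Turing.TM2.stepAux, ← stackOf_update_reg]
  simp [stackOf]

theorem push_reg {q : Code V Λ} {F lp ax} {s : ProgState V} {v : V} {x : Option Γ'} :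
    Turing.TM2.stepAux (.push (.reg v) (fun _ => true) q) x (stackOf w F lp ax s) =
      Turing.TM2.stepAux q x (stackOf w F lp ax (s.set v (s.ctr v + 1))) := by
  rw [Turing.TM2.stepAux, ← stackOf_update_reg]
  simp [stackOf, List.replicate_succ]

theorem pop_fuel {q : Code V Λ} {f F lp ax} {s : ProgState V} {x : Option Γ'} :
    Turing.TM2.stepAux (.pop .fuel f q) x (stackOf w F lp ax s) =
      Turing.TM2.stepAux q (f x (stackOf w F lp ax s .fuel).head?)
        (stackOf w (F - 1) lp ax s) := by
  rw [Turing.TM2.stepAux, ← stackOf_update_fuel w F lp ax s (F - 1)]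
  simp [stackOf]

theorem push_fuel {q : Code V Λ} {F lp ax} {s : ProgState V} {x : Option Γ'} :
    Turing.TM2.stepAux (.push .fuel (fun _ => true) q) x (stackOf w F lp ax s) =
      Turing.TM2.stepAux q x (stackOf w (F + 1) lp ax s) := by
  rw [Turing.TM2.stepAux, ← stackOf_update_fuel w F lp ax s (F + 1)]
  simp [stackOf, List.replicate_succ]

theorem pop_aux {q : Code V Λ} {f F lp ax} {s : ProgState V} {x : Option Γ'} :
    Turing.TM2.stepAux (.pop .aux f q) x (stackOf w F lp ax s) =
      Turing.TM2.stepAux q (f x (stackOf w F lp ax s .aux).head?)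
        (stackOf w F lp (ax - 1) s) := by
  rw [Turing.TM2.stepAux, ← stackOf_update_aux w F lp ax s (ax - 1)]
  simp [stackOf]

theorem push_aux {q : Code V Λ} {F lp ax} {s : ProgState V} {x : Option Γ'} :
    Turing.TM2.stepAux (.push .aux (fun _ => true) q) x (stackOf w F lp ax s) =
      Turing.TM2.stepAux q x (stackOf w F lp (ax + 1) s) := by
  rw [Turing.TM2.stepAux, ← stackOf_update_aux w F lp ax s (ax + 1)]
  simp [stackOf, List.replicate_succ]

theorem pop_loop {q : Code V Λ} {f F lp ax} {s : ProgState V} {x : Option Γ'} :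
    Turing.TM2.stepAux (.pop .loop f q) x (stackOf w F lp ax s) =
      Turing.TM2.stepAux q (f x lp.head?) (stackOf w F lp.tail ax s) := by
  rw [Turing.TM2.stepAux, ← stackOf_update_loop w F lp ax s lp.tail]
  rfl

theorem push_loop {q : Code V Λ} {b : Bool} {F lp ax} {s : ProgState V} {x : Option Γ'} :
    Turing.TM2.stepAux (.push .loop (fun _ => b) q) x (stackOf w F lp ax s) =
      Turing.TM2.stepAux q x (stackOf w F (b :: lp) ax s) := by
  rw [Turing.TM2.stepAux, ← stackOf_update_loop w F lp ax s (b :: lp)]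
  rfl

theorem stepAux_jump (l : Λ) (x : Option Γ') (S : ∀ k : Stack V, List (Sym k)) :
    Turing.TM2.stepAux (jump l) x S = ⟨some l, none, S⟩ := rfl

@[simp] theorem _root_.ProgState.set_set (s : ProgState V) (v : V) (x y : ℕ) :
    (s.set v x).set v y = s.set v y := by
  simp [ProgState.set]

@[simp] theorem _root_.ProgState.set_ctr_self (s : ProgState V) (v : V) :
    s.set v (s.ctr v) = s := by
  simp [ProgState.set]

@[simp] theorem _root_.ProgState.ctr_set_self (s : ProgState V) (v : V) (x : ℕ) :
    (s.set v x).ctr v = x := by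
  simp [ProgState.set]

@[simp] theorem _root_.ProgState.pos_set (s : ProgState V) (v : V) (x : ℕ) :
    (s.set v x).pos = s.pos := rfl

/-- First phase of a loop: the number of rounds is fixed on the loop stack before the body runs, so
the body is free to change the counter `v`. What is taken from `v` and from the fuel is remembered
in `aux`. -/
theorem reach_count {v : V} {l₁ l₂ : Λ}
    (h₁ : M l₁ = popTest (.reg v)
        (popTest .fuel
          (.push .aux (fun _ => true) (.push .loop (fun _ => true) (jump l₁)))
          (.push (.reg v) (fun _ => true) (jump l₂)))
        (jump l₂)) (k : ℕ) : ∀ (F : ℕ) (lp : List Bool) (ax : ℕ) (s : ProgState V),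
      min (s.ctr v) F = k →
      Reach M ⟨some l₁, none, stackOf w F lp ax s⟩
        ⟨some l₂, none, stackOf w (F - k) (List.replicate k true ++ lp) (ax + k)
          (s.set v (s.ctr v - k))⟩ (k + 1) := by
  induction k with
  | zero =>
    intro F lp ax s hk
    refine Reach.single ?_
    rw [h₁, popTest, pop_reg]
    rcases Nat.eq_zero_or_pos (s.ctr v) with h0 | h0
    · simp [stackOf, h0, stepAux_jump]
    · have hF : F = 0 := by omega
      obtain ⟨y, hy⟩ : ∃ y, s.ctr v = y + 1 := ⟨s.ctr v - 1, by omega⟩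
      subst hF
      have : (stackOf w 0 lp ax s (.reg v)).head? = some true := by
        simp [stackOf, hy, List.replicate_succ]
      rw [this, Turing.TM2.stepAux]
      simp only [Option.map_some, Option.isSome_some, cond_true]
      rw [popTest, pop_fuel]
      have : (stackOf w 0 lp ax (s.set v (s.ctr v - 1)) .fuel).head? = none := rfl
      rw [this, Turing.TM2.stepAux]
      simp only [Option.map_none, Option.isSome_none, cond_false]
      rw [push_reg, stepAux_jump]
      simp [hy]
  | succ k ih =>
    intro F lp ax s hk
    have h := ih (F - 1) (true :: lp) (ax + 1) (s.set v (s.ctr v - 1)) (by simp; omega)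
    have e : stackOf w (F - (k + 1)) (List.replicate (k + 1) true ++ lp) (ax + (k + 1))
        (s.set v (s.ctr v - (k + 1))) = stackOf w (F - 1 - k) (List.replicate k true ++ true :: lp)
          (ax + 1 + k) ((s.set v (s.ctr v - 1)).set v ((s.set v (s.ctr v - 1)).ctr v - k)) := by
      rw [List.replicate_succ', List.append_assoc, ProgState.set_set, ProgState.ctr_set_self,
        Nat.sub_sub, Nat.sub_sub, add_comm 1 k, add_assoc ax, add_comm 1 k]
      rfl
    rw [e]
    refine ((Reach.single (c' := ⟨some l₁, none, stackOf w (F - 1) (true :: lp) (ax + 1)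
      (s.set v (s.ctr v - 1))⟩) ?_).trans h).mono (by omega)
    · obtain ⟨y, hy⟩ : ∃ y, s.ctr v = y + 1 := ⟨s.ctr v - 1, by omega⟩
      obtain ⟨z, rfl⟩ : ∃ z, F = z + 1 := ⟨F - 1, by omega⟩
      rw [h₁, popTest, pop_reg]
      have : (stackOf w (z + 1) lp ax s (.reg v)).head? = some true := by
        simp [stackOf, hy, List.replicate_succ]
      rw [this, Turing.TM2.stepAux]
      simp only [Option.map_some, Option.isSome_some, cond_true]
      rw [popTest, pop_fuel]
      have : (stackOf w (z + 1) lp ax (s.set v (s.ctr v - 1)) .fuel).head? = some true := rfl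
      rw [this, Turing.TM2.stepAux]
      simp only [Option.map_some, Option.isSome_some, cond_true]
      rw [push_aux, push_loop, stepAux_jump]

/-- Second phase of a loop: `aux` gives back to `v` and to the fuel what the first phase has taken.
-/
theorem reach_restore {v : V} {l₂ l₃ : Λ}
    (h₂ : M l₂ = popTest .aux
        (.push (.reg v) (fun _ => true) (.push .fuel (fun _ => true) (jump l₂))) (jump l₃))
    (lp : List Bool) (ax : ℕ) : ∀ (F : ℕ) (s : ProgState V),
      Reach M ⟨some l₂, none, stackOf w F lp ax s⟩
        ⟨some l₃, none, stackOf w (F + ax) lp 0 (s.set v (s.ctr v + ax))⟩ (ax + 1) := by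
  induction ax with
  | zero =>
    intro F s
    refine Reach.single ?_
    rw [h₂, popTest, pop_aux]
    simp [stackOf, stepAux_jump]
  | succ k ih =>
    intro F s
    have h := ih (F + 1) (s.set v (s.ctr v + 1))
    have e : stackOf w (F + (k + 1)) lp 0 (s.set v (s.ctr v + (k + 1))) =
        stackOf w (F + 1 + k) lp 0
          ((s.set v (s.ctr v + 1)).set v ((s.set v (s.ctr v + 1)).ctr v + k)) := by
      rw [ProgState.set_set, ProgState.ctr_set_self, add_assoc, add_assoc, add_comm 1 k]
    rw [e]
    refine ((Reach.single (c' := ⟨some l₂, none, stackOf w (F + 1) lp k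
      (s.set v (s.ctr v + 1))⟩) ?_).trans h).mono (by omega)
    · rw [h₂, popTest, pop_aux]
      have : (stackOf w F lp (k + 1) s .aux).head? = some true := rfl
      rw [this, Turing.TM2.stepAux]
      simp only [Option.map_some, Option.isSome_some, cond_true]
      rw [push_reg, push_fuel, stepAux_jump]
      rfl

theorem pos_eval_le (F : ℕ) (p : Prog V) :
    ∀ s : ProgState V, s.pos ≤ w.length → (p.eval w F s).pos ≤ w.length := by
  induction p with
  | skip | inc | dec => intro s hs; exact hs
  | left => intro s hs; exact (Nat.sub_le _ _).trans hs
  | right => intro s hs; exact min_le_right _ _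
  | seq p q hp hq => intro s hs; exact hq _ (hp _ hs)
  | ifz v p q hp hq | ifOne p q hp hq =>
    intro s hs
    simp only [eval]
    split_ifs
    exacts [hp _ hs, hq _ hs]
  | rep v p hp =>
    intro s hs
    simp only [eval]
    generalize min (s.ctr v) F = k
    induction k with
    | zero => exact hs
    | succ k ih => rw [Function.iterate_succ_apply']; exact hp _ ih

/-- Third phase of a loop: each `true` on the loop stack triggers one run of the body, and the
marker `false` ends the loop. -/
theorem reach_iterate {p : Prog V} {F t : ℕ} {lp : List Bool} {l₀ l₃ out : Λ}
    (h₃ : M l₃ = .pop .loop (fun _ (o : Option Bool) => if o = some true then some Γ'.blank else none)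
        (.branch Option.isSome (jump l₀) (jump out)))
    (h : ∀ (s : ProgState V) lp, s.pos ≤ w.length →
      Reach M ⟨some l₀, none, stackOf w F lp 0 s⟩
        ⟨some l₃, none, stackOf w F lp 0 (p.eval w F s)⟩ t) (k : ℕ) :
    ∀ s : ProgState V, s.pos ≤ w.length →
      Reach M ⟨some l₃, none, stackOf w F (List.replicate k true ++ false :: lp) 0 s⟩
        ⟨some out, none, stackOf w F lp 0 ((p.eval w F)^[k] s)⟩ (k * (t + 1) + 1) := by
  induction k with
  | zero =>
    intro s _
    refine (Reach.single ?_).mono (Nat.le_add_left _ _)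
    rw [h₃, pop_loop]
    simp [stepAux_jump]
  | succ k ih =>
    intro s hs
    refine (((Reach.single ?_).trans (h s (List.replicate k true ++ false :: lp) hs)).trans
      (ih _ (pos_eval_le w F p s hs))).mono (by ring_nf; omega)
    rw [h₃, pop_loop]
    simp [stepAux_jump, List.replicate_succ]

/-- Structural induction over the program. The loop stack `lp` is arbitrary because the body of a
loop runs on top of the frames of the surrounding loops. -/
theorem reach_code (F : ℕ) (p : Prog V) :
    ∀ (ι : p.Label → Λ) (out : Λ), (∀ l, M (ι l) = p.code ι out l) →
    ∀ (s : ProgState V) (lp : List Bool), s.pos ≤ w.length →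
      Reach M ⟨some (ι p.entry), none, stackOf w F lp 0 s⟩
        ⟨some out, none, stackOf w F lp 0 (p.eval w F s)⟩ (p.cost.eval F) := by
  induction p with
  | skip =>
    intro ι out hM s lp hs
    simp only [cost, Polynomial.eval_one]
    exact Reach.single (by rw [hM]; rfl)
  | inc v =>
    intro ι out hM s lp hs
    simp only [cost, Polynomial.eval_one]
    exact Reach.single (by rw [hM, code, push_reg]; rfl)
  | dec v =>
    intro ι out hM s lp hs
    simp only [cost, Polynomial.eval_one]
    exact Reach.single (by rw [hM, code, pop_reg]; rfl)
  | left =>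
    intro ι out hM s lp hs
    simp only [cost, Polynomial.eval_one]
    refine Reach.single ?_
    rw [hM, code, Turing.TM2.stepAux, Turing.TM2.stepAux]
    rcases Nat.eq_zero_or_pos s.pos with h0 | h0
    · have : stackOf w F lp 0 s .before = [] := by simp [stackOf, h0]
      rw [this]
      simp only [List.head?_nil, Option.isSome_none, cond_false, List.tail_nil, stepAux_jump, eval]
      congr 1
      funext k
      cases k <;> simp [stackOf, h0]
    · obtain ⟨i, hi⟩ : ∃ i, s.pos = i + 1 := ⟨s.pos - 1, by omega⟩
      have hlt : i < w.length := by omega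
      have : stackOf w F lp 0 s .before = (w[i] :: (w.take i).reverse : List Γ') := by
        rw [stackOf, hi, List.take_succ_eq_append_getElem hlt]
        simp only [List.reverse_append, List.reverse_cons, List.reverse_nil, List.nil_append,
          List.cons_append]
      rw [this]
      simp only [List.head?_cons, Option.isSome_some, cond_true, List.tail_cons,
        Turing.TM2.stepAux, stepAux_jump, eval]
      rw [show s.pos - 1 = i by omega, ← stackOf_update_tape w F lp 0 s i,
        List.drop_eq_getElem_cons hlt]
      simp [stackOf, hi]
  | right =>
    intro ι out hM s lp hs
    simp only [cost, Polynomial.eval_one]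
    refine Reach.single ?_
    rw [hM, code, Turing.TM2.stepAux, Turing.TM2.stepAux]
    rcases hs.eq_or_lt with h0 | h0
    · have : stackOf w F lp 0 s .behind = [] := by simp [stackOf, h0]
      rw [this]
      simp only [List.head?_nil, Option.isSome_none, cond_false, List.tail_nil, stepAux_jump, eval]
      congr 1
      funext k
      cases k <;> simp [stackOf, h0]
    · have : stackOf w F lp 0 s .behind = (w[s.pos] :: w.drop (s.pos + 1) : List Γ') := by
        simp [stackOf]
      rw [this]
      simp only [List.head?_cons, Option.isSome_some, cond_true, List.tail_cons,
        Turing.TM2.stepAux, stepAux_jump, eval]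
      rw [min_eq_left (by omega), ← stackOf_update_tape' w F lp 0 s (s.pos + 1),
        List.take_succ_eq_append_getElem h0]
      simp only [stackOf, ne_eq, reduceCtorEq, not_false_eq_true, Function.update_of_ne,
        Option.getD_some, List.reverse_append, List.reverse_cons, List.reverse_nil, List.nil_append,
        List.cons_append]
  | seq p q hp hq =>
    intro ι out hM s lp hs
    simp only [cost, Polynomial.eval_add]
    exact (hp (fun l => ι (.inl l)) (ι (.inr q.entry)) (fun l => hM _) s lp hs).trans
      (hq (fun l => ι (.inr l)) out (fun l => hM _) _ lp (pos_eval_le w F p s hs))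
  | ifz v p q hp hq =>
    intro ι out hM s lp hs
    simp only [cost, Polynomial.eval_add, Polynomial.eval_one, eval]
    split_ifs with h0
    · refine ((Reach.single ?_).trans
        (hp (fun l => ι (.inr (.inl l))) out (fun l => hM _) s lp hs)).mono (by omega)
      rw [entry, hM, code, Turing.TM2.stepAux, Turing.TM2.stepAux]
      simp [stackOf, h0, stepAux_jump]
    · refine ((Reach.single ?_).trans
        (hq (fun l => ι (.inr (.inr l))) out (fun l => hM _) s lp hs)).mono (by omega)
      rw [entry, hM, code, Turing.TM2.stepAux, Turing.TM2.stepAux]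
      obtain ⟨y, hy⟩ : ∃ y, s.ctr v = y + 1 := ⟨s.ctr v - 1, by omega⟩
      simp [stackOf, hy, stepAux_jump, List.replicate_succ]
  | ifOne p q hp hq =>
    intro ι out hM s lp hs
    simp only [cost, Polynomial.eval_add, Polynomial.eval_one, eval]
    split_ifs with h0
    · refine ((Reach.single ?_).trans
        (hp (fun l => ι (.inr (.inl l))) out (fun l => hM _) s lp hs)).mono (by omega)
      rw [entry, hM, code, Turing.TM2.stepAux, Turing.TM2.stepAux]
      simp [stackOf, h0, stepAux_jump]
    · refine ((Reach.single ?_).trans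
        (hq (fun l => ι (.inr (.inr l))) out (fun l => hM _) s lp hs)).mono (by omega)
      rw [entry, hM, code, Turing.TM2.stepAux, Turing.TM2.stepAux]
      simp [stackOf, h0, stepAux_jump]
  | rep v p hp =>
    intro ι out hM s lp hs
    simp only [cost, Polynomial.eval_add, Polynomial.eval_mul, Polynomial.eval_X,
      Polynomial.eval_ofNat, eval]
    have h₀ : Reach M ⟨some (ι (.inl 0)), none, stackOf w F lp 0 s⟩
        ⟨some (ι (.inl 1)), none, stackOf w F (false :: lp) 0 s⟩ 1 :=
      Reach.single (by rw [hM, code, push_loop]; rfl)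
    have h₁ := reach_count w (hM (.inl 1)) _ F (false :: lp) 0 s rfl
    set k := min (s.ctr v) F with hk
    have h₂ := reach_restore w (hM (.inl 2)) (List.replicate k true ++ false :: lp) (0 + k) (F - k)
      (s.set v (s.ctr v - k))
    have h₃ := reach_iterate w (hM (.inl 3)) (fun s lp hs => hp (fun l => ι (.inr l)) (ι (.inl 3))
      (fun l => hM _) s lp hs) k s hs (lp := lp)
    have e₁ : F - k + (0 + k) = F := by omega
    have e₂ : s.ctr v - k + (0 + k) = s.ctr v := by omega
    rw [ProgState.set_set, ProgState.ctr_set_self, e₁, e₂, ProgState.set_ctr_self] at h₂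
    -- Setting the marker, counting, restoring and iterating take `1`, `k + 1`, `k + 1` and `k * (t
    -- + 1) + 1` steps, where `t` bounds one run of the body; this is the source of `3 * X + 4` in
    -- `cost`.
    refine (((h₀.trans h₁).trans h₂).trans h₃).mono ?_
    have hkF : k ≤ F := min_le_right _ _
    have := Nat.mul_le_mul_right (p.cost.eval F) hkF
    rw [mul_add]
    omega

end Correct

end Prog

/-! ### The complete machine: preparing the loop bound, running the program, clearing the stacks. -/

namespace Prog

variable {V : Type} [DecidableEq V]

/-- Add four to the loop bound and to the counter `big`. -/
def charge {Λ : Type} (big : V) (q : Code V Λ) : Code V Λ :=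
  .push .fuel (fun _ => true) <| .push .fuel (fun _ => true) <|
  .push .fuel (fun _ => true) <| .push .fuel (fun _ => true) <|
  .push (.reg big) (fun _ => true) <| .push (.reg big) (fun _ => true) <|
  .push (.reg big) (fun _ => true) <| .push (.reg big) (fun _ => true) q

/-- The code of the machine that runs the program `p`: first it stores four times the length of the
tape in the loop bound and in the counter `big`, and after running `p` it erases the tape and the
loop bound. -/
def machineCode (p : Prog V) (big : V) : Fin 3 ⊕ p.Label → Code V (Fin 3 ⊕ p.Label)
  | .inl 0 => .pop .behind (fun _ o => o)
      (.branch Option.isSome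
        (.push .before (fun o => o.getD Γ'.blank)
          (charge big (jump (.inl 0))))
        (jump (.inr p.entry)))
  | .inl 1 => popTest .behind (jump (.inl 1)) (jump (.inl 2))
  | .inl 2 => popTest .fuel (jump (.inl 2)) .halt
  | .inr l => p.code .inr (.inl 1) l

/-- The machine that runs the program `p`. -/
def machine [Fintype V] (p : Prog V) (big out : V) : Turing.FinTM2 where
  K := Stack V
  k₀ := .behind
  k₁ := .reg out
  Γ := Sym
  Λ := Fin 3 ⊕ p.Label
  main := .inl 0
  σ := Option Γ'
  initialState := none
  Γk₀Fin := inferInstanceAs (Fintype Γ')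
  m := p.machineCode big

theorem step_right {Λ : Type} (w : List Γ') {q q' : Code V Λ} {F lp ax} {s : ProgState V}
    {x : Option Γ'} (hs : s.pos < w.length) :
    ∃ y, Turing.TM2.stepAux (.pop .behind (fun _ o => o)
      (.branch Option.isSome (.push .before (fun o => o.getD Γ'.blank) q) q')) x
        (stackOf w F lp ax s) =
      Turing.TM2.stepAux q y (stackOf w F lp ax ⟨s.ctr, s.pos + 1⟩) := by
  refine ⟨some w[s.pos], ?_⟩
  rw [Turing.TM2.stepAux, Turing.TM2.stepAux]
  have : stackOf w F lp ax s .behind = (w[s.pos] :: w.drop (s.pos + 1) : List Γ') := by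
    simp [stackOf]
  rw [this]
  simp only [List.head?_cons, Option.isSome_some, cond_true, List.tail_cons, Turing.TM2.stepAux]
  rw [← stackOf_update_tape' w F lp ax s (s.pos + 1), List.take_succ_eq_append_getElem hs]
  simp only [stackOf, ne_eq, reduceCtorEq, not_false_eq_true, Function.update_of_ne,
    Option.getD_some, List.reverse_append, List.reverse_cons, List.reverse_nil, List.nil_append,
    List.cons_append]

theorem reach_measure (p : Prog V) (big : V) (w : List Γ') (i : ℕ) (hi : i ≤ w.length) :
    Reach (p.machineCode big) ⟨some (.inl 0), none, stackOf w 0 [] 0 ⟨fun _ => 0, 0⟩⟩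
      ⟨some (.inl 0), none,
        stackOf w (4 * i) [] 0 ⟨Function.update (fun _ => 0) big (4 * i), i⟩⟩ i := by
  induction i with
  | zero =>
    have : Function.update (fun _ => 0 : V → ℕ) big (4 * 0) = fun _ => 0 := by
      simp
    rw [this]
    exact Reach.refl _
  | succ i ih =>
    refine (ih (by omega)).trans (Reach.single ?_)
    obtain ⟨y, hy⟩ := step_right w (Λ := Fin 3 ⊕ p.Label)
      (s := ⟨Function.update (fun _ => 0) big (4 * i), i⟩) (F := 4 * i) (lp := []) (ax := 0)
      (x := none)
      (q := charge big (jump (.inl 0)))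
      (q' := (jump (.inr p.entry))) (by simpa using hi)
    refine hy.trans ?_
    rw [charge, push_fuel, push_fuel, push_fuel, push_fuel, push_reg, push_reg, push_reg, push_reg,
      stepAux_jump]
    simp only [ProgState.set_set, ProgState.ctr_set_self, ProgState.set, Function.update_self,
      Function.update_idem]
    rw [show 4 * i + 1 + 1 + 1 + 1 = 4 * (i + 1) by ring]

/-- With the head at the left end the whole tape lies on the stack `behind`, so emptying that stack
erases it. -/
theorem reach_erase_tape (p : Prog V) (big : V) (F : ℕ) (c : V → ℕ) (w : List Γ') :
    Reach (p.machineCode big) ⟨some (.inl 1), none, stackOf w F [] 0 ⟨c, 0⟩⟩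
      ⟨some (.inl 2), none, stackOf [] F [] 0 ⟨c, 0⟩⟩ (w.length + 1) := by
  induction w with
  | nil =>
    refine Reach.single ?_
    rw [machineCode, popTest, Turing.TM2.stepAux, Turing.TM2.stepAux]
    simp [stackOf, stepAux_jump]
  | cons a w ih =>
    refine ((Reach.single ?_).trans ih).mono (by simp; omega)
    rw [machineCode, popTest, Turing.TM2.stepAux, Turing.TM2.stepAux]
    simp [stackOf, stepAux_jump]
    funext k
    cases k <;> simp [stackOf]

theorem reach_erase_fuel (p : Prog V) (big : V) (c : V → ℕ) (F : ℕ) :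
    Reach (p.machineCode big) ⟨some (.inl 2), none, stackOf [] F [] 0 ⟨c, 0⟩⟩
      ⟨none, none, stackOf [] 0 [] 0 ⟨c, 0⟩⟩ (F + 1) := by
  induction F with
  | zero =>
    refine Reach.single ?_
    rw [machineCode, popTest, pop_fuel]
    simp [stackOf]
  | succ F ih =>
    refine ((Reach.single ?_).trans ih).mono (by omega)
    rw [machineCode, popTest, pop_fuel]
    simp [stackOf, stepAux_jump, List.replicate_succ]

/-- The halting configuration of `Turing.haltList` has every stack empty except the output. This is
why the program has to end with all counters but `out` at zero and with the head at the left end. -/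
theorem machine_outputs [Fintype V] (p : Prog V) (big out : V) (w : List Γ') (r : ℕ)
    (h : p.eval w (4 * w.length) ⟨Function.update (fun _ => 0) big (4 * w.length), w.length⟩ =
      ⟨Function.update (fun _ => 0) out r, 0⟩) :
    Nonempty (Turing.TM2OutputsInTime (p.machine big out) w
      (some (List.replicate r true : List Bool))
      (p.cost.eval (4 * w.length) + 6 * w.length + 4)) := by
  have h₁ := reach_measure p big w w.length le_rfl
  have h₂ : Reach (p.machineCode big) ⟨some (.inl 0), none,
        stackOf w (4 * w.length) [] 0 ⟨Function.update (fun _ => 0) big (4 * w.length), w.length⟩⟩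
      ⟨some (.inr p.entry), none,
        stackOf w (4 * w.length) [] 0
          ⟨Function.update (fun _ => 0) big (4 * w.length), w.length⟩⟩ 1 := by
    refine Reach.single ?_
    rw [machineCode, Turing.TM2.stepAux, Turing.TM2.stepAux]
    have : stackOf w (4 * w.length) [] 0
        ⟨Function.update (fun _ => 0) big (4 * w.length), w.length⟩ .behind = [] := by
      simp [stackOf]
    rw [this]
    simp only [List.head?_nil, Option.isSome_none, cond_false, List.tail_nil, stepAux_jump]
    congr 1
    funext k
    cases k <;> simp [stackOf]
  have h₃ := reach_code w (4 * w.length) p (M := p.machineCode big) .inr (.inl 1) (fun l => rfl)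
    ⟨Function.update (fun _ => 0) big (4 * w.length), w.length⟩ [] le_rfl
  rw [h] at h₃
  have h₄ := reach_erase_tape p big (4 * w.length) (Function.update (fun _ => 0) out r) w
  have h₅ := reach_erase_fuel p big (Function.update (fun _ => 0) out r) (4 * w.length)
  obtain ⟨k, hk, e⟩ := ((((h₁.trans h₂).trans h₃).trans h₄).trans h₅).mono
    (t' := p.cost.eval (4 * w.length) + 6 * w.length + 4) (by omega)
  refine ⟨⟨⟨k, ?_⟩, hk⟩⟩
  have i₁ : Turing.initList (p.machine big out) w =
      ⟨some (.inl 0), none, stackOf w 0 [] 0 ⟨fun _ => 0, 0⟩⟩ := by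
    unfold Turing.initList
    congr 1
    funext k
    cases k <;> rfl
  have i₂ : Turing.haltList (p.machine big out) (List.replicate r true : List Bool) =
      ⟨none, none, stackOf [] 0 [] 0 ⟨Function.update (fun _ => 0) out r, 0⟩⟩ := by
    unfold Turing.haltList
    congr 1
    funext k
    cases k with
    | reg u =>
      by_cases hu : u = out
      · subst hu
        have h0 : stackOf [] 0 [] 0 ⟨Function.update (fun _ => 0) u r, 0⟩ (.reg u) =
            List.replicate r true := by simp [stackOf]
        refine Eq.trans ?_ h0.symm
        exact dif_pos rfl
      · have : (Stack.reg u : Stack V) ≠ .reg out := by simpa using hu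
        have h0 : stackOf [] 0 [] 0 ⟨Function.update (fun _ => 0) out r, 0⟩ (.reg u) = [] := by
          simp [stackOf, hu]
        refine Eq.trans ?_ h0.symm
        exact dif_neg this
    | _ => rfl
  rw [i₁]
  exact e.trans (congrArg some i₂).symm

end Prog

/-! ### Counter arithmetic and loop rules. -/

/-- The counters of the rank program. -/
inductive Reg : Type
  | big | n | a | b | rows | i₁ | i₂ | k₁ | k₂ | j | p | cnt | cap | cur | best | new
  deriving DecidableEq

instance : Fintype Reg where
  elems := {.big, .n, .a, .b, .rows, .i₁, .i₂, .k₁, .k₂, .j, .p, .cnt, .cap, .cur, .best, .new}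
  complete r := by cases r <;> decide

namespace Prog

section Generic

variable {V : Type} [DecidableEq V] {w : List Γ'} {F : ℕ}

theorem _root_.ProgState.ctr_set (s : ProgState V) (u v : V) (x : ℕ) :
    (s.set v x).ctr u = if u = v then x else s.ctr u := by
  simp [ProgState.set, Function.update_apply]

theorem eval_inc (v : V) (s : ProgState V) : (inc v).eval w F s = s.set v (s.ctr v + 1) := rfl

theorem eval_dec (v : V) (s : ProgState V) : (dec v).eval w F s = s.set v (s.ctr v - 1) := rfl

/-- The loop rule: `S t` names the state after `t` rounds. As long as the counter does not exceed
`F`, the truncation built into `eval` is invisible. -/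
theorem eval_rep_eq {v : V} {p : Prog V} {s : ProgState V} (hs : s.ctr v ≤ F)
    (S : ℕ → ProgState V) (h₀ : S 0 = s) (h : ∀ t < s.ctr v, p.eval w F (S t) = S (t + 1)) :
    (rep v p).eval w F s = S (s.ctr v) := by
  rw [eval, min_eq_left hs]
  suffices ∀ t ≤ s.ctr v, (p.eval w F)^[t] s = S t from this _ le_rfl
  intro t ht
  induction t with
  | zero => exact h₀.symm
  | succ t ih => rw [Function.iterate_succ_apply', ih (by omega), h t (by omega)]

/-- Add `q` to a counter. -/
def incs (v : V) : ℕ → Prog V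
  | 0 => skip
  | q + 1 => seq (inc v) (incs v q)

theorem eval_incs (v : V) (q : ℕ) (s : ProgState V) :
    (incs v q).eval w F s = s.set v (s.ctr v + q) := by
  induction q generalizing s with
  | zero => simp [incs, eval]
  | succ q ih => rw [incs, eval, eval_inc, ih]; simp [add_assoc, add_comm 1 q]

/-- Set a counter to zero. -/
def clear (v : V) : Prog V := rep v (dec v)

theorem eval_clear {v : V} {s : ProgState V} (hs : s.ctr v ≤ F) :
    (clear v).eval w F s = s.set v 0 := by
  rw [clear, eval_rep_eq hs (fun t => s.set v (s.ctr v - t)) (by simp)]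
  · simp
  · intro t ht
    simp [eval_dec, Nat.sub_sub]

/-- Add `q` times the counter `u` to the counter `v`. -/
def addMul (q : ℕ) (u v : V) : Prog V := rep u (incs v q)

theorem eval_addMul {q : ℕ} {u v : V} {s : ProgState V} (hs : s.ctr u ≤ F) :
    (addMul q u v).eval w F s = s.set v (s.ctr v + q * s.ctr u) := by
  rw [addMul, eval_rep_eq hs (fun t => s.set v (s.ctr v + q * t)) (by simp)]
  intro t ht
  simp [eval_incs, mul_add, add_assoc]

/-- Add the minimum of `u` and `v` to `x`, and set `v` to zero. -/
def addMin (u v x : V) : Prog V :=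
  seq (rep u (ifz v skip (seq (dec v) (inc x)))) (clear v)

theorem eval_addMin {u v x : V} {s : ProgState V} (hu : s.ctr u ≤ F) (hv : s.ctr v ≤ F)
    (hvx : v ≠ x) :
    (addMin u v x).eval w F s = (s.set v 0).set x (s.ctr x + min (s.ctr u) (s.ctr v)) := by
  rw [addMin, eval, eval_rep_eq hu
    (fun t => (s.set v (s.ctr v - t)).set x (s.ctr x + min t (s.ctr v))) (by
      ext r <;> simp [ProgState.set])]
  · rw [eval_clear (by simp [ProgState.ctr_set, hvx]; omega)]
    ext r
    · simp only [ProgState.ctr_set]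
      split_ifs <;> simp_all
    · rfl
  · intro t ht
    rw [eval]
    simp only [ProgState.ctr_set, hvx, if_false, if_true]
    split_ifs with h0
    · rw [eval]
      congr 1
      · congr 1; omega
      · omega
    · rw [eval, eval_dec, eval_inc]
      ext r
      · simp only [ProgState.ctr_set]
        split_ifs <;> simp_all <;> omega
      · rfl

/-- Run `p` for all values of the counter `i` that are less than the counter `lim`. -/
def forLoop (i lim : V) (p : Prog V) : Prog V := seq (rep lim (seq p (inc i))) (clear i)

/-- The invariant `S t` is kept with loop counter zero, and its value `t` is put in only while the
body runs. The final clearing of `i` therefore leads back to a state of the form `S`. -/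
theorem eval_forLoop {i lim : V} {p : Prog V} {s : ProgState V} (hl : s.ctr lim ≤ F)
    (h0 : s.ctr i = 0) (S : ℕ → ProgState V) (hi : ∀ t, (S t).ctr i = 0) (h₀ : S 0 = s)
    (h : ∀ t < s.ctr lim, p.eval w F ((S t).set i t) = (S (t + 1)).set i t) :
    (forLoop i lim p).eval w F s = S (s.ctr lim) := by
  rw [forLoop, eval, eval_rep_eq hl (fun t => (S t).set i t) (by
    rw [h₀, ← h0, ProgState.set_ctr_self]), eval_clear (by simpa using hl)]
  · rw [ProgState.set_set, ← hi (s.ctr lim), ProgState.set_ctr_self]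
  · intro t ht
    rw [eval, h t ht, eval_inc]
    simp

theorem iterate_left (s : ProgState V) (k : ℕ) :
    ((left : Prog V).eval w F)^[k] s = ⟨s.ctr, s.pos - k⟩ := by
  induction k with
  | zero => rfl
  | succ k ih => rw [Function.iterate_succ_apply', ih]; simp [eval, Nat.sub_sub]

theorem iterate_right (s : ProgState V) (hs : s.pos ≤ w.length) (k : ℕ) :
    ((right : Prog V).eval w F)^[k] s = ⟨s.ctr, min (s.pos + k) w.length⟩ := by
  induction k with
  | zero => ext <;> simp [hs]
  | succ k ih =>
    rw [Function.iterate_succ_apply', ih]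
    ext
    · rfl
    · simp only [eval]; omega

/-- Move the head to the left end, if the counter `big` is large. -/
def rewind (big : V) : Prog V := rep big left

theorem eval_rewind {big : V} {c : V → ℕ} {i : ℕ} (hb : c big = F) (hs : i ≤ F) :
    (rewind big).eval w F ⟨c, i⟩ = ⟨c, 0⟩ := by
  rw [rewind, eval, iterate_left]
  simp [hb, hs]

/-- Skip all ones to the right of the head, counting them by `p`, and then the next symbol. -/
def readUnary (big : V) (p : Prog V) : Prog V :=
  seq (rep big (ifOne (seq right p) skip)) right

theorem eval_rep_right {v : V} {c : V → ℕ} {i : ℕ} (hv : c v ≤ F) (hi : i ≤ w.length) :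
    (rep v right).eval w F ⟨c, i⟩ = ⟨c, min (i + c v) w.length⟩ := by
  rw [eval, min_eq_left hv, iterate_right _ hi]

theorem eval_readUnary {big : V} {c : V → ℕ} {i : ℕ} (hb : c big = F) {pre post : List Γ'} {k : ℕ}
    (hw : w = pre ++ (encodeUnary k ++ post)) (hk : k ≤ F) (hi : i = pre.length)
    (p : Prog V) (S : ℕ → V → ℕ) (h₀ : S 0 = c)
    (hp : ∀ t < k, ∀ i, p.eval w F ⟨S t, i⟩ = ⟨S (t + 1), i⟩) :
    (readUnary big p).eval w F ⟨c, i⟩ = ⟨S k, pre.length + k + 1⟩ := by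
  have hlen : w.length = pre.length + (k + 1 + post.length) := by
    simp [hw, encodeUnary]; omega
  subst hi
  -- After `k` rounds the head rests on the separator and the remaining rounds of the long loop do
  -- nothing; the last `right` then skips the separator.
  rw [readUnary, eval, eval_rep_eq (by exact hb.le) (fun t => ⟨S (min t k), pre.length + min t k⟩)
    (by ext <;> simp [h₀])]
  · simp only [hb, min_eq_right hk]
    rw [eval]
    congr 1
    simp only
    omega
  · intro t _
    rw [eval]
    rcases lt_or_ge t k with ht | ht
    · rw [min_eq_left ht.le, min_eq_left (by omega : t + 1 ≤ k), if_pos, eval, eval, hp t ht]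
      · congr 1
        simp only
        omega
      · simp only [hw, encodeUnary]
        rw [List.getElem?_append_right (by omega), Nat.add_sub_cancel_left,
          List.getElem?_append_left (by simp; omega), List.getElem?_append_left (by simpa),
          List.getElem?_replicate_of_lt ht]
    · rw [min_eq_right ht, min_eq_right (by omega : k ≤ t + 1), if_neg, eval]
      simp only [hw, encodeUnary]
      rw [List.getElem?_append_right (by omega), Nat.add_sub_cancel_left,
          List.getElem?_append_left (by simp), List.getElem?_append_right (by simp)]
      simp

end Generic

end Prog

/-! ### The candidate bounds and the layout of the input word. -/

/-- Membership in `X`, for natural numbers as indices. -/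
def HasEntry {m n : ℕ} (X : Finset (Fin m × Fin n)) (i j : ℕ) : Prop :=
  ∃ (hi : i < m) (hj : j < n), (⟨i, hi⟩, ⟨j, hj⟩) ∈ X

open Classical in
/-- The number of elements of `X` in the column `j`. -/
noncomputable def columnCount {m n : ℕ} (X : Finset (Fin m × Fin n)) (j : ℕ) : ℕ :=
  ((Finset.range m).filter fun i => HasEntry X i j).card

/-- The bound for the rank of `X` that comes from `q` and the numbers `c j`. -/
noncomputable def rankBound {m n : ℕ} (a b : ℕ) (X : Finset (Fin m × Fin n)) (q : ℕ) (c : ℕ → ℕ) : ℕ :=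
  q * b + ∑ j ∈ Finset.range n, min (columnCount X j) (a + c j)

open Classical in
/-- The indicator function of `X`. -/
noncomputable def entryBit {m n : ℕ} (X : Finset (Fin m × Fin n)) (i j : ℕ) : ℕ :=
  if HasEntry X i j then 1 else 0

theorem columnCount_le {m n : ℕ} (X : Finset (Fin m × Fin n)) (j : ℕ) : columnCount X j ≤ m := by
  classical
  exact (Finset.card_filter_le _ _).trans (by simp)

theorem List.getElem?_flatMap_of_length {α β : Type*} (f : α → List β) (c : ℕ)
    (hf : ∀ x, (f x).length = c) (l : List α) (p j : ℕ) (hj : j < c) :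
    (l.flatMap f)[p * c + j]? = l[p]?.bind fun x => (f x)[j]? := by
  induction l generalizing p with
  | nil => simp
  | cons x l ih =>
    cases p with
    | zero =>
      have : j < (f x).length := (hf x).symm ▸ hj
      simp [List.flatMap_cons, List.getElem?_append_left this]
    | succ p =>
      rw [List.flatMap_cons, List.getElem?_append_right (by rw [hf, add_mul]; omega), hf,
        show (p + 1) * c + j - c = p * c + j by rw [add_mul]; omega, ih]
      simp

theorem length_encodeUnary (k : ℕ) : (encodeUnary k).length = k + 1 := by simp [encodeUnary]

theorem length_encodeInput {m n a b : ℕ} (X : Finset (Fin m × Fin n)) :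
    (encodeInput m n a b X).length = m + n + a + b + 4 + m * (n + 1) := by
  simp [encodeInput, length_encodeUnary]
  ring

/-- This holds for all `i`: for `i ≥ m` the position lies beyond the end of the tape, so the added
rows up to `a + 3` are read as empty. -/
theorem getElem?_encodeInput {m n a b : ℕ} (X : Finset (Fin m × Fin n)) (i j : ℕ) (hj : j < n) :
    (encodeInput m n a b X)[m + n + a + b + 4 + i * (n + 1) + j]? = some (Γ'.bit true) ↔
      HasEntry X i j := by
  rw [encodeInput, List.getElem?_append_right (by simp [length_encodeUnary]; ring_nf; omega)]
  have : m + n + a + b + 4 + i * (n + 1) + j -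
      (encodeUnary m ++ encodeUnary n ++ encodeUnary a ++ encodeUnary b).length =
      i * (n + 1) + j := by
    simp [length_encodeUnary]
    omega
  rw [this, List.getElem?_flatMap_of_length _ (n + 1) (by simp) _ _ _ (by omega)]
  rcases lt_or_ge i m with hi | hi
  · simp [hi, hj, HasEntry, List.getElem?_append_left]
  · simp [HasEntry, hi]

/-! ### The program that computes the rank. -/

namespace Prog

/-- Move the head behind the four numbers at the beginning of the tape. -/
def skipHeader : Prog Reg :=
  seq (readUnary .big skip) (seq (readUnary .big skip)
    (seq (readUnary .big skip) (readUnary .big skip)))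

/-- Look up the entry of the matrix in the row `u` and the column `v`, with the head at the left end
before and after. -/
def ifEntry (u v : Reg) (p q : Prog Reg) : Prog Reg :=
  seq skipHeader (seq (rep u (seq (rep .n right) right)) (seq (rep v right)
    (ifOne (seq (rewind .big) p) (seq (rewind .big) q))))

/-- Read the four numbers at the beginning of the tape and move the head to the left end. -/
def parse : Prog Reg :=
  seq (rewind .big) (seq (readUnary .big skip) (seq (readUnary .big (inc .n))
    (seq (readUnary .big (inc .a)) (seq (readUnary .big (inc .b))
      (seq (rewind .big) (seq (addMul 1 .a .rows) (incs .rows 3)))))))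

/-- Add the minimum of the number of entries in the column `j` and of `a` plus the number computed
by `c` to `cur`. -/
def column (c : Prog Reg) : Prog Reg :=
  seq (forLoop .p .rows (ifEntry .p .j (inc .cnt) skip))
    (seq (addMul 1 .a .cap) (seq c (seq (addMin .cnt .cap .cur) (clear .cnt))))

/-- Replace `best` by the minimum of `best` and `cur`, and set `cur` to zero. -/
def updateBest : Prog Reg :=
  seq (addMin .best .cur .new) (seq (clear .best) (seq (addMul 1 .new .best) (clear .new)))

/-- Take the bound given by `q` and `c` into account. -/
def bound (q : ℕ) (c : Prog Reg) : Prog Reg :=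
  seq (addMul q .b .cur) (seq (forLoop .j .n (column c)) updateBest)

/-- Add the entry in the row `u` and the current column to `cap`. -/
def addEntry (u : Reg) : Prog Reg := ifEntry u .j (inc .cap) skip

/-- Add one to `cap` if one of the entries in the rows `u` and `v` of the current column and one of
the entries in the rows `u'` and `v'` is one. -/
def addCross (u v u' v' : Reg) : Prog Reg :=
  let q := ifEntry u' .j (inc .cap) (ifEntry v' .j (inc .cap) skip)
  ifEntry u .j q (ifEntry v .j q skip)

/-- Minimize over all bounds. -/
def minimize : Prog Reg :=
  seq (bound 0 (incs .cap 3)) (seq (bound 3 skip)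
    (forLoop .i₁ .rows (seq (bound 2 (addEntry .i₁)) (forLoop .i₂ .i₁
      (seq (bound 1 (seq (addEntry .i₁) (addEntry .i₂))) (forLoop .k₁ .rows (forLoop .k₂ .k₁
        (bound 2 (addCross .i₁ .i₂ .k₁ .k₂)))))))))

/-- The program that computes the rank. -/
def rankProg : Prog Reg :=
  seq parse (seq (addMul 1 .big .best) (seq minimize (seq (clear .n) (seq (clear .a)
    (seq (clear .b) (seq (clear .rows) (clear .big)))))))

/-! ### Reading the header and the entries of the matrix. -/

section Semantics

variable {m n a b : ℕ} (X : Finset (Fin m × Fin n))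

/-- The head is at the left end, and the parameters of the problem are stored. -/
structure Ready (X : Finset (Fin m × Fin n)) (a b : ℕ) (s : ProgState Reg) : Prop where
  pos_eq : s.pos = 0
  big_eq : s.ctr .big = 4 * (encodeInput m n a b X).length
  n_eq : s.ctr .n = n
  a_eq : s.ctr .a = a
  b_eq : s.ctr .b = b
  rows_eq : s.ctr .rows = a + 3

/-- Shorthand for the evaluation on the given input. -/
noncomputable def run (X : Finset (Fin m × Fin n)) (a b : ℕ) (p : Prog Reg) :
    ProgState Reg → ProgState Reg :=
  p.eval (encodeInput m n a b X) (4 * (encodeInput m n a b X).length)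

variable {X}

theorem eval_header {s : ProgState Reg} (hs : s.pos = 0)
    (hb : s.ctr .big = 4 * (encodeInput m n a b X).length)
    (p₁ p₂ p₃ : Prog Reg) (S₁ S₂ S₃ : ℕ → Reg → ℕ)
    (h₁ : S₁ 0 = s.ctr) (h₂ : S₂ 0 = S₁ n) (h₃ : S₃ 0 = S₂ a)
    (hb₁ : S₁ n .big = s.ctr .big) (hb₂ : S₂ a .big = s.ctr .big)
    (hp₁ : ∀ t < n, ∀ i, run X a b p₁ ⟨S₁ t, i⟩ = ⟨S₁ (t + 1), i⟩)
    (hp₂ : ∀ t < a, ∀ i, run X a b p₂ ⟨S₂ t, i⟩ = ⟨S₂ (t + 1), i⟩)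
    (hp₃ : ∀ t < b, ∀ i, run X a b p₃ ⟨S₃ t, i⟩ = ⟨S₃ (t + 1), i⟩) :
    run X a b (seq (readUnary .big skip) (seq (readUnary .big p₁)
      (seq (readUnary .big p₂) (readUnary .big p₃)))) s = ⟨S₃ b, m + n + a + b + 4⟩ := by
  have hlen := length_encodeInput (a := a) (b := b) X
  unfold run at *
  obtain ⟨c, i⟩ := s
  obtain rfl : i = 0 := hs
  dsimp only at hb h₁ hb₁ hb₂
  obtain ⟨rest, hw⟩ : ∃ rest, encodeInput m n a b X =
      encodeUnary m ++ (encodeUnary n ++ (encodeUnary a ++ (encodeUnary b ++ rest))) :=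
    ⟨_, by rw [encodeInput]; simp only [List.append_assoc]; rfl⟩
  rw [eval, eval_readUnary (i := 0) hb (pre := []) (k := m) (by rw [hw]; rfl) (by omega) rfl _
    (fun _ => c) rfl (by intro t _ i; rfl), eval,
    eval_readUnary hb (pre := encodeUnary m) (k := n) hw (by omega)
      (by simp [length_encodeUnary]) _ S₁ h₁ hp₁, eval,
    eval_readUnary (hb₁.trans hb) (pre := encodeUnary m ++ encodeUnary n) (k := a)
      (post := encodeUnary b ++ rest)
      (by rw [hw]; simp only [List.append_assoc]) (by omega)
      (by simp [length_encodeUnary]; try omega) _ S₂ h₂ hp₂,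
    eval_readUnary (hb₂.trans hb) (pre := encodeUnary m ++ encodeUnary n ++ encodeUnary a) (k := b)
      (post := rest)
      (by rw [hw]; simp only [List.append_assoc]) (by omega)
      (by simp [length_encodeUnary]; try omega) _ S₃ h₃ hp₃]
  congr 1
  simp [length_encodeUnary]
  omega

open Classical in
theorem run_ifEntry {s : ProgState Reg} (hs : Ready X a b s) {u v : Reg} {p q : Prog Reg}
    (hu : s.ctr u ≤ 4 * (encodeInput m n a b X).length) (hv : s.ctr v < n) :
    run X a b (ifEntry u v p q) s =
      if HasEntry X (s.ctr u) (s.ctr v) then run X a b p s else run X a b q s := by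
  have hlen := length_encodeInput (a := a) (b := b) X
  have h₀ : run X a b skipHeader s = ⟨s.ctr, m + n + a + b + 4⟩ :=
    eval_header hs.pos_eq hs.big_eq _ _ _ (fun _ => s.ctr) (fun _ => s.ctr) (fun _ => s.ctr) rfl rfl rfl
      rfl rfl (by intros; rfl) (by intros; rfl) (by intros; rfl)
  have hbig := hs.big_eq
  have hn := hs.n_eq
  have hnF : n ≤ 4 * (encodeInput m n a b X).length := by omega
  unfold run at *
  rw [ifEntry, eval, h₀, eval]
  set w := encodeInput m n a b X
  rw [eval_rep_eq (by exact hu)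
    (fun t => ⟨s.ctr, min (m + n + a + b + 4 + t * (n + 1)) w.length⟩) (by
      ext
      · rfl
      · simp; omega)]
  · rw [eval, eval_rep_right (by omega) (min_le_right _ _)]
    have e : min (min (m + n + a + b + 4 + s.ctr u * (n + 1)) w.length + s.ctr v) w.length =
      min (m + n + a + b + 4 + s.ctr u * (n + 1) + s.ctr v) w.length := by omega
    -- A head that would run off the tape stops at the end, where no symbol is read; the same holds
    -- for the true position, so the truncation does no harm.
    have g : w[min (m + n + a + b + 4 + s.ctr u * (n + 1) + s.ctr v) w.length]? =
        w[m + n + a + b + 4 + s.ctr u * (n + 1) + s.ctr v]? := by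
      rcases le_total (m + n + a + b + 4 + s.ctr u * (n + 1) + s.ctr v) w.length with h | h
      · rw [min_eq_left h]
      · rw [min_eq_right h, List.getElem?_eq_none le_rfl, List.getElem?_eq_none h]
    simp only [e]
    rw [eval]
    simp only [g]
    have hs' : (⟨s.ctr, 0⟩ : ProgState Reg) = s := by ext <;> simp [hs.pos_eq]
    rw [if_congr (getElem?_encodeInput X _ _ hv) rfl rfl, eval, eval,
      eval_rewind hbig (by omega), hs']
  · intro t _
    rw [eval, eval, eval]
    simp only [hn]
    rw [min_eq_left hnF, iterate_right _ (min_le_right _ _)]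
    congr 1
    simp only
    rw [add_mul]
    omega

end Semantics

end Prog

/-! ### Evaluation of a single bound. -/

namespace Prog

variable {m n a b : ℕ} {X : Finset (Fin m × Fin n)}

/-- The counters that hold the parameters of the problem. -/
def _root_.Reg.isParam : Reg → Bool
  | .big | .n | .a | .b | .rows => true
  | _ => false

theorem Ready.set {s : ProgState Reg} (hs : Ready X a b s) {v : Reg} (hv : v.isParam = false)
    (x : ℕ) : Ready X a b (s.set v x) := by
  have h : ∀ u : Reg, u.isParam = true → (s.set v x).ctr u = s.ctr u := by
    intro u hu
    rw [ProgState.ctr_set, if_neg]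
    rintro rfl
    simp [hu] at hv
  exact ⟨hs.pos_eq, (h _ rfl).trans hs.big_eq, (h _ rfl).trans hs.n_eq, (h _ rfl).trans hs.a_eq,
    (h _ rfl).trans hs.b_eq, (h _ rfl).trans hs.rows_eq⟩

/-- The program `p` adds `c j` to the counter `cap`. -/
def AddsToCap (X : Finset (Fin m × Fin n)) (a b : ℕ) (p : Prog Reg) (s : ProgState Reg)
    (c : ℕ → ℕ) : Prop :=
  ∀ st : ProgState Reg, Ready X a b st → st.ctr .i₁ = s.ctr .i₁ → st.ctr .i₂ = s.ctr .i₂ →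
    st.ctr .k₁ = s.ctr .k₁ → st.ctr .k₂ = s.ctr .k₂ → st.ctr .j < n →
    run X a b p st = st.set .cap (st.ctr .cap + c (st.ctr .j))

/-- The auxiliary counters are zero. -/
structure Clean (s : ProgState Reg) : Prop where
  cnt_eq : s.ctr .cnt = 0
  cap_eq : s.ctr .cap = 0
  p_eq : s.ctr .p = 0
  cur_eq : s.ctr .cur = 0
  new_eq : s.ctr .new = 0
  j_eq : s.ctr .j = 0

theorem run_seq (p q : Prog Reg) (s : ProgState Reg) :
    run X a b (seq p q) s = run X a b q (run X a b p s) := rfl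

open Classical in
-- The loop runs over `a + 3` rows instead of `m`, because only `a + 3` is stored; the additional
-- rows contain no entry.
theorem run_countColumn (hm : m ≤ a + 3) {s : ProgState Reg} (hs : Ready X a b s)
    (hj : s.ctr .j < n) (hp : s.ctr .p = 0) (hc : s.ctr .cnt = 0) :
    run X a b (forLoop .p .rows (ifEntry .p .j (inc .cnt) skip)) s =
      s.set .cnt (columnCount X (s.ctr .j)) := by
  have hlen := length_encodeInput (a := a) (b := b) X
  have hr := hs.rows_eq
  have key := eval_forLoop (w := encodeInput m n a b X)
    (F := 4 * (encodeInput m n a b X).length) (i := .p) (lim := .rows)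
    (p := ifEntry .p .j (inc .cnt) skip) (s := s) (by omega) hp
    (fun t => s.set .cnt ((Finset.range t).filter fun i => HasEntry X i (s.ctr .j)).card)
    (fun t => by simp [ProgState.ctr_set, hp]) (by
      simp only [Finset.range_zero, Finset.filter_empty, Finset.card_empty]
      rw [← hc, ProgState.set_ctr_self]) (by
      intro t ht
      have e := run_ifEntry (X := X) (a := a) (b := b)
        (s := (s.set .cnt ((Finset.range t).filter fun i => HasEntry X i (s.ctr .j)).card).set .p t)
        ((hs.set rfl _).set rfl _) (u := .p) (v := .j) (p := inc .cnt) (q := skip)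
        (by simp only [ProgState.ctr_set, if_true]; omega)
        (by simpa [ProgState.ctr_set] using hj)
      rw [run] at e
      rw [e]
      simp only [ProgState.ctr_set, if_true, reduceCtorEq, if_false]
      rw [Finset.range_add_one, Finset.filter_insert]
      split_ifs with h
      · rw [Finset.card_insert_of_notMem (by simp), run, eval_inc]
        ext r
        · simp only [ProgState.ctr_set, if_true, reduceCtorEq, if_false]
          split_ifs <;> simp_all
        · rfl
      · rfl)
  rw [run, key, hr, columnCount]
  congr 2
  ext i
  simp only [Finset.mem_filter, Finset.mem_range]
  constructor
  · rintro ⟨_, h⟩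
    exact ⟨h.1, h⟩
  · rintro ⟨h, h'⟩
    exact ⟨by omega, h'⟩

theorem run_column (hm : m ≤ a + 3) {s : ProgState Reg} (hs : Ready X a b s) {p : Prog Reg}
    {c : ℕ → ℕ} (hp : AddsToCap X a b p s c) (hc : ∀ j, c j ≤ 3)
    (hj : s.ctr .j < n) (hp0 : s.ctr .p = 0) (hc0 : s.ctr .cnt = 0) (hcap : s.ctr .cap = 0) :
    run X a b (column p) s =
      s.set .cur (s.ctr .cur + min (columnCount X (s.ctr .j)) (a + c (s.ctr .j))) := by
  have hlen := length_encodeInput (a := a) (b := b) X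
  have hT := columnCount_le X (s.ctr .j)
  have hc' := hc (s.ctr .j)
  have ha := hs.a_eq
  rw [column, run_seq, run_countColumn hm hs hj hp0 hc0, run_seq]
  have e₁ : run X a b (addMul 1 .a .cap) (s.set .cnt (columnCount X (s.ctr .j))) =
      (s.set .cnt (columnCount X (s.ctr .j))).set .cap a := by
    rw [run, eval_addMul (by simp [ProgState.ctr_set]; omega)]
    simp [ProgState.ctr_set, hcap, ha]
  rw [e₁, run_seq, hp _ ((hs.set rfl _).set rfl _) (by simp [ProgState.ctr_set])
    (by simp [ProgState.ctr_set]) (by simp [ProgState.ctr_set]) (by simp [ProgState.ctr_set])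
    (by simpa [ProgState.ctr_set] using hj), run_seq]
  simp only [ProgState.ctr_set, if_true, reduceCtorEq, if_false, ProgState.set_set]
  rw [run, run, eval_addMin (by simp [ProgState.ctr_set]; omega)
    (by simp [ProgState.ctr_set]; omega) (by decide), eval_clear (by simp [ProgState.ctr_set]; omega)]
  ext r
  · simp only [ProgState.ctr_set, if_true, reduceCtorEq, if_false]
    split_ifs <;> simp_all
  · rfl

theorem rankBound_le (q : ℕ) (hq : q ≤ 3) (c : ℕ → ℕ) :
    rankBound a b X q c ≤ 3 * b + n * m := by
  rw [rankBound]
  gcongr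
  calc ∑ j ∈ Finset.range n, min (columnCount X j) (a + c j)
      ≤ ∑ j ∈ Finset.range n, m :=
        Finset.sum_le_sum fun j _ => (min_le_left _ _).trans (columnCount_le X j)
    _ = n * m := by simp

theorem run_bound (hm : m ≤ a + 3) {s : ProgState Reg} (hs : Ready X a b s) (hcl : Clean s)
    {q : ℕ} (hq : q ≤ 3) {p : Prog Reg} {c : ℕ → ℕ} (hp : AddsToCap X a b p s c)
    (hc : ∀ j, c j ≤ 3) (hbest : s.ctr .best ≤ 4 * (encodeInput m n a b X).length) :
    run X a b (bound q p) s = s.set .best (min (s.ctr .best) (rankBound a b X q c)) := by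
  have hlen := length_encodeInput (a := a) (b := b) X
  have hle := rankBound_le (a := a) (b := b) (X := X) q hq c
  -- The loop bound has to leave room for the term `3 * b`; the factor four in front of the length
  -- of the tape provides it.
  have hle' : rankBound a b X q c ≤ 4 * (encodeInput m n a b X).length := by
    rw [hlen]; nlinarith
  have hb := hs.b_eq
  have hn := hs.n_eq
  have hcur := hcl.cur_eq
  have e₁ : run X a b (addMul q .b .cur) s = s.set .cur (q * b) := by
    rw [run, eval_addMul (by omega), hcur, hb, zero_add]
  have e₂ : run X a b (forLoop .j .n (column p)) (s.set .cur (q * b)) =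
      s.set .cur (rankBound a b X q c) := by
    have key := eval_forLoop (w := encodeInput m n a b X)
      (F := 4 * (encodeInput m n a b X).length) (i := .j) (lim := .n)
      (p := column p) (s := s.set .cur (q * b)) (by simp [ProgState.ctr_set]; omega)
      (by simp [ProgState.ctr_set, hcl.j_eq])
      (fun t => s.set .cur (q * b + ∑ j ∈ Finset.range t, min (columnCount X j) (a + c j)))
      (fun t => by simp [ProgState.ctr_set, hcl.j_eq]) (by simp) (by
        intro t ht
        have e := run_column hm (s := (s.set .cur
          (q * b + ∑ j ∈ Finset.range t, min (columnCount X j) (a + c j))).set .j t)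
          ((hs.set rfl _).set rfl _) (p := p) (c := c)
          (by
            intro s' h h₁ h₂ h₃ h₄ h₅
            simp only [ProgState.ctr_set, reduceCtorEq, if_false] at h₁ h₂ h₃ h₄
            exact hp s' h h₁ h₂ h₃ h₄ h₅)
          hc (by simpa [ProgState.ctr_set, hn] using ht) (by simp [ProgState.ctr_set, hcl.p_eq])
          (by simp [ProgState.ctr_set, hcl.cnt_eq]) (by simp [ProgState.ctr_set, hcl.cap_eq])
        rw [run] at e
        rw [e, Finset.sum_range_succ]
        ext r
        · simp only [ProgState.ctr_set, if_true, reduceCtorEq, if_false]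
          split_ifs <;> simp_all [add_assoc]
        · rfl)
    rw [run, key]
    simp [ProgState.ctr_set, hn, rankBound]
  rw [bound, run_seq, e₁, run_seq, e₂, updateBest, run_seq, run_seq, run_seq]
  have hnew := hcl.new_eq
  rw [run, run, run, run, eval_addMin (by simpa [ProgState.ctr_set] using hbest)
    (by simpa [ProgState.ctr_set] using hle') (by decide)]
  rw [eval_clear (v := Reg.best), eval_addMul, eval_clear (v := Reg.new)]
  rotate_left
  · simp [ProgState.ctr_set]; omega
  · simp [ProgState.ctr_set]; omega
  · simpa [ProgState.ctr_set] using hbest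
  ext r
  · simp only [ProgState.ctr_set, if_true, reduceCtorEq, if_false]
    split_ifs <;> simp_all
  · rfl

end Prog

/-! ### Minimization over all bounds. -/

namespace Prog

variable {m n a b : ℕ} {X : Finset (Fin m × Fin n)}

theorem addsToCap_skip (s : ProgState Reg) : AddsToCap X a b skip s fun _ => 0 := by
  intro s' _ _ _ _ _ _
  simp [run, eval]

theorem addsToCap_incs (q : ℕ) (s : ProgState Reg) : AddsToCap X a b (incs .cap q) s fun _ => q := by
  intro s' _ _ _ _ _ _
  rw [run, eval_incs]

/-- The counters that hold row indices. -/
def _root_.Reg.isIndex : Reg → Bool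
  | .i₁ | .i₂ | .k₁ | .k₂ => true
  | _ => false

theorem AddsToCap.ctr_eq {s s' : ProgState Reg} (h₁ : s'.ctr .i₁ = s.ctr .i₁)
    (h₂ : s'.ctr .i₂ = s.ctr .i₂) (h₃ : s'.ctr .k₁ = s.ctr .k₁) (h₄ : s'.ctr .k₂ = s.ctr .k₂)
    {u : Reg} (hu : u.isIndex = true) : s'.ctr u = s.ctr u := by
  cases u <;> simp_all [Reg.isIndex]

open Classical in
theorem AddsToCap.ifEntry {s : ProgState Reg} {p q : Prog Reg} {c d : ℕ → ℕ}
    (hp : AddsToCap X a b p s c) (hq : AddsToCap X a b q s d) {u : Reg} (hu : u.isIndex = true)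
    (hu' : s.ctr u ≤ a + 3) :
    AddsToCap X a b (ifEntry u .j p q) s
      fun j => if HasEntry X (s.ctr u) j then c j else d j := by
  have hlen := length_encodeInput (a := a) (b := b) X
  intro s' hs h₁ h₂ h₃ h₄ h₅
  have e := AddsToCap.ctr_eq h₁ h₂ h₃ h₄ hu
  rw [run_ifEntry hs (by omega) h₅, e]
  dsimp only
  split_ifs
  · exact hp s' hs h₁ h₂ h₃ h₄ h₅
  · exact hq s' hs h₁ h₂ h₃ h₄ h₅

theorem AddsToCap.seq {s : ProgState Reg} {p q : Prog Reg} {c d : ℕ → ℕ}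
    (hp : AddsToCap X a b p s c) (hq : AddsToCap X a b q s d) :
    AddsToCap X a b (seq p q) s fun j => c j + d j := by
  intro s' hs h₁ h₂ h₃ h₄ h₅
  rw [run_seq, hp s' hs h₁ h₂ h₃ h₄ h₅, hq _ (hs.set rfl _)]
  · simp [ProgState.ctr_set, add_assoc]
  all_goals simpa [ProgState.ctr_set]

theorem addsToCap_inc (s : ProgState Reg) : AddsToCap X a b (inc .cap) s fun _ => 1 := by
  intro s' _ _ _ _ _ _
  rw [run, eval_inc]

theorem addsToCap_addEntry {s : ProgState Reg} {u : Reg} (hu : u.isIndex = true)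
    (hle : s.ctr u ≤ a + 3) :
    AddsToCap X a b (addEntry u) s fun j => entryBit X (s.ctr u) j :=
  (addsToCap_inc s).ifEntry (addsToCap_skip s) hu hle

/-- The numbers that belong to two pairs of rows. -/
noncomputable def _root_.crossBit (X : Finset (Fin m × Fin n)) (i i' k k' j : ℕ) : ℕ :=
  min (max (entryBit X i j) (entryBit X i' j)) (max (entryBit X k j) (entryBit X k' j))

theorem addsToCap_addCross {s : ProgState Reg} (h₁ : s.ctr .i₁ ≤ a + 3) (h₂ : s.ctr .i₂ ≤ a + 3)
    (h₃ : s.ctr .k₁ ≤ a + 3) (h₄ : s.ctr .k₂ ≤ a + 3) :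
    AddsToCap X a b (addCross .i₁ .i₂ .k₁ .k₂) s
      (crossBit X (s.ctr .i₁) (s.ctr .i₂) (s.ctr .k₁) (s.ctr .k₂)) := by
  have hq := (addsToCap_inc (X := X) (a := a) (b := b) s).ifEntry
    ((addsToCap_inc s).ifEntry (addsToCap_skip s) (u := .k₂) rfl h₄) (u := .k₁) rfl h₃
  have h := hq.ifEntry (hq.ifEntry (addsToCap_skip s) (u := .i₂) rfl h₂) (u := .i₁) rfl h₁
  convert h using 1
  · rfl
  funext j
  simp only [crossBit, entryBit]
  split_ifs <;> rfl

theorem crossBit_le (i i' k k' j : ℕ) : crossBit X i i' k k' j ≤ 1 := by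
  refine (min_le_left _ _).trans (max_le ?_ ?_) <;> rw [entryBit] <;> split_ifs <;> simp

theorem _root_.entryBit_le (i j : ℕ) : entryBit X i j ≤ 1 := by
  rw [entryBit]; split_ifs <;> simp

/-- The program `p` replaces `best` by the minimum of `best` and of the elements of `C`. -/
def Minimizes (X : Finset (Fin m × Fin n)) (a b : ℕ) (p : Prog Reg) (s : ProgState Reg)
    (C : Set ℕ) : Prop :=
  ∃ r, run X a b p s = s.set .best r ∧ IsLeast (insert (s.ctr .best) C) r

theorem minimizes_bound (hm : m ≤ a + 3) {s : ProgState Reg} (hs : Ready X a b s) (hcl : Clean s)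
    {q : ℕ} (hq : q ≤ 3) {p : Prog Reg} {c : ℕ → ℕ} (hp : AddsToCap X a b p s c)
    (hc : ∀ j, c j ≤ 3) (hbest : s.ctr .best ≤ 4 * (encodeInput m n a b X).length) :
    Minimizes X a b (bound q p) s {rankBound a b X q c} :=
  ⟨_, run_bound hm hs hcl hq hp hc hbest, isLeast_pair⟩

/-- The assumptions on the state in which the programs for the minimization are run. -/
structure Fit (X : Finset (Fin m × Fin n)) (a b : ℕ) (s : ProgState Reg) : Prop extends
    Ready X a b s, Clean s where
  best_le : s.ctr .best ≤ 4 * (encodeInput m n a b X).length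

theorem Fit.set_best {s : ProgState Reg} (h : Fit X a b s) {r : ℕ} (hr : r ≤ s.ctr .best) :
    Fit X a b (s.set .best r) := by
  refine ⟨h.toReady.set rfl _, ⟨?_, ?_, ?_, ?_, ?_, ?_⟩, ?_⟩
  all_goals simp only [ProgState.ctr_set, reduceCtorEq, if_false, if_true]
  exacts [h.cnt_eq, h.cap_eq, h.p_eq, h.cur_eq, h.new_eq, h.j_eq, hr.trans h.best_le]

theorem Fit.set_index {s : ProgState Reg} (h : Fit X a b s) {v : Reg} (hv : v.isIndex = true)
    (x : ℕ) : Fit X a b (s.set v x) := by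
  have h' : ∀ u : Reg, u.isIndex = false → (s.set v x).ctr u = s.ctr u := by
    intro u hu
    rw [ProgState.ctr_set, if_neg]
    rintro rfl
    simp [hu] at hv
  refine ⟨h.toReady.set (by cases v <;> simp_all [Reg.isIndex, Reg.isParam]) _,
    ⟨?_, ?_, ?_, ?_, ?_, ?_⟩, ?_⟩
  all_goals rw [h' _ rfl]
  exacts [h.cnt_eq, h.cap_eq, h.p_eq, h.cur_eq, h.new_eq, h.j_eq, h.best_le]

theorem Minimizes.seq {p q : Prog Reg} {s : ProgState Reg} {C D : Set ℕ}
    (hp : Minimizes X a b p s C)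
    (hq : ∀ r ≤ s.ctr .best, Minimizes X a b q (s.set .best r) D) :
    Minimizes X a b (seq p q) s (C ∪ D) := by
  obtain ⟨r, hr, hr'⟩ := hp
  obtain ⟨r₂, h₂, h₂'⟩ := hq r (hr'.2 (Set.mem_insert _ _))
  refine ⟨r₂, by rw [run_seq, hr, h₂, ProgState.set_set], ?_, ?_⟩
  · rcases h₂'.1 with h | h
    · rw [ProgState.ctr_set, if_pos rfl] at h
      rw [h]
      rcases hr'.1 with h | h
      · exact Or.inl h
      · exact Or.inr (Or.inl h)
    · exact Or.inr (Or.inr h)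
  · have hle : r₂ ≤ r := by simpa [ProgState.ctr_set] using h₂'.2 (Set.mem_insert _ _)
    rintro x (hx | hx | hx)
    · exact hle.trans (hr'.2 (Or.inl hx))
    · exact hle.trans (hr'.2 (Or.inr hx))
    · exact h₂'.2 (Or.inr hx)

/-- A loop minimizes over the union of what its rounds minimize over. The running minimum `g` is
defined by recursion; the values `f` chosen for irrelevant arguments are arbitrary. -/
theorem Minimizes.forLoop {p : Prog Reg} {s : ProgState Reg} {i lim : Reg}
    (hi : i.isIndex = true) (h0 : s.ctr i = 0)
    (hl : s.ctr lim ≤ 4 * (encodeInput m n a b X).length) (C : ℕ → Set ℕ)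
    (h : ∀ t < s.ctr lim, ∀ r ≤ s.ctr .best, Minimizes X a b p ((s.set .best r).set i t) (C t)) :
    Minimizes X a b (forLoop i lim p) s (⋃ t < s.ctr lim, C t) := by
  have hib : i ≠ .best := by rintro rfl; simp [Reg.isIndex] at hi
  have hstep : ∀ t r, ∃ r', t < s.ctr lim → r ≤ s.ctr .best →
      run X a b p ((s.set .best r).set i t) = ((s.set .best r').set i t) ∧
        IsLeast (insert r (C t)) r' := by
    intro t r
    by_cases ht : t < s.ctr lim ∧ r ≤ s.ctr .best
    · obtain ⟨r', h₁, h₂⟩ := h t ht.1 r ht.2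
      refine ⟨r', fun _ _ => ⟨h₁.trans ?_, ?_⟩⟩
      · ext u
        · simp only [ProgState.ctr_set]
          split_ifs <;> simp_all
        · rfl
      · simpa [ProgState.ctr_set, hib.symm] using h₂
    · exact ⟨0, fun h₁ h₂ => absurd ⟨h₁, h₂⟩ ht⟩
  choose f hf using hstep
  let g : ℕ → ℕ := fun t => Nat.rec (s.ctr .best) (fun t r => f t r) t
  have hg : ∀ t ≤ s.ctr lim, IsLeast (insert (s.ctr .best) (⋃ u < t, C u)) (g t) := by
    intro t ht
    induction t with
    | zero => simp [g]
    | succ t ih =>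
      have ih := ih (by omega)
      have hle := ih.2 (Set.mem_insert _ _)
      have h₂ := (hf t (g t) (by omega) hle).2
      refine ⟨?_, ?_⟩
      · rcases h₂.1 with e | e
        · rcases ih.1 with e' | e'
          · exact Or.inl (e.trans e')
          · refine Or.inr ?_
            simp only [Set.mem_iUnion] at e' ⊢
            obtain ⟨u, hu, hm⟩ := e'
            exact ⟨u, by omega, by rwa [show g (t + 1) = g t from e]⟩
        · refine Or.inr ?_
          simp only [Set.mem_iUnion]
          exact ⟨t, by omega, e⟩
      · have hle' : g (t + 1) ≤ g t := h₂.2 (Set.mem_insert _ _)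
        rintro x (hx | hx)
        · exact hle'.trans (ih.2 (Or.inl hx))
        · simp only [Set.mem_iUnion] at hx
          obtain ⟨u, hu, hx⟩ := hx
          rcases (Nat.lt_succ_iff.1 hu).eq_or_lt with rfl | hu
          · exact h₂.2 (Or.inr hx)
          · refine hle'.trans (ih.2 (Or.inr ?_))
            simp only [Set.mem_iUnion]
            exact ⟨u, hu, hx⟩
  refine ⟨g (s.ctr lim), ?_, hg _ le_rfl⟩
  refine eval_forLoop hl h0 (fun t => s.set .best (g t))
    (fun t => by simp [ProgState.ctr_set, hib, h0]) (by simp [g]) ?_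
  intro t ht
  exact (hf t (g t) ht ((hg t ht.le).2 (Set.mem_insert _ _))).1

/-- All bounds for the rank. -/
def _root_.rankBounds (X : Finset (Fin m × Fin n)) (a b : ℕ) : Set ℕ :=
  {rankBound a b X 0 fun _ => 3} ∪ ({rankBound a b X 3 fun _ => 0} ∪
    ⋃ i < a + 3, ({rankBound a b X 2 fun j => entryBit X i j} ∪
      ⋃ i' < i, ({rankBound a b X 1 fun j => entryBit X i j + entryBit X i' j} ∪
        ⋃ k < a + 3, ⋃ k' < k, {rankBound a b X 2 (crossBit X i i' k k')})))

theorem minimizes_k₂ (hm : m ≤ a + 3) {s : ProgState Reg} (hs : Fit X a b s)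
    (h₁ : s.ctr .i₁ ≤ a + 3) (h₂ : s.ctr .i₂ ≤ a + 3) (h₃ : s.ctr .k₁ ≤ a + 3)
    (h₄ : s.ctr .k₂ = 0) :
    Minimizes X a b (forLoop .k₂ .k₁ (bound 2 (addCross .i₁ .i₂ .k₁ .k₂))) s
      (⋃ k' < s.ctr .k₁,
        {rankBound a b X 2 (crossBit X (s.ctr .i₁) (s.ctr .i₂) (s.ctr .k₁) k')}) := by
  have hlen := length_encodeInput (a := a) (b := b) X
  refine Minimizes.forLoop rfl h₄ (by omega) _ fun t ht r hr => ?_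
  have hs' := (hs.set_best hr).set_index (v := .k₂) rfl t
  have h := minimizes_bound hm hs'.toReady hs'.toClean (q := 2) (by omega)
    (addsToCap_addCross (by simpa [ProgState.ctr_set]) (by simpa [ProgState.ctr_set])
      (by simpa [ProgState.ctr_set]) (by simp only [ProgState.ctr_set, if_true]; omega))
    (fun j => (crossBit_le _ _ _ _ _).trans (by omega)) hs'.best_le
  simpa only [ProgState.ctr_set, reduceCtorEq, if_false, if_true] using h

theorem minimizes_k₁ (hm : m ≤ a + 3) {s : ProgState Reg} (hs : Fit X a b s)
    (h₁ : s.ctr .i₁ ≤ a + 3) (h₂ : s.ctr .i₂ ≤ a + 3) (h₃ : s.ctr .k₁ = 0)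
    (h₄ : s.ctr .k₂ = 0) :
    Minimizes X a b (forLoop .k₁ .rows (forLoop .k₂ .k₁ (bound 2 (addCross .i₁ .i₂ .k₁ .k₂)))) s
      (⋃ k < a + 3, ⋃ k' < k,
        {rankBound a b X 2 (crossBit X (s.ctr .i₁) (s.ctr .i₂) k k')}) := by
  have hlen := length_encodeInput (a := a) (b := b) X
  have hrows := hs.rows_eq
  rw [← hrows]
  refine Minimizes.forLoop rfl h₃ (by omega) _ fun t ht r hr => ?_
  have h := minimizes_k₂ hm ((hs.set_best hr).set_index (v := .k₁) rfl t)
    (by simpa [ProgState.ctr_set]) (by simpa [ProgState.ctr_set])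
    (by simp only [ProgState.ctr_set, if_true]; omega) (by simpa [ProgState.ctr_set])
  simpa only [ProgState.ctr_set, reduceCtorEq, if_false, if_true] using h

theorem minimizes_i₂ (hm : m ≤ a + 3) {s : ProgState Reg} (hs : Fit X a b s)
    (h₁ : s.ctr .i₁ ≤ a + 3) (h₂ : s.ctr .i₂ = 0) (h₃ : s.ctr .k₁ = 0) (h₄ : s.ctr .k₂ = 0) :
    Minimizes X a b (forLoop .i₂ .i₁ (seq (bound 1 (seq (addEntry .i₁) (addEntry .i₂)))
        (forLoop .k₁ .rows (forLoop .k₂ .k₁ (bound 2 (addCross .i₁ .i₂ .k₁ .k₂)))))) s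
      (⋃ i' < s.ctr .i₁,
        ({rankBound a b X 1 fun j => entryBit X (s.ctr .i₁) j + entryBit X i' j} ∪
          ⋃ k < a + 3, ⋃ k' < k, {rankBound a b X 2 (crossBit X (s.ctr .i₁) i' k k')})) := by
  have hlen := length_encodeInput (a := a) (b := b) X
  refine Minimizes.forLoop rfl h₂ (by omega) _ fun t ht r hr => ?_
  have hs' := (hs.set_best hr).set_index (v := .i₂) rfl t
  have h := minimizes_bound hm hs'.toReady hs'.toClean (q := 1) (by omega)
    ((addsToCap_addEntry (u := .i₁) rfl (by simpa [ProgState.ctr_set])).seq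
      (addsToCap_addEntry (u := .i₂) rfl (by simp only [ProgState.ctr_set, if_true]; omega)))
    (fun j => (add_le_add (entryBit_le _ _) (entryBit_le _ _)).trans (by omega)) hs'.best_le
  simp only [ProgState.ctr_set, reduceCtorEq, if_false, if_true] at h
  refine h.seq fun r' hr' => ?_
  have h' := minimizes_k₁ hm (hs'.set_best hr') (by simpa [ProgState.ctr_set])
    (by simp only [ProgState.ctr_set, reduceCtorEq, if_false, if_true]; omega)
    (by simpa [ProgState.ctr_set]) (by simpa [ProgState.ctr_set])
  simpa only [ProgState.ctr_set, reduceCtorEq, if_false, if_true] using h'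

theorem minimizes_i₁ (hm : m ≤ a + 3) {s : ProgState Reg} (hs : Fit X a b s)
    (h₁ : s.ctr .i₁ = 0) (h₂ : s.ctr .i₂ = 0) (h₃ : s.ctr .k₁ = 0) (h₄ : s.ctr .k₂ = 0) :
    Minimizes X a b (forLoop .i₁ .rows (seq (bound 2 (addEntry .i₁)) (forLoop .i₂ .i₁
        (seq (bound 1 (seq (addEntry .i₁) (addEntry .i₂)))
          (forLoop .k₁ .rows (forLoop .k₂ .k₁ (bound 2 (addCross .i₁ .i₂ .k₁ .k₂)))))))) s
      (⋃ i < a + 3, ({rankBound a b X 2 fun j => entryBit X i j} ∪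
        ⋃ i' < i, ({rankBound a b X 1 fun j => entryBit X i j + entryBit X i' j} ∪
          ⋃ k < a + 3, ⋃ k' < k, {rankBound a b X 2 (crossBit X i i' k k')}))) := by
  have hlen := length_encodeInput (a := a) (b := b) X
  have hrows := hs.rows_eq
  rw [← hrows]
  refine Minimizes.forLoop rfl h₁ (by omega) _ fun t ht r hr => ?_
  have hs' := (hs.set_best hr).set_index (v := .i₁) rfl t
  have h := minimizes_bound hm hs'.toReady hs'.toClean (q := 2) (by omega)
    (addsToCap_addEntry (u := .i₁) rfl (by simp only [ProgState.ctr_set, if_true]; omega))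
    (fun j => (entryBit_le _ _).trans (by omega)) hs'.best_le
  simp only [ProgState.ctr_set, reduceCtorEq, if_false, if_true] at h
  refine h.seq fun r' hr' => ?_
  have h' := minimizes_i₂ hm (hs'.set_best hr')
    (by simp only [ProgState.ctr_set, reduceCtorEq, if_false, if_true]; omega)
    (by simpa [ProgState.ctr_set]) (by simpa [ProgState.ctr_set]) (by simpa [ProgState.ctr_set])
  rw [hrows]
  simpa only [ProgState.ctr_set, reduceCtorEq, if_false, if_true] using h'

theorem minimizes_minimize (hm : m ≤ a + 3) {s : ProgState Reg} (hs : Fit X a b s)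
    (h₁ : s.ctr .i₁ = 0) (h₂ : s.ctr .i₂ = 0) (h₃ : s.ctr .k₁ = 0) (h₄ : s.ctr .k₂ = 0) :
    Minimizes X a b minimize s (rankBounds X a b) := by
  refine (minimizes_bound hm hs.toReady hs.toClean (by omega) (addsToCap_incs 3 s) (by simp)
    hs.best_le).seq fun r hr => ?_
  have hs' := hs.set_best hr
  refine (minimizes_bound hm hs'.toReady hs'.toClean (by omega) (addsToCap_skip _) (by simp)
    hs'.best_le).seq fun r' hr' => ?_
  apply minimizes_i₁ hm (hs'.set_best hr') <;> simpa [ProgState.ctr_set]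

theorem run_parse : run X a b parse ⟨Function.update (fun _ => 0) .big
    (4 * (encodeInput m n a b X).length), (encodeInput m n a b X).length⟩ =
      ⟨fun r => match r with
        | .big => 4 * (encodeInput m n a b X).length
        | .n => n
        | .a => a
        | .b => b
        | .rows => a + 3
        | _ => 0, 0⟩ := by
  have hlen := length_encodeInput (a := a) (b := b) X
  let c₀ : Reg → ℕ := Function.update (fun _ => 0) .big (4 * (encodeInput m n a b X).length)
  have h := eval_header (X := X) (a := a) (b := b) (s := ⟨c₀, 0⟩) rfl (by simp [c₀])
    (inc .n) (inc .a) (inc .b) (fun t => Function.update c₀ .n t)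
    (fun t => Function.update (Function.update c₀ .n n) .a t)
    (fun t => Function.update (Function.update (Function.update c₀ .n n) .a a) .b t)
    (by simp [c₀]) (by simp [c₀]) (by simp [c₀]) (by simp [c₀]) (by simp [c₀])
    (fun t _ i => by rw [run, eval_inc]; simp [ProgState.set])
    (fun t _ i => by rw [run, eval_inc]; simp [ProgState.set])
    (fun t _ i => by rw [run, eval_inc]; simp [ProgState.set])
  have e₀ : run X a b (rewind .big) ⟨c₀, (encodeInput m n a b X).length⟩ = ⟨c₀, 0⟩ := by
    rw [run, eval_rewind (by simp [c₀]) (by omega)]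
  simp only [run_seq] at h
  rw [parse]
  simp only [run_seq]
  rw [e₀, h]
  simp only [run]
  rw [eval_rewind (by simp [c₀]) (by omega), eval_addMul (by simp [c₀]; omega), eval_incs]
  ext r
  · cases r <;> simp [ProgState.ctr_set, c₀]
  · rfl

theorem run_rankProg (hm : m ≤ a + 3) : ∃ r,
    run X a b rankProg ⟨Function.update (fun _ => 0) .big
      (4 * (encodeInput m n a b X).length), (encodeInput m n a b X).length⟩ =
      ⟨Function.update (fun _ => 0) .best r, 0⟩ ∧ IsLeast (rankBounds X a b) r := by
  have hlen := length_encodeInput (a := a) (b := b) X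
  rw [rankProg, run_seq, run_parse, run_seq]
  have e : run X a b (addMul 1 .big .best) ⟨fun r => match r with
        | .big => 4 * (encodeInput m n a b X).length
        | .n => n
        | .a => a
        | .b => b
        | .rows => a + 3
        | _ => 0, 0⟩ = ⟨fun r => match r with
        | .big => 4 * (encodeInput m n a b X).length
        | .n => n
        | .a => a
        | .b => b
        | .rows => a + 3
        | .best => 4 * (encodeInput m n a b X).length
        | _ => 0, 0⟩ := by
    rw [run, eval_addMul (by simp)]
    ext r
    · cases r <;> simp [ProgState.ctr_set]
    · rfl
  rw [e, run_seq]
  obtain ⟨r, h₁, h₂⟩ := minimizes_minimize (X := X) (a := a) (b := b) hm (s := ⟨fun r => match r with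
        | .big => 4 * (encodeInput m n a b X).length
        | .n => n
        | .a => a
        | .b => b
        | .rows => a + 3
        | .best => 4 * (encodeInput m n a b X).length
        | _ => 0, 0⟩) ⟨⟨rfl, rfl, rfl, rfl, rfl, rfl⟩, ⟨rfl, rfl, rfl, rfl, rfl, rfl⟩, le_rfl⟩
      rfl rfl rfl rfl
  refine ⟨r, ?_, ?_, fun x hx => h₂.2 (Or.inr hx)⟩
  · rw [h₁]
    simp only [run_seq]
    simp only [run]
    rw [eval_clear (v := Reg.n) (by simp [ProgState.ctr_set]; omega),
      eval_clear (v := Reg.a) (by simp [ProgState.ctr_set]; omega),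
      eval_clear (v := Reg.b) (by simp [ProgState.ctr_set]; omega),
      eval_clear (v := Reg.rows) (by simp [ProgState.ctr_set]; omega),
      eval_clear (v := Reg.big) (by simp [ProgState.ctr_set])]
    ext r
    · cases r <;> simp [ProgState.ctr_set]
    · rfl
  · rcases h₂.1 with h | h
    -- The initial value of `best` is not itself a bound. It is never the result, because the bound
    -- with `q = 0` is at most `n * m`, which is smaller.
    · have hmem : rankBound a b X 0 (fun _ => 3) ∈ rankBounds X a b := Or.inl rfl
      have h₃ := h₂.2 (Or.inr hmem)
      have h₄ : rankBound a b X 0 (fun _ => 3) ≤ n * m := by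
        rw [rankBound, zero_mul, zero_add]
        calc ∑ j ∈ Finset.range n, min (columnCount X j) (a + 3)
            ≤ ∑ j ∈ Finset.range n, m :=
              Finset.sum_le_sum fun j _ => (min_le_left _ _).trans (columnCount_le X j)
          _ = n * m := by simp
      simp only at h
      nlinarith
    · exact h

end Prog

/-- There is a machine that computes the least of the bounds in polynomial time. -/
theorem exists_machine_isLeast_rankBounds :
    ∃ (M : Turing.TM2ComputableAux Γ' Bool) (p : Polynomial ℕ),
      ∀ m n a b : ℕ, a ≤ m → b ≤ n → m - a ≤ 3 → ∀ X : Finset (Fin m × Fin n),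
        ∃ r : ℕ, IsLeast (rankBounds X a b) r ∧
          HaltsWithOutput M (encodeInput m n a b X) (Computability.unaryEncodeNat r)
            (p.eval (m + n)) := by
  -- With `a ≤ m` and `b ≤ n` the length `m + n + a + b + 4 + m * (n + 1)` of the input is at most
  -- `(m + n + 2) ^ 2`; `N` bounds four times that length.
  obtain ⟨N, hN⟩ : ∃ N : Polynomial ℕ, ∀ x, N.eval x = 4 * (x + 2) ^ 2 :=
    ⟨4 * (Polynomial.X + 2) ^ 2, by simp⟩
  refine ⟨⟨Prog.rankProg.machine .big .best, Equiv.refl _, Equiv.refl _⟩,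
    Prog.rankProg.cost.comp N + 2 * N + 4, ?_⟩
  intro m n a b ha hb hd X
  obtain ⟨r, h₁, h₂⟩ := Prog.run_rankProg (X := X) (a := a) (b := b) (by omega)
  refine ⟨r, h₂, ?_⟩
  obtain ⟨h⟩ := Prog.machine_outputs _ _ _ _ _ h₁
  have hlen := length_encodeInput (a := a) (b := b) X
  have hN' : 4 * (encodeInput m n a b X).length ≤ N.eval (m + n) := by
    rw [hlen, hN]
    nlinarith
  have hu : Computability.unaryEncodeNat r = List.replicate r true := by
    clear h₁ h₂ h
    induction r with
    | zero => rfl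
    | succ r ih => rw [Computability.unaryEncodeNat, ih, List.replicate_succ]
  refine ⟨⟨⟨h.steps, ?_⟩, h.steps_le_m.trans ?_⟩⟩
  · have e := h.evals_in_steps
    rw [hu]
    exact Eq.trans (congrArg (fun l => (flip bind (Prog.rankProg.machine .big .best).step)^[h.steps]
        (some (Turing.initList (Prog.rankProg.machine .big .best) l))) (List.map_id _))
      (e.trans (congrArg (fun l => some (Turing.haltList (Prog.rankProg.machine .big .best) l))
        (List.map_id _).symm))
  · rw [Polynomial.eval_add, Polynomial.eval_add, Polynomial.eval_comp, Polynomial.eval_mul,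
      Polynomial.eval_ofNat, Polynomial.eval_ofNat]
    have := Prog.cost_eval_mono Prog.rankProg hN'
    dsimp only at this
    omega

/-! ### Dimension counts. -/

section LinearAlgebra

variable {K : Type*} [Field K]

theorem Submodule.exists_le_finrank_eq {V : Type*} [AddCommGroup V] [Module K V]
    (S : Submodule K V) {k : ℕ} (hk : k ≤ Module.finrank K S) :
    ∃ U ≤ S, Module.finrank K U = k := by
  obtain ⟨f, hf⟩ := exists_linearIndependent_of_le_finrank hk
  have hf' : LinearIndependent K fun i => (f i : V) := hf.map' S.subtype (Submodule.ker_subtype S)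
  refine ⟨Submodule.span K (Set.range fun i => (f i : V)), ?_, ?_⟩
  · rw [Submodule.span_le]
    rintro _ ⟨i, rfl⟩
    exact (f i).2
  · rw [finrank_span_eq_card hf', Fintype.card_fin]

/-- The functions that vanish outside `s`. -/
def coordSubspace (K : Type*) [Field K] {ι : Type*} (s : Set ι) : Submodule K (ι → K) :=
  ⨅ i ∈ sᶜ, LinearMap.ker (LinearMap.proj i : (ι → K) →ₗ[K] K)

theorem mem_coordSubspace {ι : Type*} {s : Set ι} {f : ι → K} :
    f ∈ coordSubspace K s ↔ ∀ i ∉ s, f i = 0 := by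
  simp [coordSubspace, Submodule.mem_iInf]

theorem finrank_coordSubspace {ι : Type*} [Finite ι] (s : Set ι) :
    Module.finrank K (coordSubspace K s) = s.ncard := by
  classical
  have := Fintype.ofFinite ι
  unfold coordSubspace
  rw [(LinearMap.iInfKerProjEquiv K (fun _ : ι => K) (I := s) (J := sᶜ)
    disjoint_compl_right (by simp)).finrank_eq, Module.finrank_fintype_fun_eq_card,
    ← Nat.card_eq_fintype_card, Nat.card_coe_set_eq]

theorem finrank_add_finrank_le_of_le {V : Type*} [AddCommGroup V] [Module K V]
    [FiniteDimensional K V] {S T Z : Submodule K V} (hS : S ≤ Z) (hT : T ≤ Z) :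
    Module.finrank K S + Module.finrank K T ≤
      Module.finrank K Z + Module.finrank K (S ⊓ T : Submodule K V) := by
  rw [← Submodule.finrank_sup_add_finrank_inf_eq]
  gcongr
  exact Submodule.finrank_mono (sup_le hS hT)

theorem finrank_le_finrank_ker_add {V W : Type*} [AddCommGroup V] [Module K V] [AddCommGroup W]
    [Module K W] [FiniteDimensional K V] [FiniteDimensional K W] (f : V →ₗ[K] W) :
    Module.finrank K V ≤ Module.finrank K (LinearMap.ker f) + Module.finrank K W := by
  rw [← f.finrank_range_add_finrank_ker, add_comm]
  gcongr
  exact Submodule.finrank_le _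

theorem finrank_le_finrank_inf_ker_add {V W : Type*} [AddCommGroup V] [Module K V] [AddCommGroup W]
    [Module K W] [FiniteDimensional K V] [FiniteDimensional K W] (S : Submodule K V)
    (f : V →ₗ[K] W) :
    Module.finrank K S ≤
      Module.finrank K (S ⊓ LinearMap.ker f : Submodule K V) + Module.finrank K W := by
  refine (finrank_le_finrank_ker_add (f.domRestrict S)).trans ?_
  gcongr
  have : (LinearMap.ker (f.domRestrict S)).map S.subtype ≤ S ⊓ LinearMap.ker f := by
    rintro _ ⟨v, hv, rfl⟩
    exact ⟨v.2, hv⟩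
  rw [← Submodule.finrank_map_subtype_eq]
  exact Submodule.finrank_mono this

end LinearAlgebra

/-! ### Relations between columns, and adding empty rows. -/

section Rigidity

variable {K : Type*} [Field K] {m n a b : ℕ}

/-- The columns of the rigidity matrix for arbitrary values of the variables. -/
def rigidityColumn (x : Fin m → Fin a → K) (y : Fin n → Fin b → K) (p : Fin m × Fin n) :
    (Fin a × Fin n) ⊕ (Fin b × Fin m) → K :=
  Sum.elim (fun r => if p.2 = r.2 then x p.1 r.1 else 0)
    (fun r => if p.1 = r.2 then y p.2 r.1 else 0)

/-- The linear relations between the columns with labels in `X`, as families of columns. -/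
def columnRelations (x : Fin m → Fin a → K) (y : Fin n → Fin b → K) (X : Finset (Fin m × Fin n)) :
    Submodule K (Fin n → Fin m → K) where
  carrier := {f | (∀ j i, (i, j) ∉ X → f j i = 0) ∧ (∀ j t, ∑ i, f j i * x i t = 0) ∧
    ∀ i l, ∑ j, f j i * y j l = 0}
  add_mem' := by
    rintro f g ⟨hf₁, hf₂, hf₃⟩ ⟨hg₁, hg₂, hg₃⟩
    refine ⟨fun j i h => ?_, fun j t => ?_, fun i l => ?_⟩
    · simp [hf₁ j i h, hg₁ j i h]
    · simp [add_mul, Finset.sum_add_distrib, hf₂, hg₂]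
    · simp [add_mul, Finset.sum_add_distrib, hf₃, hg₃]
  zero_mem' := by simp
  smul_mem' := by
    rintro c f ⟨hf₁, hf₂, hf₃⟩
    refine ⟨fun j i h => ?_, fun j t => ?_, fun i l => ?_⟩
    · simp [hf₁ j i h]
    · simp [mul_assoc, ← Finset.mul_sum, hf₂]
    · simp [mul_assoc, ← Finset.mul_sum, hf₃]

/-- The rank of the columns with labels in `X`. -/
noncomputable def columnRank (x : Fin m → Fin a → K) (y : Fin n → Fin b → K)
    (X : Finset (Fin m × Fin n)) : ℕ :=
  Module.finrank K (Submodule.span K (rigidityColumn x y '' X))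

/-- Rank-nullity for the linear combinations of the columns in `X`; extension by zero (`E`)
identifies the kernel with `columnRelations`. -/
theorem columnRank_add_finrank (x : Fin m → Fin a → K) (y : Fin n → Fin b → K)
    (X : Finset (Fin m × Fin n)) :
    columnRank x y X + Module.finrank K (columnRelations x y X) = X.card := by
  classical
  let φ := Fintype.linearCombination K (fun p : X => rigidityColumn x y p)
  have h := φ.finrank_range_add_finrank_ker
  rw [Module.finrank_fintype_fun_eq_card, Fintype.card_coe] at h
  rw [← h, columnRank, Fintype.range_linearCombination]
  congr 1
  · rw [Set.image_eq_range]; rfl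
  · let E : (X → K) →ₗ[K] (Fin n → Fin m → K) :=
      { toFun := fun c j i => if h : (i, j) ∈ X then c ⟨(i, j), h⟩ else 0
        map_add' := by intro c d; ext j i; by_cases h : (i, j) ∈ X <;> simp [h]
        map_smul' := by intro c d; ext j i; by_cases h : (i, j) ∈ X <;> simp [h] }
    have hE : Function.Injective E := by
      intro c d hcd
      ext ⟨⟨i, j⟩, hp⟩
      have := congrFun (congrFun hcd j) i
      simpa [E, hp] using this
    have hsum : ∀ (c : X → K) (r), φ c r = ∑ j, ∑ i, E c j i * rigidityColumn x y (i, j) r := by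
      intro c r
      rw [← Fintype.sum_prod_type_right (fun p => E c p.2 p.1 * rigidityColumn x y p r)]
      simp only [φ, Fintype.linearCombination_apply, Finset.sum_apply, Pi.smul_apply, smul_eq_mul]
      rw [← Finset.sum_subset (Finset.subset_univ X), ← Finset.sum_coe_sort X]
      · refine Finset.sum_congr rfl fun p _ => ?_
        simp [E]
      · intro p _ hp
        simp [E, hp]
    have hrel : ∀ c, c ∈ LinearMap.ker φ ↔ E c ∈ columnRelations x y X := by
      intro c
      have h₁ : ∀ j i, (i, j) ∉ X → E c j i = 0 := fun j i h => by simp [E, h]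
      have h₂ : ∀ j t, φ c (Sum.inl (t, j)) = ∑ i, E c j i * x i t := by
        intro j t
        rw [hsum, Finset.sum_eq_single j]
        · simp [rigidityColumn]
        · intro k _ hk
          simp [rigidityColumn, hk]
        · simp
      have h₃ : ∀ i l, φ c (Sum.inr (l, i)) = ∑ j, E c j i * y j l := by
        intro i l
        rw [hsum]
        refine Finset.sum_congr rfl fun j _ => ?_
        rw [Finset.sum_eq_single i]
        · simp [rigidityColumn]
        · intro k _ hk
          simp [rigidityColumn, hk]
        · simp
      rw [LinearMap.mem_ker]
      constructor
      · intro hc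
        exact ⟨h₁, fun j t => by rw [← h₂, hc, Pi.zero_apply], fun i l => by
          rw [← h₃, hc, Pi.zero_apply]⟩
      · rintro ⟨-, g₂, g₃⟩
        ext (⟨t, j⟩ | ⟨l, i⟩)
        · rw [h₂, g₂, Pi.zero_apply]
        · rw [h₃, g₃, Pi.zero_apply]
    have hmap : (LinearMap.ker φ).map E = columnRelations x y X := by
      ext f
      constructor
      · rintro ⟨c, hc, rfl⟩
        exact (hrel c).1 hc
      · intro hf
        have : E (fun p => f p.1.2 p.1.1) = f := by
          ext j i
          by_cases h : (i, j) ∈ X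
          · simp [E, h]
          · simp [E, h, hf.1 j i h]
        exact ⟨fun p => f p.1.2 p.1.1, (hrel _).2 (this.symm ▸ hf), this⟩
    rw [← hmap]
    exact (Submodule.equivMapOfInjective E hE (LinearMap.ker φ)).finrank_eq.symm

/-- `X` as a set of positions in a matrix with more rows. -/
def padRows {M : ℕ} (h : m ≤ M) (X : Finset (Fin m × Fin n)) : Finset (Fin M × Fin n) :=
  X.map ((Fin.castLEEmb h).prodMap (Function.Embedding.refl _))

theorem mem_padRows {M : ℕ} (h : m ≤ M) (X : Finset (Fin m × Fin n)) (p : Fin M × Fin n) :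
    p ∈ padRows h X ↔ HasEntry X p.1 p.2 := by
  obtain ⟨i, j⟩ := p
  simp only [padRows, Finset.mem_map, HasEntry]
  constructor
  · rintro ⟨⟨i', j'⟩, hX, he⟩
    simp only [Function.Embedding.prodMap, Function.Embedding.coeFn_mk, Prod.map,
      Fin.castLEEmb_apply, Function.Embedding.refl_apply, Prod.mk.injEq] at he
    obtain ⟨rfl, rfl⟩ := he
    exact ⟨i'.2, j'.2, hX⟩
  · rintro ⟨hi, hj, hX⟩
    exact ⟨_, hX, rfl⟩

theorem hasEntry_padRows {M : ℕ} (h : m ≤ M) (X : Finset (Fin m × Fin n)) (i j : ℕ) :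
    HasEntry (padRows h X) i j ↔ HasEntry X i j := by
  constructor
  · rintro ⟨hi, hj, hX⟩
    exact (mem_padRows h X _).1 hX
  · intro hX
    obtain ⟨hi, hj, -⟩ := id hX
    exact ⟨hi.trans_le h, hj, (mem_padRows h X _).2 hX⟩

theorem columnCount_padRows {M : ℕ} (h : m ≤ M) (X : Finset (Fin m × Fin n)) (j : ℕ) :
    columnCount (padRows h X) j = columnCount X j := by
  classical
  simp only [columnCount, hasEntry_padRows]
  congr 1
  ext i
  simp only [Finset.mem_filter, Finset.mem_range]
  exact ⟨fun ⟨_, hX⟩ => ⟨hX.1, hX⟩, fun ⟨hi, hX⟩ => ⟨hi.trans_le h, hX⟩⟩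

theorem rankBounds_padRows {M : ℕ} (h : m ≤ M) (X : Finset (Fin m × Fin n)) :
    rankBounds (padRows h X) a b = rankBounds X a b := by
  have h₁ : entryBit (padRows h X) = entryBit X := by
    ext i j
    by_cases hX : HasEntry X i j
    · rw [entryBit, entryBit, if_pos hX, if_pos ((hasEntry_padRows h X i j).2 hX)]
    · rw [entryBit, entryBit, if_neg hX, if_neg (mt (hasEntry_padRows h X i j).1 hX)]
  have h₂ : crossBit (padRows h X) = crossBit X := by
    ext i i' k k' j
    simp only [crossBit, h₁]
  have h₃ : rankBound a b (padRows h X) = rankBound a b X := by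
    ext q c
    simp only [rankBound, columnCount_padRows]
  simp only [rankBounds, h₁, h₂, h₃]

/-- An additional row of the grid carries no label of the padded set, so the columns are merely
extended by zeros, through the injection `ι`. -/
theorem columnRank_padRows {M : ℕ} (h : m ≤ M) (x : Fin M → Fin a → K) (y : Fin n → Fin b → K)
    (X : Finset (Fin m × Fin n)) :
    columnRank x y (padRows h X) = columnRank (fun i => x (Fin.castLE h i)) y X := by
  let ι : ((Fin a × Fin n) ⊕ (Fin b × Fin m) → K) →ₗ[K] ((Fin a × Fin n) ⊕ (Fin b × Fin M) → K) :=
    { toFun := fun f => Sum.elim (fun r => f (Sum.inl r))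
        (fun r => if hr : (r.2 : ℕ) < m then f (Sum.inr (r.1, ⟨r.2, hr⟩)) else 0)
      map_add' := by
        intro f g
        ext (r | r)
        · simp
        · by_cases hr : (r.2 : ℕ) < m <;> simp [hr]
      map_smul' := by
        intro f g
        ext (r | r)
        · simp
        · by_cases hr : (r.2 : ℕ) < m <;> simp [hr] }
  have hι : Function.Injective ι := by
    intro f g hfg
    ext (r | r)
    · exact congrFun hfg (Sum.inl r)
    · have := congrFun hfg (Sum.inr (r.1, Fin.castLE h r.2))
      simpa [ι] using this
  have hcol : ∀ p : Fin m × Fin n, rigidityColumn x y (Fin.castLE h p.1, p.2) =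
      ι (rigidityColumn (fun i => x (Fin.castLE h i)) y p) := by
    rintro ⟨i, j⟩
    ext (r | r)
    · rfl
    · by_cases hr : (r.2 : ℕ) < m
      · simp [ι, rigidityColumn, hr, Fin.ext_iff]
      · have : (i : ℕ) ≠ r.2 := fun e => hr (e ▸ i.2)
        simp [ι, rigidityColumn, hr, Fin.ext_iff, this]
  have himg : rigidityColumn x y '' (padRows h X : Finset _) =
      ι '' (rigidityColumn (fun i => x (Fin.castLE h i)) y '' X) := by
    rw [padRows, Finset.coe_map, Set.image_image, Set.image_image]
    exact Set.image_congr fun p _ => hcol p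
  rw [columnRank, himg, ← Submodule.map_span, columnRank]
  exact ((Submodule.equivMapOfInjective ι hι _).finrank_eq).symm

end Rigidity

/-! ### The matroid rank, and its behaviour under specialization. -/

section Specialization

theorem LinearIndepOn.finrank_span_image {K V ι : Type*} [Field K] [AddCommGroup V] [Module K V]
    [Finite ι] {v : ι → V} {S : Set ι} (h : LinearIndepOn K v S) :
    Module.finrank K (Submodule.span K (v '' S)) = S.ncard := by
  have := Fintype.ofFinite S
  rw [Set.image_eq_range, finrank_span_eq_card h, ← Nat.card_eq_fintype_card, Nat.card_coe_set_eq]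

theorem columnMatroid_eRk {K R C : Type*} [Field K] [Finite C] (A : Matrix R C K) (X : Set C) :
    (columnMatroid A).eRk X = (Module.finrank K (Submodule.span K (A.col '' X)) : ℕ∞) := by
  obtain ⟨I, hI⟩ := (columnMatroid A).exists_isBasis X (Set.subset_univ X)
  have hind : LinearIndepOn K A.col I := (columnMatroid_indep_iff A I).1 hI.indep
  have hspan : Submodule.span K (A.col '' X) = Submodule.span K (A.col '' I) := by
    apply le_antisymm
    · rw [Submodule.span_le]
      rintro _ ⟨e, he, rfl⟩
      by_cases heI : e ∈ I
      · exact Submodule.subset_span (Set.mem_image_of_mem _ heI)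
      · by_contra hne
        exact heI (hI.mem_of_insert_indep he ((columnMatroid_indep_iff A _).2
          ((linearIndepOn_insert heI).2 ⟨hind, hne⟩)))
    · exact Submodule.span_mono (Set.image_mono hI.subset)
  rw [hI.eRk_eq_encard, hspan, hind.finrank_span_image, Set.Finite.cast_ncard_eq (Set.toFinite I)]

theorem bipartiteRigidityMatroid_eRk {m n a b : ℕ} (X : Finset (Fin m × Fin n)) :
    (bipartiteRigidityMatroid m n a b).eRk X =
      (columnRank (K := RigidityField m n a b) (a := a) (b := b) rigidityX rigidityY X : ℕ∞) := by
  rw [bipartiteRigidityMatroid, columnMatroid_eRk, columnRank]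
  have : (rigidityMatrix m n a b).col = rigidityColumn rigidityX rigidityY := by
    ext p (r | r) <;> rfl
  rw [this]

/-- The specialized matrix has a left inverse. Lifting its entries to `R` gives `B` such that `det
(B * A)` is sent to `1` by `φ`, hence is nonzero, hence invertible in `K`. -/
theorem linearIndependent_algebraMap_of_linearIndependent_map {R F K ι κ : Type*} [CommRing R]
    [IsDomain R] [Field F] [Field K] [Algebra R K] [FaithfulSMul R K] [Finite ι] [Finite κ]
    (φ : R →+* F) (hφ : Function.Surjective φ) (v : ι → κ → R)
    (h : LinearIndependent F fun i k => φ (v i k)) :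
    LinearIndependent K fun i k => algebraMap R K (v i k) := by
  classical
  have := Fintype.ofFinite ι
  have := Fintype.ofFinite κ
  let A : Matrix κ ι R := Matrix.of fun k i => v i k
  have hA : Function.Injective (A.map φ).mulVec := Matrix.mulVec_injective_iff.2 h
  obtain ⟨g, hg⟩ := LinearMap.exists_leftInverse_of_injective (A.map φ).mulVecLin
    (LinearMap.ker_eq_bot.2 hA)
  have hB : LinearMap.toMatrix' g * A.map φ = 1 := by
    rw [← LinearMap.toMatrix'_id, ← hg, LinearMap.toMatrix'_comp, ← Matrix.toLin'_apply',
      LinearMap.toMatrix'_toLin']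
  choose ψ hψ using hφ
  let B : Matrix ι κ R := (LinearMap.toMatrix' g).map ψ
  have hB' : B.map φ = LinearMap.toMatrix' g := by
    ext i k
    simp [B, hψ]
  have hdet : (B * A).det ≠ 0 := by
    intro h0
    have h1 : φ (B * A).det = 1 := by
      rw [RingHom.map_det, RingHom.mapMatrix_apply, Matrix.map_mul, hB', hB, Matrix.det_one]
    rw [h0, map_zero] at h1
    exact zero_ne_one h1
  have hdet' : IsUnit ((B.map (algebraMap R K)) * A.map (algebraMap R K)) := by
    rw [Matrix.isUnit_iff_isUnit_det, ← Matrix.map_mul, ← RingHom.mapMatrix_apply,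
      ← RingHom.map_det, isUnit_iff_ne_zero]
    exact (map_ne_zero_iff _ (FaithfulSMul.algebraMap_injective R K)).2 hdet
  have hinj := Matrix.mulVec_injective_iff_isUnit.2 hdet'
  refine (Matrix.mulVec_injective_iff (M := A.map (algebraMap R K))).1 fun u w huw => hinj ?_
  rw [← Matrix.mulVec_mulVec, huw, Matrix.mulVec_mulVec]

theorem columnRank_le_generic {m n a b : ℕ} (x : Fin m → Fin a → ℂ) (y : Fin n → Fin b → ℂ)
    (X : Finset (Fin m × Fin n)) :
    columnRank x y X ≤
      columnRank (K := RigidityField m n a b) (a := a) (b := b) rigidityX rigidityY X := by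
  obtain ⟨S, hSX, -, hspan, hS⟩ := exists_linearIndepOn_extension (K := ℂ)
    (v := rigidityColumn x y) (linearIndepOn_empty ℂ _) (Set.empty_subset (X : Set (Fin m × Fin n)))
  let φ : MvPolynomial ((Fin m × Fin a) ⊕ (Fin n × Fin b)) ℂ →+* ℂ :=
    MvPolynomial.eval (Sum.elim (fun p => x p.1 p.2) (fun p => y p.1 p.2))
  have hφ : Function.Surjective φ := fun c => ⟨MvPolynomial.C c, by simp [φ]⟩
  let w : Fin m × Fin n → (Fin a × Fin n) ⊕ (Fin b × Fin m) →
      MvPolynomial ((Fin m × Fin a) ⊕ (Fin n × Fin b)) ℂ := fun p =>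
    Sum.elim (fun r => if p.2 = r.2 then MvPolynomial.X (Sum.inl (p.1, r.1)) else 0)
      (fun r => if p.1 = r.2 then MvPolynomial.X (Sum.inr (p.2, r.1)) else 0)
  have h₁ : ∀ p, rigidityColumn x y p = fun r => φ (w p r) := by
    intro p
    ext (r | r)
    · by_cases h : p.2 = r.2 <;> simp [w, φ, rigidityColumn, h]
    · by_cases h : p.1 = r.2 <;> simp [w, φ, rigidityColumn, h]
  have h₂ : ∀ p, rigidityColumn (K := RigidityField m n a b) (a := a) (b := b)
      rigidityX rigidityY p = fun r => algebraMap _ (RigidityField m n a b) (w p r) := by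
    intro p
    ext (r | r)
    · by_cases h : p.2 = r.2 <;> simp [w, rigidityColumn, h, rigidityX]
    · by_cases h : p.1 = r.2 <;> simp [w, rigidityColumn, h, rigidityY]
  have hgen : LinearIndepOn (RigidityField m n a b)
      (rigidityColumn (K := RigidityField m n a b) (a := a) (b := b) rigidityX rigidityY) S := by
    have := linearIndependent_algebraMap_of_linearIndependent_map (K := RigidityField m n a b)
      φ hφ (fun p : S => w p) (by simpa only [LinearIndepOn, h₁] using hS)
    simpa only [LinearIndepOn, h₂] using this
  calc columnRank x y X ≤ Module.finrank ℂ (Submodule.span ℂ (rigidityColumn x y '' S)) :=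
        Submodule.finrank_mono (Submodule.span_le.2 hspan)
    _ = Module.finrank _ (Submodule.span (RigidityField m n a b) (rigidityColumn
        (K := RigidityField m n a b) (a := a) (b := b) rigidityX rigidityY '' S)) := by
      rw [hS.finrank_span_image, hgen.finrank_span_image]
    _ ≤ _ := Submodule.finrank_mono (Submodule.span_mono (Set.image_mono hSX))

end Specialization

/-! ### Every element of `rankBounds` bounds the rank from above. -/

section UpperBound

variable {K : Type*} [Field K] {m n a b : ℕ}

/-- The set of rows of the elements of `Y` in the column `j`. -/
def columnRows (Y : Finset (Fin m × Fin n)) (j : Fin n) : Finset (Fin m) :=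
  Finset.univ.filter fun i => (i, j) ∈ Y

theorem mem_columnRows {Y : Finset (Fin m × Fin n)} {j : Fin n} {i : Fin m} :
    i ∈ columnRows Y j ↔ (i, j) ∈ Y := by
  simp [columnRows]

theorem hasEntry_iff_mem_columnRows {Y : Finset (Fin m × Fin n)} {j : Fin n} {i : Fin m} :
    HasEntry Y i j ↔ i ∈ columnRows Y j := by
  rw [mem_columnRows]
  exact ⟨fun ⟨_, _, h⟩ => h, fun h => ⟨i.2, j.2, h⟩⟩

theorem columnCount_eq_card (Y : Finset (Fin m × Fin n)) (j : Fin n) :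
    columnCount Y j = (columnRows Y j).card := by
  classical
  rw [columnCount, ← Finset.card_map Fin.valEmbedding]
  congr 1
  ext i
  simp only [Finset.mem_filter, Finset.mem_range, Finset.mem_map, Fin.valEmbedding_apply]
  constructor
  · rintro ⟨hi, h⟩
    exact ⟨⟨i, hi⟩, hasEntry_iff_mem_columnRows.1 h, rfl⟩
  · rintro ⟨i, h, rfl⟩
    exact ⟨i.2, hasEntry_iff_mem_columnRows.2 h⟩

theorem rankBound_eq_sum (Y : Finset (Fin m × Fin n)) (q : ℕ) (c : ℕ → ℕ) :
    rankBound a b Y q c = q * b + ∑ j : Fin n, min (columnRows Y j).card (a + c j) := by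
  rw [rankBound, ← Fin.sum_univ_eq_sum_range (fun j => min (columnCount Y j) (a + c j))]
  simp only [columnCount_eq_card]

theorem sum_card_columnRows (Y : Finset (Fin m × Fin n)) :
    ∑ j, (columnRows Y j).card = Y.card := by
  rw [Finset.card_eq_sum_card_fiberwise (f := Prod.snd) (t := Finset.univ) (by simp)]
  refine Finset.sum_congr rfl fun j _ => ?_
  rw [← Finset.card_map (Function.Embedding.sectL (Fin m) j)]
  congr 1
  ext ⟨i, k⟩
  simp only [Finset.mem_map, mem_columnRows, Function.Embedding.sectL_apply, Prod.mk.injEq,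
    Finset.mem_filter]
  constructor
  · rintro ⟨i', h, rfl, rfl⟩
    exact ⟨h, rfl⟩
  · rintro ⟨h, rfl⟩
    exact ⟨i, h, rfl, rfl⟩

theorem entryBit_eq (Y : Finset (Fin m × Fin n)) (i : Fin m) (j : Fin n) :
    entryBit Y i j = if i ∈ columnRows Y j then 1 else 0 := by
  by_cases h : i ∈ columnRows Y j
  · rw [entryBit, if_pos (hasEntry_iff_mem_columnRows.2 h), if_pos h]
  · rw [entryBit, if_neg (mt hasEntry_iff_mem_columnRows.1 h), if_neg h]

/-- Vectors `g_j` in `U` supported on the rows of column `j` satisfy all conditions that involve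
`x`. What remains are `b` equations with values in `U`, so the solution space loses at most `b * dim
U` dimensions. -/
theorem sum_finrank_inf_coordSubspace_le (x : Fin m → Fin a → K) (y : Fin n → Fin b → K)
    (Y : Finset (Fin m × Fin n)) (U : Submodule K (Fin m → K))
    (hU : U ≤ LinearMap.ker (Fintype.linearCombination K x)) :
    ∑ j, Module.finrank K (U ⊓ coordSubspace K (columnRows Y j) : Submodule K (Fin m → K)) ≤
      Module.finrank K (columnRelations x y Y) + b * Module.finrank K U := by
  let W := fun j => (U ⊓ coordSubspace K (columnRows Y j) : Submodule K (Fin m → K))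
  let Ψ : (∀ j, W j) →ₗ[K] (Fin b → U) := LinearMap.pi fun l =>
    ∑ j, y j l • (Submodule.inclusion (inf_le_left : W j ≤ U)).comp (LinearMap.proj j)
  have h := finrank_le_finrank_ker_add Ψ
  rw [Module.finrank_pi_fintype, Module.finrank_pi_fintype, Finset.sum_const, Finset.card_univ,
    Fintype.card_fin, smul_eq_mul] at h
  refine h.trans (Nat.add_le_add_right ?_ _)
  let E : (∀ j, W j) →ₗ[K] (Fin n → Fin m → K) :=
    LinearMap.pi fun j => (W j).subtype.comp (LinearMap.proj j)
  have hE : Function.Injective E := fun u v huv => by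
    ext j i
    exact congrFun (congrFun huv j) i
  rw [(Submodule.equivMapOfInjective E hE (LinearMap.ker Ψ)).finrank_eq]
  apply Submodule.finrank_mono
  rintro _ ⟨u, hu, rfl⟩
  refine ⟨fun j i hi => ?_, fun j t => ?_, fun i l => ?_⟩
  · exact mem_coordSubspace.1 (u j).2.2 i (by simpa [mem_columnRows] using hi)
  · have := hU (u j).2.1
    have := congrFun (LinearMap.mem_ker.1 this) t
    simpa [E, Fintype.linearCombination_apply] using this
  · have := congrFun (congrArg Subtype.val (congrFun (LinearMap.mem_ker.1 hu) l)) i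
    simpa [Ψ, E, mul_comm] using this

theorem columnRank_le_rankBound (x : Fin m → Fin a → K) (y : Fin n → Fin b → K)
    (Y : Finset (Fin m × Fin n)) (U : Submodule K (Fin m → K))
    (hU : U ≤ LinearMap.ker (Fintype.linearCombination K x)) (q : ℕ)
    (hq : Module.finrank K U = q) (c : ℕ → ℕ)
    (h : ∀ j : Fin n, (columnRows Y j).card ≤ a + c j +
      Module.finrank K (U ⊓ coordSubspace K (columnRows Y j) : Submodule K (Fin m → K))) :
    columnRank x y Y ≤ rankBound a b Y q c := by
  have h₁ := sum_finrank_inf_coordSubspace_le x y Y U hU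
  have h₂ := columnRank_add_finrank x y Y
  have h₃ : ∑ j : Fin n, (columnRows Y j).card ≤
      ∑ j : Fin n, min (columnRows Y j).card (a + c j) + ∑ j : Fin n,
        Module.finrank K (U ⊓ coordSubspace K (columnRows Y j) : Submodule K (Fin m → K)) := by
    rw [← Finset.sum_add_distrib]
    refine Finset.sum_le_sum fun j _ => ?_
    have := h j
    omega
  rw [sum_card_columnRows] at h₃
  rw [rankBound_eq_sum, mul_comm]
  rw [hq] at h₁
  omega

theorem exists_le_ker_linearCombination (x : Fin (a + 3) → Fin a → K) (S : Submodule K (Fin (a + 3) → K))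
    {k : ℕ} (hk : a + k ≤ Module.finrank K S) :
    ∃ U ≤ S, U ≤ LinearMap.ker (Fintype.linearCombination K x) ∧ Module.finrank K U = k := by
  have := finrank_le_finrank_inf_ker_add S (Fintype.linearCombination K x)
  rw [Module.finrank_fintype_fun_eq_card, Fintype.card_fin] at this
  obtain ⟨U, hU, hr⟩ := Submodule.exists_le_finrank_eq
    (S ⊓ LinearMap.ker (Fintype.linearCombination K x)) (k := k) (by omega)
  exact ⟨U, hU.trans inf_le_left, hU.trans inf_le_right, hr⟩

/-- Take `U` of dimension `q = 3 - |I|` in the kernel, vanishing on `I`. Inside the `(a +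
q)`-dimensional space of vectors vanishing on `I`, it meets the vectors supported on `Y_j \ I` in
dimension at least `|Y_j| - |I ∩ Y_j| - a`. -/
theorem columnRank_le_rankBound_inter (x : Fin (a + 3) → Fin a → K) (y : Fin n → Fin b → K)
    (Y : Finset (Fin (a + 3) × Fin n)) (I : Finset (Fin (a + 3))) {q : ℕ} (hI : q + I.card = 3)
    (c : ℕ → ℕ) (hc : ∀ j : Fin n, c j = (I ∩ columnRows Y j).card) :
    columnRank x y Y ≤ rankBound a b Y q c := by
  have hZ : Module.finrank K (coordSubspace K ((Iᶜ : Finset _) : Set (Fin (a + 3)))) =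
      a + q := by
    rw [finrank_coordSubspace, Set.ncard_coe_finset, Finset.card_compl, Fintype.card_fin]
    omega
  obtain ⟨U, hUZ, hU, hr⟩ := exists_le_ker_linearCombination x
    (coordSubspace K ((Iᶜ : Finset _) : Set (Fin (a + 3)))) hZ.ge
  refine columnRank_le_rankBound x y Y U hU q hr c fun j => ?_
  have hle : coordSubspace K ((columnRows Y j \ I : Finset _) : Set (Fin (a + 3))) ≤
      coordSubspace K ((Iᶜ : Finset _) : Set (Fin (a + 3))) := by
    intro f hf
    rw [mem_coordSubspace] at hf ⊢
    intro i hi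
    exact hf i (by simp at hi; simp [hi])
  have hle' : coordSubspace K ((columnRows Y j \ I : Finset _) : Set (Fin (a + 3))) ≤
      coordSubspace K (columnRows Y j : Set (Fin (a + 3))) := by
    intro f hf
    rw [mem_coordSubspace] at hf ⊢
    intro i hi
    exact hf i (by simp at hi; simp [hi])
  have h₁ := finrank_add_finrank_le_of_le hUZ hle
  rw [hZ, hr, finrank_coordSubspace, Set.ncard_coe_finset] at h₁
  have h₂ := Submodule.finrank_mono (inf_le_inf_left U hle')
  have h₃ := Finset.card_sdiff_add_card_inter (columnRows Y j) I
  rw [hc, Finset.inter_comm]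
  omega

/-- The image of the three-dimensional `V` in the four-dimensional `(K × K) × (K × K)` is killed by
a nonzero functional, a sum of functionals of `f` and of `g`. If both parts are nonzero, the kernel
of one, pulled back to `V`, serves; if one part vanishes, a coordinate of the corresponding map
replaces it. -/
theorem exists_functional_pairs {V : Type*} [AddCommGroup V] [Module K V] [FiniteDimensional K V]
    (hV : Module.finrank K V = 3) (f g : V →ₗ[K] K × K) :
    ∃ (φ : V →ₗ[K] K) (u v : K × K →ₗ[K] K), u ≠ 0 ∧ v ≠ 0 ∧
      ∀ w, φ w = 0 → u (f w) = 0 ∧ v (g w) = 0 := by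
  have hne : LinearMap.range (f.prod g) < ⊤ := by
    rw [lt_top_iff_ne_top]
    intro h
    have h₁ := LinearMap.finrank_range_le (f.prod g)
    rw [h, finrank_top, hV] at h₁
    simp at h₁
  obtain ⟨s, hs, hs'⟩ := Submodule.exists_le_ker_of_lt_top _ hne
  have hsum : ∀ w, s.comp (LinearMap.inl K (K × K) (K × K)) (f w) +
      s.comp (LinearMap.inr K (K × K) (K × K)) (g w) = 0 := by
    intro w
    have : s (f w, g w) = 0 := hs' ⟨w, rfl⟩
    rw [← this, LinearMap.comp_apply, LinearMap.comp_apply, ← map_add]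
    simp
  have hfst : LinearMap.fst K K K ≠ 0 := fun h => by
    simpa using LinearMap.congr_fun h (1, 0)
  by_cases h₁ : s.comp (LinearMap.inl K (K × K) (K × K)) = 0
  · have h₂ : s.comp (LinearMap.inr K (K × K) (K × K)) ≠ 0 := by
      intro h₂
      apply hs
      ext <;> simp [h₁, h₂]
    refine ⟨(LinearMap.fst K K K).comp f, _, _, hfst, h₂, fun w hw => ⟨hw, ?_⟩⟩
    simpa [h₁] using hsum w
  · by_cases h₂ : s.comp (LinearMap.inr K (K × K) (K × K)) = 0
    · refine ⟨(LinearMap.fst K K K).comp g, _, _, h₁, hfst, fun w hw => ⟨?_, hw⟩⟩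
      have := hsum w
      rwa [h₂, LinearMap.zero_apply, add_zero] at this
    · refine ⟨(s.comp (LinearMap.inl K (K × K) (K × K))).comp f, _, _, h₁, h₂, fun w hw =>
        ⟨hw, ?_⟩⟩
      have := hsum w
      rw [LinearMap.comp_apply] at hw
      rwa [hw, zero_add] at this

theorem finrank_ker_comp_proj_prod {ι : Type*} [Fintype ι] {i i' : ι} (hi : i ≠ i')
    {u : K × K →ₗ[K] K} (hu : u ≠ 0) :
    Module.finrank K (LinearMap.ker (u.comp ((LinearMap.proj i).prod (LinearMap.proj i') :
      (ι → K) →ₗ[K] K × K))) + 1 = Fintype.card ι := by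
  classical
  rw [Module.Dual.finrank_ker_add_one_of_ne_zero, Module.finrank_fintype_fun_eq_card]
  intro h
  apply hu
  ext
  · simpa [hi.symm] using LinearMap.congr_fun h (Pi.single i 1)
  · simpa [hi] using LinearMap.congr_fun h (Pi.single i' 1)

/-- The plane `U` in the kernel satisfies one nontrivial linear equation in the coordinates `i, i'`
and one in `k, k'`. Generically it is spanned by the two lines of vectors vanishing on these pairs,
but the argument needs no genericity. -/
theorem columnRank_le_rankBound_cross (x : Fin (a + 3) → Fin a → K) (y : Fin n → Fin b → K)
    (Y : Finset (Fin (a + 3) × Fin n)) {i i' k k' : Fin (a + 3)} (hi : i' ≠ i) (hk : k' ≠ k) :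
    columnRank x y Y ≤ rankBound a b Y 2 (crossBit Y i i' k k') := by
  obtain ⟨U₀, -, hU₀, hr₀⟩ := exists_le_ker_linearCombination x ⊤ (k := 3) (by simp)
  let f : (Fin (a + 3) → K) →ₗ[K] K × K := (LinearMap.proj i).prod (LinearMap.proj i')
  let g : (Fin (a + 3) → K) →ₗ[K] K × K := (LinearMap.proj k).prod (LinearMap.proj k')
  obtain ⟨φ, u, v, hu, hv, huv⟩ := exists_functional_pairs hr₀ (f.comp U₀.subtype)
    (g.comp U₀.subtype)
  have hker := finrank_le_finrank_ker_add φ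
  rw [hr₀, Module.finrank_self] at hker
  obtain ⟨U₁, hU₁, hr⟩ := Submodule.exists_le_finrank_eq (LinearMap.ker φ) (k := 2) (by omega)
  rw [← Submodule.finrank_map_subtype_eq] at hr
  have hf : U₁.map U₀.subtype ≤ LinearMap.ker (u.comp f) := by
    rintro _ ⟨w, hw, rfl⟩
    exact (huv w (hU₁ hw)).1
  have hg : U₁.map U₀.subtype ≤ LinearMap.ker (v.comp g) := by
    rintro _ ⟨w, hw, rfl⟩
    exact (huv w (hU₁ hw)).2
  refine columnRank_le_rankBound x y Y (U₁.map U₀.subtype)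
    ((Submodule.map_subtype_le _ _).trans hU₀) 2 hr _ fun j => ?_
  -- If column `j` avoids both rows of a pair, then `U` and the vectors supported on column `j` lie
  -- in a common hyperplane of dimension `a + 2`. The intersection gains one dimension over the
  -- general estimate, and `c j = 0` suffices.
  have key : ∀ {w : K × K →ₗ[K] K} {p p' : Fin (a + 3)}, w ≠ 0 → p' ≠ p →
      U₁.map U₀.subtype ≤ LinearMap.ker (w.comp ((LinearMap.proj p).prod (LinearMap.proj p'))) →
      p ∉ columnRows Y j → p' ∉ columnRows Y j →
      (columnRows Y j).card ≤ a + Module.finrank K (U₁.map U₀.subtype ⊓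
        coordSubspace K (columnRows Y j) : Submodule K (Fin (a + 3) → K)) := by
    intro w p p' hw hp hle h h'
    have h₁ := finrank_ker_comp_proj_prod hp.symm hw
    have h₂ := finrank_add_finrank_le_of_le hle (T := coordSubspace K (columnRows Y j)) (by
      intro e he
      rw [mem_coordSubspace] at he
      have h₃ := he p (by simpa using h)
      have h₄ := he p' (by simpa using h')
      change w (e p, e p') = 0
      rw [h₃, h₄]
      exact map_zero w)
    rw [finrank_coordSubspace, Set.ncard_coe_finset, hr] at h₂
    rw [Fintype.card_fin] at h₁
    omega
  rw [crossBit, entryBit_eq, entryBit_eq, entryBit_eq, entryBit_eq]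
  by_cases h₁ : i ∉ columnRows Y j ∧ i' ∉ columnRows Y j
  · have := key hu hi hf h₁.1 h₁.2
    omega
  by_cases h₂ : k ∉ columnRows Y j ∧ k' ∉ columnRows Y j
  · have := key hv hk hg h₂.1 h₂.2
    omega
  have h₃ := finrank_add_finrank_le_of_le (S := U₁.map U₀.subtype)
    (T := coordSubspace K (columnRows Y j)) le_top le_top
  rw [finrank_coordSubspace, Set.ncard_coe_finset, hr, finrank_top,
    Module.finrank_fintype_fun_eq_card, Fintype.card_fin] at h₃
  have h₄ : 1 ≤ max (if i ∈ columnRows Y j then 1 else 0)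
      (if i' ∈ columnRows Y j then 1 else 0) := by
    rw [not_and_or, not_not, not_not] at h₁
    rcases h₁ with h | h <;> simp [h]
  have h₅ : 1 ≤ max (if k ∈ columnRows Y j then 1 else 0)
      (if k' ∈ columnRows Y j then 1 else 0) := by
    rw [not_and_or, not_not, not_not] at h₂
    rcases h₂ with h | h <;> simp [h]
  have h₆ := le_min h₄ h₅
  omega

theorem columnRank_le_of_mem_rankBounds (x : Fin (a + 3) → Fin a → K) (y : Fin n → Fin b → K)
    (Y : Finset (Fin (a + 3) × Fin n)) {r : ℕ} (hr : r ∈ rankBounds Y a b) :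
    columnRank x y Y ≤ r := by
  simp only [rankBounds, Set.mem_union, Set.mem_singleton_iff, Set.mem_iUnion, exists_prop] at hr
  rcases hr with rfl | rfl | ⟨i, hi, rfl | ⟨i', hi', rfl | ⟨k, hk, k', hk', rfl⟩⟩⟩
  -- `U = 0` gives the trivial bound by the number of elements, since no column has more than `a +
  -- 3`.
  · refine columnRank_le_rankBound x y Y ⊥ bot_le 0 (finrank_bot K _) _ fun j => ?_
    have := (columnRows Y j).card_le_univ
    rw [Fintype.card_fin] at this
    omega
  · exact columnRank_le_rankBound_inter x y Y ∅ (by simp) _ (by simp)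
  · refine columnRank_le_rankBound_inter x y Y {⟨i, hi⟩} (by simp) _ fun j => ?_
    rw [entryBit_eq Y ⟨i, hi⟩ j]
    by_cases h : (⟨i, hi⟩ : Fin (a + 3)) ∈ columnRows Y j <;> simp [h]
  · have hne : (⟨i, hi⟩ : Fin (a + 3)) ≠ ⟨i', hi'.trans hi⟩ := by
      simp only [ne_eq, Fin.mk.injEq]
      omega
    refine columnRank_le_rankBound_inter x y Y {⟨i, hi⟩, ⟨i', hi'.trans hi⟩}
      (by rw [Finset.card_pair hne]) _ fun j => ?_
    rw [entryBit_eq Y ⟨i, hi⟩ j, entryBit_eq Y ⟨i', hi'.trans hi⟩ j]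
    by_cases h : (⟨i, hi⟩ : Fin (a + 3)) ∈ columnRows Y j <;>
    by_cases h' : (⟨i', hi'.trans hi⟩ : Fin (a + 3)) ∈ columnRows Y j <;>
    simp [h, h', Finset.insert_inter_of_mem, Finset.insert_inter_of_notMem,
      Finset.card_pair hne]
  · exact columnRank_le_rankBound_cross x y Y (i := ⟨i, hi⟩) (i' := ⟨i', hi'.trans hi⟩)
      (k := ⟨k, hk⟩) (k' := ⟨k', hk'.trans hk⟩) (by simp only [ne_eq, Fin.mk.injEq]; omega)
      (by simp only [ne_eq, Fin.mk.injEq]; omega)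

end UpperBound

/-! ### Distributing elements among monotone submodular functions. -/

section Assignment

variable {α β : Type*} [DecidableEq α] [Fintype β] [DecidableEq β]

/-- Monotone submodular functions on finite sets. -/
structure MonotoneSubmodular (F : Finset α → ℕ) : Prop where
  monotone : Monotone F
  submodular : ∀ A B, F (A ∪ B) + F (A ∩ B) ≤ F A + F B

theorem MonotoneSubmodular.insert {F : Finset α → ℕ} (hF : MonotoneSubmodular F) (k : α) :
    MonotoneSubmodular fun A => F (insert k A) where
  monotone A B h := hF.monotone (Finset.insert_subset_insert k h)
  submodular A B := by
    rw [Finset.insert_union_distrib, Finset.insert_inter_distrib]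
    exact hF.submodular _ _

theorem MonotoneSubmodular.min {F : Finset α → ℕ} (hF : MonotoneSubmodular F) (c : ℕ) :
    MonotoneSubmodular fun A => min c (F A) where
  monotone A B h := min_le_min_left c (hF.monotone h)
  submodular A B := by
    have h₁ := hF.submodular A B
    have h₂ := hF.monotone (Finset.inter_subset_left : A ∩ B ⊆ A)
    have h₃ := hF.monotone (Finset.inter_subset_right : A ∩ B ⊆ B)
    have h₄ := hF.monotone (Finset.subset_union_left : A ⊆ A ∪ B)
    have h₅ := hF.monotone (Finset.subset_union_right : B ⊆ A ∪ B)
    omega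

theorem monotoneSubmodular_card_biUnion {γ : Type*} [DecidableEq γ] (G : Finset γ)
    (S : α → Finset γ) : MonotoneSubmodular fun A => (G ∪ A.biUnion S).card where
  monotone A B h := Finset.card_le_card
    (Finset.union_subset_union_right (Finset.biUnion_subset_biUnion_of_subset_left S h))
  submodular A B := by
    rw [← Finset.card_union_add_card_inter (G ∪ A.biUnion S)]
    refine Nat.add_le_add (Finset.card_le_card ?_) (Finset.card_le_card ?_)
    · intro x
      simp only [Finset.mem_union, Finset.mem_biUnion]
      grind
    · intro x
      simp only [Finset.mem_union, Finset.mem_biUnion, Finset.mem_inter]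
      grind

theorem monotoneSubmodular_finrank_iSup {K V : Type*} [Field K] [AddCommGroup V] [Module K V]
    [FiniteDimensional K V] (G : Submodule K V) (S : α → Submodule K V) :
    MonotoneSubmodular fun A => Module.finrank K (G ⊔ ⨆ k ∈ A, S k : Submodule K V) where
  monotone A B h := Submodule.finrank_mono (sup_le_sup_left (biSup_mono h) G)
  submodular A B := by
    rw [← Submodule.finrank_sup_add_finrank_inf_eq (G ⊔ ⨆ k ∈ A, S k)]
    refine Nat.add_le_add (Submodule.finrank_mono ?_) (Submodule.finrank_mono ?_)
    · rw [Finset.iSup_union]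
      exact sup_le (le_sup_of_le_left le_sup_left)
        (sup_le_sup le_sup_right le_sup_right)
    · exact le_inf (sup_le_sup_left (biSup_mono fun k hk => (Finset.mem_inter.1 hk).1) G)
        (sup_le_sup_left (biSup_mono fun k hk => (Finset.mem_inter.1 hk).2) G)

/-- A min-max theorem of matroid-union type: the elements of `E` can be distributed, some possibly
unused, so that the total value reaches the minimum of `|E \ A| + ∑ t, F t A`. In the induction a
new element `k` either stays unused or goes to a `t` for which it raises the value of the largest
set violating the hypothesis without `k`. -/
theorem exists_assignment (E : Finset α) (F : β → Finset α → ℕ)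
    (hF : ∀ t, MonotoneSubmodular (F t)) (v : ℕ)
    (hv : ∀ A ⊆ E, v ≤ (E \ A).card + ∑ t, F t A) :
    ∃ σ : α → Option β, v ≤ ∑ t, F t (E.filter fun k => σ k = some t) := by
  induction E using Finset.induction_on generalizing F v with
  | empty => exact ⟨fun _ => none, by simpa using hv ∅⟩
  | insert k E hk ih =>
    by_cases h : ∀ A ⊆ E, v ≤ (E \ A).card + ∑ t, F t A
    · obtain ⟨σ, hσ⟩ := ih F hF v h
      refine ⟨Function.update σ k none, hσ.trans_eq (Finset.sum_congr rfl fun t _ => ?_)⟩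
      congr 1
      ext j
      simp only [Finset.mem_filter, Finset.mem_insert, Function.update_apply]
      grind
    have hsd : ∀ A ⊆ E, (insert k E \ A).card = (E \ A).card + 1 := by
      intro A hA
      rw [Finset.insert_sdiff_of_notMem _ (fun h => hk (hA h)), Finset.card_insert_of_notMem]
      exact fun h => hk (Finset.mem_sdiff.1 h).1
    have hge : ∀ A ⊆ E, v ≤ (E \ A).card + ∑ t, F t A + 1 := by
      intro A hA
      have := hv A (hA.trans (Finset.subset_insert k E))
      rw [hsd A hA] at this
      omega
    push Not at h
    have hne : (E.powerset.filter fun A => (E \ A).card + ∑ t, F t A < v).Nonempty := by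
      obtain ⟨A, hA, hlt⟩ := h
      exact ⟨A, by simp [hA, hlt]⟩
    obtain ⟨A₀, hA₀, hmax⟩ := Finset.exists_max_image _ Finset.card hne
    simp only [Finset.mem_filter, Finset.mem_powerset] at hA₀ hmax
    -- By `hge` a violating set misses `v` by exactly one. The left side is submodular in `A`, so
    -- violating sets are closed under union, and the largest one contains all others.
    have hsub : ∀ A ⊆ E, (E \ A).card + ∑ t, F t A < v → A ⊆ A₀ := by
      intro A hA hlt
      have hU := Finset.union_subset hA hA₀.1
      have hI : A ∩ A₀ ⊆ E := Finset.inter_subset_left.trans hA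
      have h₁ := hge _ hI
      have h₂ : ∑ t, F t (A ∪ A₀) + ∑ t, F t (A ∩ A₀) ≤ ∑ t, F t A + ∑ t, F t A₀ := by
        rw [← Finset.sum_add_distrib, ← Finset.sum_add_distrib]
        exact Finset.sum_le_sum fun t _ => (hF t).submodular A A₀
      have h₃ := Finset.card_union_add_card_inter A A₀
      have h₄ := Finset.card_sdiff_add_card_eq_card hA
      have h₅ := Finset.card_sdiff_add_card_eq_card hA₀.1
      have h₆ := Finset.card_sdiff_add_card_eq_card hU
      have h₇ := Finset.card_sdiff_add_card_eq_card hI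
      have h₈ := hmax _ ⟨hU, by omega⟩
      have h₉ := Finset.eq_of_subset_of_card_le (Finset.subset_union_right : A₀ ⊆ A ∪ A₀) h₈
      rw [h₉]
      exact Finset.subset_union_left
    have hk₀ : k ∉ A₀ := fun h => hk (hA₀.1 h)
    -- Otherwise `insert k A₀` would contradict the hypothesis for `insert k E`.
    obtain ⟨t, ht⟩ : ∃ t, F t A₀ < F t (insert k A₀) := by
      by_contra! hcon
      have h₁ := hv (insert k A₀) (Finset.insert_subset_insert k hA₀.1)
      rw [Finset.insert_sdiff_insert, Finset.sdiff_insert_of_notMem hk] at h₁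
      have h₂ := Finset.sum_le_sum fun t (_ : t ∈ Finset.univ) => hcon t
      omega
    let F' : β → Finset α → ℕ := fun s A => F s (if s = t then insert k A else A)
    have hle : ∀ s A, F s A ≤ F' s A := by
      intro s A
      apply (hF s).monotone
      split_ifs
      exacts [Finset.subset_insert k A, subset_rfl]
    obtain ⟨σ, hσ⟩ := ih F' (by
      intro s
      by_cases hs : s = t
      · simpa only [F', if_pos hs] using (hF s).insert k
      · simpa only [F', if_neg hs] using hF s) v (by
      intro A hA
      have h₁ := Finset.sum_le_sum fun s (_ : s ∈ Finset.univ) => hle s A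
      by_cases hlt : (E \ A).card + ∑ t, F t A < v
      · have hAA := hsub A hA hlt
        have hkA : k ∉ A := fun h => hk (hA h)
        -- Diminishing returns: since `k` raises `F t` at `A₀`, it also raises it at the smaller set
        -- `A`.
        have h₂ := (hF t).submodular A₀ (insert k A)
        rw [Finset.union_insert, Finset.union_eq_left.2 hAA, Finset.inter_insert_of_notMem hk₀,
          Finset.inter_eq_right.2 hAA] at h₂
        have h₃ : ∑ s, F s A < ∑ s, F' s A := by
          refine Finset.sum_lt_sum (fun s _ => hle s A) ⟨t, Finset.mem_univ t, ?_⟩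
          simp only [F', if_true]
          omega
        have h₄ := hge A hA
        omega
      · omega)
    refine ⟨Function.update σ k (some t), hσ.trans_eq (Finset.sum_congr rfl fun s _ => ?_)⟩
    simp only [F']
    congr 1
    ext j
    by_cases hs : s = t
    · simp only [hs, if_true, Finset.mem_filter, Finset.mem_insert, Function.update_apply]
      grind
    · simp only [if_neg hs, Finset.mem_filter, Finset.mem_insert, Function.update_apply]
      grind

/-- Every group needs a representative in the construction of `y`, so empty groups have to be
filled. An element that is unassigned or not alone in its group can be moved to an empty group
without loss, because the truncated cardinality of a union is subadditive. -/
theorem exists_surjective_assignment [Fintype α] {γ : Type*} [DecidableEq γ] (S : α → Finset γ)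
    (hcard : Fintype.card β ≤ Fintype.card α) (c v : ℕ) (τ : α → Option β)
    (hτ : v ≤ ∑ t, min c ((Finset.univ.filter fun j => τ j = some t).biUnion S).card) :
    ∃ σ : α → Option β, (∀ t, ∃ j, σ j = some t) ∧
      v ≤ ∑ t, min c ((Finset.univ.filter fun j => σ j = some t).biUnion S).card := by
  let hit : (α → Option β) → Finset β := fun σ => Finset.univ.filter fun t => ∃ j, σ j = some t
  have hne : (Finset.univ.filter fun σ : α → Option β =>
      v ≤ ∑ t, min c ((Finset.univ.filter fun j => σ j = some t).biUnion S).card).Nonempty :=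
    ⟨τ, by simpa using hτ⟩
  obtain ⟨σ, hσ, hmax⟩ := Finset.exists_max_image _ (fun σ => (hit σ).card) hne
  simp only [Finset.mem_filter, Finset.mem_univ, true_and] at hσ hmax
  refine ⟨σ, ?_, hσ⟩
  by_contra! hcon
  obtain ⟨t, ht⟩ := hcon
  -- If each element were alone in its group, the assignment would be an injection missing `t`,
  -- contradicting `hcard`.
  obtain ⟨j, hj⟩ : ∃ j, ∀ s, σ j = some s → ∃ j', j' ≠ j ∧ σ j' = some s := by
    by_contra! hcon
    choose f hf hf' using hcon
    have hinj : Function.Injective f := by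
      intro i j hij
      by_contra hne
      exact hf' j i hne (hij ▸ hf i)
    have := Fintype.card_lt_of_injective_of_notMem f hinj (b := t) (by
      rintro ⟨j, rfl⟩
      exact ht j (hf j))
    omega
  have hlt : (hit σ).card < (hit (Function.update σ j (some t))).card := by
    apply Finset.card_lt_card
    rw [Finset.ssubset_iff_of_subset]
    · exact ⟨t, by simp only [hit, Finset.mem_filter, Finset.mem_univ, true_and]; exact ⟨j, by simp⟩,
        by simpa [hit] using ht⟩
    · intro s
      simp only [hit, Finset.mem_filter, Finset.mem_univ, true_and]
      rintro ⟨i, hi⟩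
      by_cases hij : i = j
      · obtain ⟨j', hne, hj'⟩ := hj s (hij ▸ hi)
        exact ⟨j', by rwa [Function.update_of_ne hne]⟩
      · exact ⟨i, by rwa [Function.update_of_ne hij]⟩
  refine (hmax _ (hσ.trans ?_)).not_gt hlt
  have ht0 : (Finset.univ.filter fun j => σ j = some t) = ∅ := by
    simpa [Finset.filter_eq_empty_iff] using ht
  have htj : (Finset.univ.filter fun i => Function.update σ j (some t) i = some t) = {j} := by
    ext i
    simp only [Finset.mem_filter, Finset.mem_univ, true_and, Finset.mem_singleton,
      Function.update_apply]
    grind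
  have hother : ∀ s, s ≠ t → σ j ≠ some s →
      (Finset.univ.filter fun i => Function.update σ j (some t) i = some s) =
        Finset.univ.filter fun i => σ i = some s := by
    intro s hs hj
    ext i
    simp only [Finset.mem_filter, Finset.mem_univ, true_and, Function.update_apply]
    grind
  rcases hs : σ j with _ | s
  · refine Finset.sum_le_sum fun s _ => ?_
    by_cases hst : s = t
    · subst hst
      simp [ht0]
    · rw [hother s hst (by simp [hs])]
  · have hst : s ≠ t := fun h => ht j (h ▸ hs)
    rw [← Finset.add_sum_erase _ _ (Finset.mem_univ t),
      ← Finset.add_sum_erase _ _ (Finset.mem_erase.2 ⟨hst, Finset.mem_univ s⟩),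
      ← Finset.add_sum_erase _ _ (Finset.mem_univ t),
      ← Finset.add_sum_erase _ _ (Finset.mem_erase.2 ⟨hst, Finset.mem_univ s⟩), ht0, htj]
    have h₁ : ∑ r ∈ (Finset.univ.erase t).erase s,
          min c ((Finset.univ.filter fun i => σ i = some r).biUnion S).card =
        ∑ r ∈ (Finset.univ.erase t).erase s, min c ((Finset.univ.filter fun i =>
          Function.update σ j (some t) i = some r).biUnion S).card := by
      refine Finset.sum_congr rfl fun r hr => ?_
      simp only [Finset.mem_erase] at hr
      rw [hother r hr.2.1 (by rw [hs]; simpa using Ne.symm hr.1)]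
    have h₂ : ((Finset.univ.filter fun i => σ i = some s).biUnion S) ⊆ (({j} : Finset α).biUnion S) ∪
        (Finset.univ.filter fun i => Function.update σ j (some t) i = some s).biUnion S := by
      intro x
      simp only [Finset.mem_union, Finset.mem_biUnion, Finset.mem_filter, Finset.mem_univ, true_and,
        Finset.mem_singleton, Function.update_apply]
      grind
    have h₃ := (Finset.card_le_card h₂).trans (Finset.card_union_le _ _)
    simp only [Finset.biUnion_empty, Finset.card_empty]
    omega

end Assignment

/-! ### Three-dimensional spaces in general position. -/

section Vanishing

variable {K : Type*} [Field K]

/-- The elements of `N` that vanish on `S`. -/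
def vanishOn {ι : Type*} (N : Submodule K (ι → K)) (S : Finset ι) : Submodule K (ι → K) :=
  N ⊓ LinearMap.ker (LinearMap.funLeft K K (Subtype.val : S → ι))

theorem mem_vanishOn {ι : Type*} {N : Submodule K (ι → K)} {S : Finset ι} {f : ι → K} :
    f ∈ vanishOn N S ↔ f ∈ N ∧ ∀ i ∈ S, f i = 0 := by
  simp [vanishOn, LinearMap.funLeft, funext_iff]

theorem vanishOn_union {ι : Type*} [DecidableEq ι] (N : Submodule K (ι → K)) (S T : Finset ι) :
    vanishOn N (S ∪ T) = vanishOn N S ⊓ vanishOn N T := by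
  ext f
  simp only [Submodule.mem_inf, mem_vanishOn, Finset.mem_union]
  grind

theorem vanishOn_anti {ι : Type*} (N : Submodule K (ι → K)) {S T : Finset ι} (h : S ⊆ T) :
    vanishOn N T ≤ vanishOn N S := fun _ hf =>
  mem_vanishOn.2 ⟨(mem_vanishOn.1 hf).1, fun i hi => (mem_vanishOn.1 hf).2 i (h hi)⟩

theorem vanishOn_le {ι : Type*} (N : Submodule K (ι → K)) (S : Finset ι) : vanishOn N S ≤ N :=
  inf_le_left

/-- A three-dimensional space of functions in general position with respect to the coordinates. -/
structure InGeneralPosition {ι : Type*} (N : Submodule K (ι → K)) : Prop where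
  finrank_eq : Module.finrank K N = 3
  vanishOn_eq_bot : ∀ S : Finset ι, S.card = 3 → vanishOn N S = ⊥
  sup_eq : ∀ P Q R : Finset ι, P.card = 2 → Q.card = 2 → R.card = 2 → Disjoint P Q →
    Disjoint P R → Disjoint Q R → N ≤ vanishOn N P ⊔ vanishOn N Q ⊔ vanishOn N R

/-- Each coordinate costs at most one dimension, and three coordinates cost all three; for smaller
`S` the second fact is applied to a set of three containing `S`. -/
theorem InGeneralPosition.finrank_vanishOn {ι : Type*} [Fintype ι] {N : Submodule K (ι → K)}
    (hN : InGeneralPosition N) (hι : 3 ≤ Fintype.card ι) (S : Finset ι) :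
    Module.finrank K (vanishOn N S) = 3 - S.card := by
  classical
  have hge := finrank_le_finrank_inf_ker_add N (LinearMap.funLeft K K (Subtype.val : S → ι))
  rw [hN.finrank_eq, Module.finrank_fintype_fun_eq_card, Fintype.card_coe] at hge
  change 3 ≤ Module.finrank K (vanishOn N S) + S.card at hge
  rcases le_or_gt 3 S.card with h | h
  · obtain ⟨T, hTS, hT⟩ := Finset.exists_subset_card_eq h
    have : vanishOn N S = ⊥ := eq_bot_iff.2 ((vanishOn_anti N hTS).trans (hN.vanishOn_eq_bot T hT).le)
    rw [this, finrank_bot]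
    omega
  · obtain ⟨T, hST, hT⟩ := Finset.exists_superset_card_eq (s := S) (n := 3) h.le hι
    have hle := finrank_le_finrank_inf_ker_add (vanishOn N S)
      (LinearMap.funLeft K K (Subtype.val : (T \ S : Finset ι) → ι))
    have hbot : vanishOn N S ⊓ LinearMap.ker
        (LinearMap.funLeft K K (Subtype.val : (T \ S : Finset ι) → ι)) = ⊥ := by
      rw [eq_bot_iff, ← hN.vanishOn_eq_bot T hT]
      conv_rhs => rw [← Finset.union_sdiff_of_subset hST, vanishOn_union]
      exact le_inf inf_le_left (inf_le_inf_right _ (vanishOn_le N S))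
    rw [hbot, finrank_bot, Module.finrank_fintype_fun_eq_card, Fintype.card_coe,
      Finset.card_sdiff_of_subset hST, hT] at hle
    omega

end Vanishing

/-! ### Special values of `y` built from a grouping of the columns. -/

section Relations

variable {K : Type*} [Field K] {m n a b : ℕ}

/-- The rows in which `Y` has no element in the column `j`. -/
def missingRows (Y : Finset (Fin m × Fin n)) (j : Fin n) : Finset (Fin m) :=
  (columnRows Y j)ᶜ

theorem mem_columnRelations_iff {x : Fin m → Fin a → K} {y : Fin n → Fin b → K}
    {Y : Finset (Fin m × Fin n)} {g : Fin n → Fin m → K} :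
    g ∈ columnRelations x y Y ↔
      (∀ j, g j ∈ vanishOn (LinearMap.ker (Fintype.linearCombination K x)) (missingRows Y j)) ∧
        ∀ l, ∑ j, y j l • g j = 0 := by
  simp only [columnRelations, mem_vanishOn, Submodule.mem_mk, AddSubmonoid.mem_mk,
    AddSubsemigroup.mem_mk, Set.mem_ofPred_eq, LinearMap.mem_ker, Fintype.linearCombination_apply,
    missingRows, Finset.mem_compl, mem_columnRows, funext_iff, Finset.sum_apply, Pi.smul_apply,
    smul_eq_mul, Pi.zero_apply, mul_comm, forall_and]
  rw [forall_comm (α := Fin m) (β := Fin b)]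
  tauto

/-- Each of the `b` columns that is not a representative gets one equation: it says that `g_j`
equals the vector of its representative, or zero if `j` has no group. A relation is then determined
by the `e` vectors at the representatives, and each of them vanishes wherever a member of its group
must. -/
theorem exists_finrank_columnRelations_le (x : Fin m → Fin a → K) (Y : Finset (Fin m × Fin n))
    {e : ℕ} (he : e + b = n) (τ : Fin n → Option (Fin e)) (hτ : ∀ t, ∃ j, τ j = some t) :
    ∃ y : Fin n → Fin b → K, Module.finrank K (columnRelations x y Y) ≤
      ∑ t, Module.finrank K (vanishOn (LinearMap.ker (Fintype.linearCombination K x))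
        ((Finset.univ.filter fun j => τ j = some t).biUnion (missingRows Y))) := by
  choose rep hrep using hτ
  have hinj : Function.Injective rep := fun s t h => by
    have := hrep s
    rw [h, hrep t] at this
    simpa using this.symm
  have hcard : ((Finset.univ.image rep)ᶜ).card = b := by
    rw [Finset.card_compl, Finset.card_image_of_injective _ hinj, Finset.card_univ,
      Fintype.card_fin, Fintype.card_fin]
    omega
  let ν := ((Finset.univ.image rep)ᶜ).equivFinOfCardEq hcard
  let y : Fin n → Fin b → K := fun q l => (if q = ν.symm l then 1 else 0) -
    (τ (ν.symm l)).elim 0 fun t => if q = rep t then 1 else 0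
  have hy : ∀ (g : Fin n → Fin m → K) l, ∑ q, y q l • g q =
      g (ν.symm l) - (τ (ν.symm l)).elim 0 fun t => g (rep t) := by
    intro g l
    simp only [y, sub_smul, Finset.sum_sub_distrib]
    congr 1
    · simp
    · cases τ (ν.symm l) <;> simp
  have hg : ∀ g ∈ columnRelations x y Y, ∀ q, g q = (τ q).elim 0 fun t => g (rep t) := by
    intro g hg q
    by_cases hq : q ∈ Finset.univ.image rep
    · obtain ⟨t, -, rfl⟩ := Finset.mem_image.1 hq
      rw [hrep, Option.elim_some]
    · have h := (mem_columnRelations_iff.1 hg).2 (ν ⟨q, Finset.mem_compl.2 hq⟩)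
      rw [hy, Equiv.symm_apply_apply] at h
      exact sub_eq_zero.1 h
  refine ⟨y, ?_⟩
  let N := LinearMap.ker (Fintype.linearCombination K x)
  have hmem : ∀ (g : columnRelations x y Y) t, g.1 (rep t) ∈ vanishOn N
      ((Finset.univ.filter fun j => τ j = some t).biUnion (missingRows Y)) := by
    rintro ⟨g, hgr⟩ t
    refine mem_vanishOn.2 ⟨(mem_vanishOn.1 ((mem_columnRelations_iff.1 hgr).1 _)).1, ?_⟩
    intro i hi
    simp only [Finset.mem_biUnion, Finset.mem_filter, Finset.mem_univ, true_and] at hi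
    obtain ⟨j, hj, hi⟩ := hi
    have h := hg g hgr j
    rw [hj, Option.elim_some] at h
    exact (congrFun h i).symm.trans ((mem_vanishOn.1 ((mem_columnRelations_iff.1 hgr).1 j)).2 i hi)
  let L : columnRelations x y Y →ₗ[K] ∀ t, vanishOn N
      ((Finset.univ.filter fun j => τ j = some t).biUnion (missingRows Y)) :=
    LinearMap.pi fun t => LinearMap.codRestrict _
      ((LinearMap.proj (rep t)).comp (columnRelations x y Y).subtype) fun g => hmem g t
  have hL : Function.Injective L := by
    intro g h hgh
    ext q i
    rw [hg g.1 g.2, hg h.1 h.2]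
    rcases τ q with _ | t
    · rfl
    · exact congrFun (congrArg Subtype.val (congrFun hgh t)) i
  have := LinearMap.finrank_le_finrank_of_injective hL
  rwa [Module.finrank_pi_fintype] at this

/-- With `y` the incidence matrix of `τ`, equation `l` says that the vectors of group `l` sum to
zero. The range of the equation map contains the product of the spans of the groups, and
rank-nullity gives the estimate. -/
theorem exists_finrank_columnRelations_add_le (x : Fin m → Fin a → K)
    (Y : Finset (Fin m × Fin n)) (τ : Fin n → Option (Fin b)) :
    ∃ y : Fin n → Fin b → K, Module.finrank K (columnRelations x y Y) +
      ∑ t, Module.finrank K (⨆ j ∈ Finset.univ.filter fun j => τ j = some t,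
        vanishOn (LinearMap.ker (Fintype.linearCombination K x)) (missingRows Y j) :
          Submodule K (Fin m → K)) ≤
      ∑ j, Module.finrank K
        (vanishOn (LinearMap.ker (Fintype.linearCombination K x)) (missingRows Y j)) := by
  let Z := fun j => vanishOn (LinearMap.ker (Fintype.linearCombination K x)) (missingRows Y j)
  let y : Fin n → Fin b → K := fun q l => if τ q = some l then 1 else 0
  let Ψ : (∀ j, Z j) →ₗ[K] (Fin b → Fin m → K) := LinearMap.pi fun l =>
    ∑ j, y j l • (Z j).subtype.comp (LinearMap.proj j)
  refine ⟨y, ?_⟩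
  have h := Ψ.finrank_range_add_finrank_ker
  rw [Module.finrank_pi_fintype] at h
  rw [← h, add_comm]
  refine Nat.add_le_add ?_ ?_
  · let P : Fin b → Submodule K (Fin m → K) := fun t =>
      ⨆ j ∈ Finset.univ.filter fun j => τ j = some t, Z j
    have hP : ∑ t, Module.finrank K (P t) ≤ Module.finrank K (Submodule.pi Set.univ P) := by
      rw [← Module.finrank_pi_fintype]
      refine LinearMap.finrank_le_finrank_of_injective (f := LinearMap.codRestrict
        (Submodule.pi Set.univ P) (LinearMap.pi fun t => (P t).subtype.comp (LinearMap.proj t))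
        fun f t _ => (f t).2) fun f g hfg => ?_
      ext t i
      exact congrFun (congrFun (congrArg Subtype.val hfg) t) i
    refine hP.trans (Submodule.finrank_mono ?_)
    rw [← Submodule.iSup_map_single]
    refine iSup_le fun t => ?_
    rw [Submodule.map_iSup]
    refine iSup_le fun j => ?_
    rw [Submodule.map_iSup]
    refine iSup_le fun hj => ?_
    simp only [Finset.mem_filter, Finset.mem_univ, true_and] at hj
    rintro _ ⟨f, hf, rfl⟩
    refine ⟨Pi.single j ⟨f, hf⟩, ?_⟩
    ext l i
    simp only [Ψ, LinearMap.pi_apply, LinearMap.sum_apply, LinearMap.smul_apply,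
      LinearMap.comp_apply, LinearMap.proj_apply, Submodule.subtype_apply]
    rw [Finset.sum_eq_single j]
    · simp only [Pi.single_eq_same, y, hj, Option.some.injEq, LinearMap.coe_single]
      by_cases hl : t = l
      · subst hl; simp
      · simp [hl, Ne.symm hl]
    · intro k _ hk
      simp [Pi.single_eq_of_ne hk]
    · simp
  · let E : (∀ j, Z j) →ₗ[K] (Fin n → Fin m → K) :=
      LinearMap.pi fun j => (Z j).subtype.comp (LinearMap.proj j)
    have hE : columnRelations x y Y ≤ (LinearMap.ker Ψ).map E := by
      intro g hg
      rw [mem_columnRelations_iff] at hg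
      refine ⟨fun j => ⟨g j, hg.1 j⟩, ?_, rfl⟩
      ext l i
      simpa [Ψ] using congrFun (hg.2 l) i
    exact (Submodule.finrank_mono hE).trans (Submodule.finrank_map_le E _)

end Relations

/-! ### Min-max form of the assignment, and separate groups for exceptional columns. -/

section Assignment

variable {α β : Type*} [DecidableEq α] [Fintype β] [DecidableEq β]

theorem exists_assignment_le (E : Finset α) (F : β → Finset α → ℕ)
    (hF : ∀ t, MonotoneSubmodular (F t)) :
    ∃ σ : α → Option β, ∃ A ⊆ E,
      (E \ A).card + ∑ t, F t A ≤ ∑ t, F t (E.filter fun k => σ k = some t) := by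
  obtain ⟨A, hA, hmin⟩ := Finset.exists_min_image E.powerset
    (fun A => (E \ A).card + ∑ t, F t A) ⟨∅, by simp⟩
  obtain ⟨σ, hσ⟩ := exists_assignment E F hF ((E \ A).card + ∑ t, F t A)
    fun B hB => hmin B (Finset.mem_powerset.2 hB)
  exact ⟨σ, A, Finset.mem_powerset.1 hA, hσ⟩

theorem exists_partial_injection (B : Finset α) (hB : B.card ≤ Fintype.card β) :
    ∃ ρ : α → Option β, (∀ j ∈ B, ∃ t, ρ j = some t) ∧ (∀ j ∉ B, ρ j = none) ∧
      ∀ j k t, ρ j = some t → ρ k = some t → j = k := by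
  obtain ⟨f⟩ := Function.Embedding.nonempty_of_card_le (α := B) (β := β) (by simpa using hB)
  refine ⟨fun j => if h : j ∈ B then some (f ⟨j, h⟩) else none, fun j hj => ⟨f ⟨j, hj⟩, by simp [hj]⟩,
    fun j hj => by simp [hj], fun j k t hj hk => ?_⟩
  dsimp only at hj hk
  split_ifs at hj hk with h₁ h₂
  simpa using f.injective (Option.some_injective _ (hj.trans hk.symm))

/-- The groups that `ρ` hits contribute at least the values `φ` on `B`, and each of the remaining
groups contributes at least `d`. -/
theorem sum_add_card_mul_le {B : Finset α} {ρ : α → Option β} (hρ : ∀ j ∈ B, ∃ t, ρ j = some t)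
    (hinj : ∀ j k t, ρ j = some t → ρ k = some t → j = k) {f : β → ℕ} {φ : α → ℕ} {d : ℕ}
    (hd : ∀ t, d ≤ f t) (hφ : ∀ j t, ρ j = some t → φ j ≤ f t) :
    ∑ j ∈ B, φ j + Fintype.card β * d ≤ ∑ t, f t + B.card * d := by
  choose r hr using hρ
  have hrinj : Function.Injective fun j : B => r j.1 j.2 := fun j k h => by
    refine Subtype.ext (hinj j k _ (hr j.1 j.2) ?_)
    rw [hr k.1 k.2]
    exact congrArg some h.symm
  have h₁ : ∑ j ∈ B.attach, f (r j.1 j.2) = ∑ t ∈ B.attach.image fun j => r j.1 j.2, f t := by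
    rw [Finset.sum_image fun j _ k _ h => hrinj h]
  have h₂ : ∑ j ∈ B, φ j ≤ ∑ j ∈ B.attach, f (r j.1 j.2) := by
    rw [← Finset.sum_attach]
    exact Finset.sum_le_sum fun j _ => hφ _ _ (hr j.1 j.2)
  have h₃ := Finset.sum_add_sum_compl (B.attach.image fun j => r j.1 j.2) f
  have h₄ : (B.attach.image fun j => r j.1 j.2)ᶜ.card * d ≤
      ∑ t ∈ (B.attach.image fun j => r j.1 j.2)ᶜ, f t :=
    Finset.card_nsmul_le_sum _ f d fun t _ => hd t
  have h₅ : (B.attach.image fun j => r j.1 j.2).card = B.card := by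
    rw [Finset.card_image_of_injective _ hrinj, Finset.card_attach]
  have h₆ := Finset.card_add_card_compl (B.attach.image fun j => r j.1 j.2)
  rw [← h₆, h₅, add_mul]
  omega

end Assignment

/-! ### Recognizing members of `rankBounds`. -/

section Bounds

variable {m n a b : ℕ}

theorem exists_rankBound_inter_mem (Y : Finset (Fin (a + 3) × Fin n)) (I : Finset (Fin (a + 3)))
    {q : ℕ} (hq : 1 ≤ q) (hI : q + I.card = 3) :
    ∃ c : ℕ → ℕ, (∀ j : Fin n, c j = (I ∩ columnRows Y j).card) ∧
      rankBound a b Y q c ∈ rankBounds Y a b := by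
  simp only [rankBounds, Set.mem_union, Set.mem_singleton_iff, Set.mem_iUnion, exists_prop]
  obtain h | h | h : I.card = 0 ∨ I.card = 1 ∨ I.card = 2 := by omega
  · obtain rfl : q = 3 := by omega
    obtain rfl := Finset.card_eq_zero.1 h
    exact ⟨fun _ => 0, by simp, Or.inr (Or.inl rfl)⟩
  · obtain rfl : q = 2 := by omega
    obtain ⟨i, rfl⟩ := Finset.card_eq_one.1 h
    refine ⟨fun j => entryBit Y i j, fun j => ?_, Or.inr (Or.inr ⟨i, i.2, Or.inl rfl⟩)⟩
    simp only [entryBit_eq]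
    by_cases h : i ∈ columnRows Y j <;> simp [h]
  · obtain rfl : q = 1 := by omega
    obtain ⟨i, i', hne, hII⟩ := Finset.card_eq_two.1 h
    obtain ⟨i, i', hlt, rfl⟩ : ∃ i i' : Fin (a + 3), i' < i ∧ I = {i, i'} := by
      rcases lt_or_gt_of_ne hne with h | h
      · exact ⟨i', i, h, by rw [hII, Finset.pair_comm]⟩
      · exact ⟨i, i', h, hII⟩
    refine ⟨fun j => entryBit Y i j + entryBit Y i' j, fun j => ?_,
      Or.inr (Or.inr ⟨i, i.2, Or.inr ⟨i', hlt, Or.inl rfl⟩⟩)⟩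
    simp only [entryBit_eq]
    by_cases h : i ∈ columnRows Y j <;> by_cases h' : i' ∈ columnRows Y j <;>
    simp [h, h', Finset.insert_inter_of_mem, Finset.insert_inter_of_notMem,
      Finset.card_pair hlt.ne']

theorem exists_rankBound_cross_mem (Y : Finset (Fin (a + 3) × Fin n)) {P Q : Finset (Fin (a + 3))}
    (hP : P.card = 2) (hQ : Q.card = 2) :
    ∃ c : ℕ → ℕ, (∀ j : Fin n, c j ≤ 1 ∧ (Disjoint P (columnRows Y j) → c j = 0) ∧
      (Disjoint Q (columnRows Y j) → c j = 0)) ∧ rankBound a b Y 2 c ∈ rankBounds Y a b := by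
  have hpair : ∀ {P : Finset (Fin (a + 3))}, P.card = 2 →
      ∃ i i' : Fin (a + 3), i' < i ∧ P = {i, i'} := by
    intro P hP
    obtain ⟨i, i', hne, hII⟩ := Finset.card_eq_two.1 hP
    rcases lt_or_gt_of_ne hne with h | h
    · exact ⟨i', i, h, by rw [hII, Finset.pair_comm]⟩
    · exact ⟨i, i', h, hII⟩
  obtain ⟨i, i', hi, rfl⟩ := hpair hP
  obtain ⟨k, k', hk, rfl⟩ := hpair hQ
  refine ⟨crossBit Y i i' k k', fun j => ⟨Prog.crossBit_le _ _ _ _ _, fun h => ?_, fun h => ?_⟩, ?_⟩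
  · rw [Finset.disjoint_insert_left, Finset.disjoint_singleton_left] at h
    simp [crossBit, entryBit_eq, h.1, h.2]
  · rw [Finset.disjoint_insert_left, Finset.disjoint_singleton_left] at h
    simp [crossBit, entryBit_eq, h.1, h.2]
  · simp only [rankBounds, Set.mem_union, Set.mem_singleton_iff, Set.mem_iUnion, exists_prop]
    exact Or.inr (Or.inr ⟨i, i.2, Or.inr ⟨i', hi, Or.inr ⟨k, k.2, k', hk, rfl⟩⟩⟩)

theorem card_columnRows_add (Y : Finset (Fin m × Fin n)) (j : Fin n) :
    (columnRows Y j).card + (missingRows Y j).card = m := by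
  rw [missingRows, Finset.card_add_card_compl, Fintype.card_fin]

theorem inter_columnRows (Y : Finset (Fin m × Fin n)) (j : Fin n) (I : Finset (Fin m)) :
    I ∩ columnRows Y j = I \ missingRows Y j := by
  ext i
  simp [missingRows]

end Bounds

/-! ### Lower bound when few columns miss at least two rows. -/

section FewLargeColumns

variable {K : Type*} [Field K] {n a b : ℕ}

/-- Columns of `B`, missing two or more rows, go to different groups; columns of `E`, missing one
row, are distributed by the min-max theorem. A group whose missing rows form a set `W` contributes
at most `3 - min 3 |W|` to the relations. The rank is compared column by column with the bound for
`I = U`, the rows missed by the minimizing set `A`. -/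
theorem exists_rankBound_le_of_card_large_le (x : Fin (a + 3) → Fin a → K)
    (hN : InGeneralPosition (LinearMap.ker (Fintype.linearCombination K x)))
    (Y : Finset (Fin (a + 3) × Fin n)) {e : ℕ} (he : e + b = n)
    (hcard : (Finset.univ.filter fun j => 2 ≤ (missingRows Y j).card).card ≤ e) :
    ∃ y : Fin n → Fin b → K, ∃ r ∈ rankBounds Y a b, r ≤ columnRank x y Y := by
  classical
  set S := missingRows Y with hS
  set B := Finset.univ.filter fun j => 2 ≤ (S j).card with hB
  obtain ⟨ρ, hρ, hρ', hinj⟩ := exists_partial_injection (β := Fin e) B (by simpa using hcard)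
  let G : Fin e → Finset (Fin (a + 3)) := fun t =>
    (Finset.univ.filter fun j => ρ j = some t).biUnion S
  let E := Finset.univ.filter fun j => (S j).card = 1
  obtain ⟨σ, A, hAE, hσ⟩ := exists_assignment_le E
    (fun (t : Fin e) A => min 3 (G t ∪ A.biUnion S).card)
    fun t => (monotoneSubmodular_card_biUnion (G t) S).min 3
  let τ₀ : Fin n → Option (Fin e) := fun j => if j ∈ B then ρ j else σ j
  obtain ⟨τ, hτ, hτ'⟩ := exists_surjective_assignment (β := Fin e) S (by simp; omega) 3 _ τ₀ (by
    refine hσ.trans (Finset.sum_le_sum fun t _ => min_le_min_left 3 (Finset.card_le_card ?_))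
    rw [← Finset.union_biUnion]
    apply Finset.biUnion_subset_biUnion_of_subset_left
    intro j
    simp only [Finset.mem_union, Finset.mem_filter, Finset.mem_univ, true_and, τ₀]
    rintro (h | ⟨h₁, h₂⟩)
    · have : j ∈ B := by
        by_contra hj
        simp [hρ' j hj] at h
      rw [if_pos this, h]
    · have : j ∉ B := by
        simp only [E, B, Finset.mem_filter, Finset.mem_univ, true_and] at h₁ ⊢
        omega
      rw [if_neg this, h₂])
  obtain ⟨y, hy⟩ := exists_finrank_columnRelations_le x Y he τ hτ
  rw [← hS] at hy
  refine ⟨y, ?_⟩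
  have hnull : Module.finrank K (columnRelations x y Y) +
      ∑ t, min 3 ((Finset.univ.filter fun j => τ j = some t).biUnion S).card ≤ e * 3 := by
    refine (Nat.add_le_add_right hy _).trans ?_
    rw [← Finset.sum_add_distrib]
    refine (Finset.sum_le_card_nsmul _ _ 3 fun t _ => ?_).trans (by simp)
    rw [hN.finrank_vanishOn (by simp)]
    omega
  have hrank := columnRank_add_finrank x y Y
  rw [← sum_card_columnRows] at hrank
  set U := A.biUnion S with hU
  have hsum := sum_add_card_mul_le (f := fun t => min 3 (G t ∪ U).card)
    (φ := fun j => min 3 (S j ∪ U).card) (d := min 3 U.card) hρ hinj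
    (fun t => min_le_min_left 3 (Finset.card_le_card Finset.subset_union_right)) (by
      intro j t hj
      refine min_le_min_left 3 (Finset.card_le_card (Finset.union_subset_union_left ?_))
      exact Finset.subset_biUnion_of_mem S (by simp [hj]))
  rw [Fintype.card_fin] at hsum
  -- If `U` has at least three rows, the trivial bound with `q = 0` replaces the one for `I = U`.
  obtain ⟨q, c, hq, hc, hmem⟩ : ∃ (q : ℕ) (c : ℕ → ℕ), q + min 3 U.card = 3 ∧
      (∀ j : Fin n, U.card < 3 → c j = (U \ S j).card) ∧ rankBound a b Y q c ∈ rankBounds Y a b := by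
    rcases lt_or_ge U.card 3 with h | h
    · obtain ⟨c, hc, hmem⟩ := exists_rankBound_inter_mem (b := b) Y U (q := 3 - U.card) (by omega)
        (by omega)
      exact ⟨_, c, by omega, fun j _ => by rw [hc, inter_columnRows], hmem⟩
    · exact ⟨0, _, by omega, fun j h' => by omega, Or.inl rfl⟩
  refine ⟨_, hmem, ?_⟩
  -- The term `q * b` is written as `n * q - e * q`, so that each column carries one `q`.
  have hpoint : ∀ j : Fin n, q + min (columnRows Y j).card (a + c j) +
      (if j ∈ B then min 3 U.card else 0) ≤ (columnRows Y j).card +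
        (if j ∈ E \ A then 1 else 0) + (if j ∈ B then min 3 (S j ∪ U).card else 0) := by
    intro j
    have h₁ := card_columnRows_add Y j
    rw [← hS] at h₁
    have h₂ := hc j
    have h₃ : (U \ S j).card + (S j).card = (S j ∪ U).card := by
      rw [Finset.card_sdiff_add_card, Finset.union_comm]
    have h₄ := Finset.card_le_card (Finset.sdiff_subset : U \ S j ⊆ U)
    have h₅ := Finset.card_le_card (Finset.subset_union_right : U ⊆ S j ∪ U)
    by_cases hjB : j ∈ B
    · rw [if_pos hjB, if_pos hjB]
      omega
    · rw [if_neg hjB, if_neg hjB]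
      simp only [B, Finset.mem_filter, Finset.mem_univ, true_and] at hjB
      by_cases hjE : j ∈ E
      · have hj1 : (S j).card = 1 := by simpa [E] using hjE
        by_cases hjA : j ∈ A
        · have h₆ : S j ⊆ U := Finset.subset_biUnion_of_mem S hjA
          rw [Finset.union_eq_right.2 h₆] at h₃
          omega
        · rw [if_pos (Finset.mem_sdiff.2 ⟨hjE, hjA⟩)]
          omega
      · have hj1 : (S j).card ≠ 1 := by simpa [E] using hjE
        omega
  have htot := Finset.sum_le_sum fun j (_ : j ∈ Finset.univ) => hpoint j
  simp only [Finset.sum_add_distrib, Finset.sum_ite_mem, Finset.univ_inter, Finset.sum_const,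
    smul_eq_mul, Finset.card_univ, Fintype.card_fin, mul_one] at htot
  rw [rankBound_eq_sum]
  have h₁ : e * 3 = e * q + e * min 3 U.card := by rw [← mul_add, hq]
  have h₂ : n * q = q * b + e * q := by rw [← he]; ring
  omega

end FewLargeColumns

/-! ### Lines of vectors vanishing on a pair of rows. -/

section Pairs

variable {K ι : Type*} [Field K] [Fintype ι] [DecidableEq ι] {N : Submodule K (ι → K)}

/-- A nonzero vector of `N` vanishing on the pair `P` cannot vanish at a third place. -/
theorem InGeneralPosition.subset_of_vanishOn_le (hN : InGeneralPosition N)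
    (hι : 3 ≤ Fintype.card ι) {P T : Finset ι} (hP : P.card = 2)
    (h : vanishOn N P ≤ vanishOn N T) : T ⊆ P := by
  intro p hp
  by_contra hpP
  have h₁ : vanishOn N P ≤ vanishOn N (insert p P) := by
    intro f hf
    refine mem_vanishOn.2 ⟨vanishOn_le N P hf, fun i hi => ?_⟩
    rcases Finset.mem_insert.1 hi with rfl | hi
    · exact (mem_vanishOn.1 (h hf)).2 i hp
    · exact (mem_vanishOn.1 hf).2 i hi
  have h₂ := Submodule.finrank_mono h₁
  rw [hN.finrank_vanishOn hι, hN.finrank_vanishOn hι, Finset.card_insert_of_notMem hpP, hP] at h₂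
  omega

theorem InGeneralPosition.two_le_finrank (hN : InGeneralPosition N)
    (hι : 3 ≤ Fintype.card ι) {P Q : Finset ι} (hP : P.card = 2) (hQ : Q.card = 2) (hPQ : P ≠ Q)
    {V : Submodule K (ι → K)} (hPV : vanishOn N P ≤ V) (hQV : vanishOn N Q ≤ V) :
    2 ≤ Module.finrank K V := by
  by_contra! hlt
  have h₁ : vanishOn N Q = V := Submodule.eq_of_le_of_finrank_le hQV (by
    rw [hN.finrank_vanishOn hι, hQ]; omega)
  have h₂ := hN.subset_of_vanishOn_le hι hP (h₁ ▸ hPV)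
  exact hPQ (Finset.eq_of_subset_of_card_le h₂ (by omega)).symm

/-- The lines of the distinct pairs `P` and `Q` span `V`, and both consist of vectors vanishing at
`i`. So the line of `R` does as well, which forces `i ∈ R`. -/
theorem InGeneralPosition.mem_of_mem_inter (hN : InGeneralPosition N)
    (hι : 3 ≤ Fintype.card ι) {P Q R : Finset ι} (hP : P.card = 2) (hQ : Q.card = 2)
    (hR : R.card = 2) (hPQ : P ≠ Q) {V : Submodule K (ι → K)} (hPV : vanishOn N P ≤ V)
    (hQV : vanishOn N Q ≤ V) (hRV : vanishOn N R ≤ V) (hV : Module.finrank K V ≤ 2) {i : ι}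
    (hiP : i ∈ P) (hiQ : i ∈ Q) : i ∈ R := by
  have h₁ := hN.two_le_finrank hι hP hQ hPQ (V := vanishOn N P ⊔ vanishOn N Q) le_sup_left
    le_sup_right
  have h₂ := Submodule.eq_of_le_of_finrank_le (sup_le hPV hQV) (by omega)
  have h₃ : vanishOn N R ≤ vanishOn N {i} := by
    rw [← h₂] at hRV
    exact hRV.trans (sup_le (vanishOn_anti N (by simpa using hiP))
      (vanishOn_anti N (by simpa using hiQ)))
  exact hN.subset_of_vanishOn_le hι hR h₃ (Finset.mem_singleton_self i)

theorem InGeneralPosition.three_le_finrank_sup (hN : InGeneralPosition N)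
    (hι : 3 ≤ Fintype.card ι) {P T : Finset ι} (hP : P.card = 2) (hT : T.card = 1) (hTP : ¬ T ⊆ P)
    {V : Submodule K (ι → K)} (hPV : vanishOn N P ≤ V) :
    3 ≤ Module.finrank K (vanishOn N T ⊔ V : Submodule K (ι → K)) := by
  by_contra! hlt
  have h₁ : vanishOn N T = vanishOn N T ⊔ V := Submodule.eq_of_le_of_finrank_le le_sup_left (by
    rw [hN.finrank_vanishOn hι, hT]; omega)
  exact hTP (hN.subset_of_vanishOn_le hι hP (h₁ ▸ hPV.trans le_sup_right))

end Pairs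

/-! ### Lower bound when few columns miss at most one row. -/

section FewSmallColumns

variable {K : Type*} [Field K] {n a b : ℕ}

/-- Translates the span `V` of the lines belonging to the pairs in `A` into a bound. The four
nonempty configurations are: `V` has dimension three; all pairs coincide; two pairs are disjoint;
two distinct pairs share a row. -/
theorem exists_rankBound_of_pairs {N : Submodule K (Fin (a + 3) → K)} (hN : InGeneralPosition N)
    (Y : Finset (Fin (a + 3) × Fin n)) (A : Finset (Fin n))
    (hA : ∀ j ∈ A, (missingRows Y j).card = 2) (V : Submodule K (Fin (a + 3) → K))
    (hV : V = ⨆ k ∈ A, vanishOn N (missingRows Y k)) :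
    ∃ (q : ℕ) (c : ℕ → ℕ), rankBound a b Y q c ∈ rankBounds Y a b ∧ q ≤ Module.finrank K V ∧
      (∀ j, (missingRows Y j).card ≤ 1 → q + min (columnRows Y j).card (a + c j) ≤
        a + Module.finrank K (vanishOn N (missingRows Y j) ⊔ V : Submodule K (Fin (a + 3) → K))) ∧
      ∀ j ∈ A, c j = 0 := by
  have hι : 3 ≤ Fintype.card (Fin (a + 3)) := by simp
  have hAV : ∀ k ∈ A, vanishOn N (missingRows Y k) ≤ V := fun k hk => by
    rw [hV]; exact le_biSup (fun k => vanishOn N (missingRows Y k)) hk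
  have hcol := card_columnRows_add Y
  have hφ : ∀ j, 3 - (missingRows Y j).card ≤ Module.finrank K
      (vanishOn N (missingRows Y j) ⊔ V : Submodule K (Fin (a + 3) → K)) := fun j => by
    rw [← hN.finrank_vanishOn hι]
    exact Submodule.finrank_mono le_sup_left
  have hφV : ∀ j, Module.finrank K V ≤ Module.finrank K
      (vanishOn N (missingRows Y j) ⊔ V : Submodule K (Fin (a + 3) → K)) := fun j =>
    Submodule.finrank_mono le_sup_right
  rcases A.eq_empty_or_nonempty with rfl | ⟨j₁, hj₁⟩
  · refine ⟨0, fun _ => 3, Or.inl rfl, Nat.zero_le _, fun j hj => ?_, by simp⟩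
    have h₁ := hφ j
    have h₂ := hcol j
    omega
  have hP := hA j₁ hj₁
  have hPV := hAV j₁ hj₁
  rcases le_or_gt 3 (Module.finrank K V) with hd | hd
  · obtain ⟨c, hc, hmem⟩ := exists_rankBound_inter_mem (b := b) Y ∅ (q := 3) (by omega) (by simp)
    have hc0 : ∀ j : Fin n, c j = 0 := fun j => by simpa using hc j
    refine ⟨3, c, hmem, hd, fun j hj => ?_, fun j _ => hc0 j⟩
    have h₁ := hφV j
    rw [hc0]
    omega
  -- All pairs equal: `V` is a line, and the bound with `I` equal to the common pair and `q = 1`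
  -- fits.
  by_cases hsame : ∀ j ∈ A, missingRows Y j = missingRows Y j₁
  · obtain ⟨c, hc, hmem⟩ := exists_rankBound_inter_mem (b := b) Y (missingRows Y j₁) (q := 1)
      le_rfl (by omega)
    refine ⟨1, c, hmem, ?_, fun j hj => ?_, fun j hj => ?_⟩
    · have := Submodule.finrank_mono hPV
      rw [hN.finrank_vanishOn hι, hP] at this
      omega
    · rw [hc, inter_columnRows]
      have h₁ := hφ j
      have h₂ := hcol j
      have h₃ := Finset.card_le_card (Finset.sdiff_subset :
        missingRows Y j₁ \ missingRows Y j ⊆ missingRows Y j₁)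
      rcases Nat.lt_or_ge (missingRows Y j).card 1 with hj0 | hj1
      · omega
      · have hj1 : (missingRows Y j).card = 1 := by omega
        by_cases hsub : missingRows Y j ⊆ missingRows Y j₁
        · have h₄ := Finset.card_sdiff_of_subset hsub
          omega
        · have h₄ := hN.three_le_finrank_sup hι hP hj1 hsub hPV
          omega
    · rw [hc, inter_columnRows, hsame j hj, Finset.sdiff_self, Finset.card_empty]
  push Not at hsame
  obtain ⟨j₂, hj₂, hne⟩ := hsame
  have hQ := hA j₂ hj₂
  have hQV := hAV j₂ hj₂
  have hd2 := hN.two_le_finrank hι hP hQ hne.symm hPV hQV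
  have hcommon : ∀ {j k l i}, j ∈ A → k ∈ A → l ∈ A → missingRows Y j ≠ missingRows Y k →
      i ∈ missingRows Y j → i ∈ missingRows Y k → i ∈ missingRows Y l := by
    intro j k l i hj hk hl hne hij hik
    exact hN.mem_of_mem_inter hι (hA j hj) (hA k hk) (hA l hl) hne (hAV j hj) (hAV k hk)
      (hAV l hl) (by omega) hij hik
  -- Here `V` is a plane. Two disjoint pairs call for the bound of the two pairs; if they share a
  -- row `i`, all pairs contain `i`, and `I = {i}` fits.
  by_cases hdisj : Disjoint (missingRows Y j₁) (missingRows Y j₂)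
  · obtain ⟨c, hc, hmem⟩ := exists_rankBound_cross_mem (b := b) Y hP hQ
    refine ⟨2, c, hmem, hd2, fun j hj => ?_, fun j hj => ?_⟩
    · have h₁ := hφ j
      have h₂ := hcol j
      have h₃ := (hc j).1
      rcases Nat.lt_or_ge (missingRows Y j).card 1 with hj0 | hj1
      · omega
      · have hj1 : (missingRows Y j).card = 1 := by omega
        by_cases hsub : missingRows Y j ⊆ missingRows Y j₁
        · have hsub' : ¬ missingRows Y j ⊆ missingRows Y j₂ := by
            intro h
            have := Finset.disjoint_self_iff_empty _ |>.1 (hdisj.mono hsub h)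
            rw [this] at hj1
            simp at hj1
          have h₄ := hN.three_le_finrank_sup hι hQ hj1 hsub' hQV
          omega
        · have h₄ := hN.three_le_finrank_sup hι hP hj1 hsub hPV
          omega
    · have hdis : ∀ {j'}, missingRows Y j = missingRows Y j' →
          Disjoint (missingRows Y j') (columnRows Y j) := by
        intro j' h
        rw [← h, missingRows]
        exact disjoint_compl_left
      by_cases h₁ : missingRows Y j = missingRows Y j₁
      · exact (hc j).2.1 (hdis h₁)
      by_cases h₂ : missingRows Y j = missingRows Y j₂
      · exact (hc j).2.2 (hdis h₂)
      -- A third pair would be disjoint from the other two, since a row common to two distinct pairs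
      -- belongs to all of them. General position would then make `V` three-dimensional.
      exfalso
      have h₃ : Disjoint (missingRows Y j₁) (missingRows Y j) :=
        Finset.disjoint_left.2 fun i h h' =>
          Finset.disjoint_left.1 hdisj h (hcommon hj₁ hj hj₂ (Ne.symm h₁) h h')
      have h₄ : Disjoint (missingRows Y j₂) (missingRows Y j) :=
        Finset.disjoint_left.2 fun i h h' =>
          Finset.disjoint_right.1 hdisj h (hcommon hj₂ hj hj₁ (Ne.symm h₂) h h')
      have h₅ := Submodule.finrank_mono ((hN.sup_eq _ _ _ hP hQ (hA j hj) hdisj h₃ h₄).trans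
        (sup_le (sup_le hPV hQV) (hAV j hj)))
      rw [hN.finrank_eq] at h₅
      omega
  · obtain ⟨i, hi₁, hi₂⟩ := Finset.not_disjoint_iff.1 hdisj
    obtain ⟨c, hc, hmem⟩ := exists_rankBound_inter_mem (b := b) Y {i} (q := 2) (by omega) (by simp)
    have hc1 : ∀ j : Fin n, c j = if i ∈ missingRows Y j then 0 else 1 := fun j => by
      rw [hc, inter_columnRows]
      by_cases h : i ∈ missingRows Y j
      · rw [if_pos h, Finset.sdiff_eq_empty_iff_subset.2 (by simpa using h), Finset.card_empty]
      · rw [if_neg h, Finset.sdiff_eq_self_of_disjoint (by simpa using h), Finset.card_singleton]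
    refine ⟨2, c, hmem, hd2, fun j hj => ?_, fun j hj => ?_⟩
    · have h₁ := hφ j
      have h₂ := hcol j
      have h₃ := hφV j
      rw [hc1]
      by_cases hij : i ∈ missingRows Y j
      · rw [if_pos hij]
        omega
      · rw [if_neg hij]
        rcases Nat.lt_or_ge (missingRows Y j).card 1 with hj0 | hj1
        · omega
        · obtain ⟨p, hp⟩ := Finset.card_eq_one.1 (show (missingRows Y j).card = 1 by omega)
          have hpi : p ≠ i := fun h => hij (by simp [hp, h])
          by_cases hp₁ : p ∈ missingRows Y j₁
          · have hp₂ : p ∉ missingRows Y j₂ := fun hp₂ => hne (by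
              rw [← Finset.eq_of_subset_of_card_le (s := {p, i}) (t := missingRows Y j₁)
                  (by simp [Finset.insert_subset_iff, hp₁, hi₁]) (by rw [Finset.card_pair hpi, hP]),
                ← Finset.eq_of_subset_of_card_le (s := {p, i}) (t := missingRows Y j₂)
                  (by simp [Finset.insert_subset_iff, hp₂, hi₂]) (by rw [Finset.card_pair hpi, hQ])])
            have h₄ := hN.three_le_finrank_sup hι hQ (T := missingRows Y j) (by omega)
              (by simpa [hp] using hp₂) hQV
            omega
          · have h₄ := hN.three_le_finrank_sup hι hP (T := missingRows Y j) (by omega)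
              (by simpa [hp] using hp₁) hPV
            omega
    · rw [hc1, if_pos (hcommon hj₁ hj₂ hj hne.symm hi₁ hi₂)]

/-- Dual to the case of few large columns: columns of `C` go to different groups, columns of `E` are
distributed by the min-max theorem for dimensions of spans, and `V` is the span belonging to the
minimizing set `A`. -/
theorem exists_rankBound_le_of_card_small_le (x : Fin (a + 3) → Fin a → K)
    (hN : InGeneralPosition (LinearMap.ker (Fintype.linearCombination K x)))
    (Y : Finset (Fin (a + 3) × Fin n))
    (hcard : (Finset.univ.filter fun j => (missingRows Y j).card ≤ 1).card ≤ b) :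
    ∃ y : Fin n → Fin b → K, ∃ r ∈ rankBounds Y a b, r ≤ columnRank x y Y := by
  classical
  have hι : 3 ≤ Fintype.card (Fin (a + 3)) := by simp
  set N := LinearMap.ker (Fintype.linearCombination K x) with hNdef
  set S := missingRows Y with hS
  set C := Finset.univ.filter fun j => (S j).card ≤ 1 with hC
  let Z := fun j => vanishOn N (S j)
  obtain ⟨ρ, hρ, hρ', hinj⟩ := exists_partial_injection (β := Fin b) C (by simpa using hcard)
  let G : Fin b → Submodule K (Fin (a + 3) → K) := fun t =>
    ⨆ j ∈ Finset.univ.filter fun j => ρ j = some t, Z j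
  let E := Finset.univ.filter fun j => (S j).card = 2
  obtain ⟨σ, A, hAE, hσ⟩ := exists_assignment_le E
    (fun (t : Fin b) A => Module.finrank K (G t ⊔ ⨆ k ∈ A, Z k : Submodule K (Fin (a + 3) → K)))
    fun t => monotoneSubmodular_finrank_iSup (G t) Z
  let τ : Fin n → Option (Fin b) := fun j => if j ∈ C then ρ j else σ j
  obtain ⟨y, hy⟩ := exists_finrank_columnRelations_add_le x Y τ
  refine ⟨y, ?_⟩
  rw [← hNdef, ← hS] at hy
  have hτ : ∑ t, Module.finrank K (G t ⊔ ⨆ k ∈ E.filter fun k => σ k = some t, Z k :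
      Submodule K (Fin (a + 3) → K)) ≤ ∑ t, Module.finrank K
      (⨆ j ∈ Finset.univ.filter fun j => τ j = some t, Z j : Submodule K (Fin (a + 3) → K)) := by
    refine Finset.sum_le_sum fun t _ => Submodule.finrank_mono ?_
    rw [← Finset.iSup_union]
    refine biSup_mono fun j => ?_
    simp only [Finset.mem_union, Finset.mem_filter, Finset.mem_univ, true_and, τ]
    rintro (h | ⟨h₁, h₂⟩)
    · have : j ∈ C := by
        by_contra hj
        simp [hρ' j hj] at h
      rw [if_pos this, h]
    · have : j ∉ C := by
        simp only [E, C, Finset.mem_filter, Finset.mem_univ, true_and] at h₁ ⊢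
        omega
      rw [if_neg this, h₂]
  have hrank := columnRank_add_finrank x y Y
  rw [← sum_card_columnRows] at hrank
  simp only [hN.finrank_vanishOn hι] at hy
  set V := ⨆ k ∈ A, Z k with hV
  obtain ⟨q, c, hmem, hq, hsmall, hzero⟩ := exists_rankBound_of_pairs (b := b) hN Y A
    (fun j hj => by simpa [E] using hAE hj) V hV
  rw [← hS] at hsmall
  refine ⟨_, hmem, ?_⟩
  have hsum := sum_add_card_mul_le
    (f := fun t => Module.finrank K (G t ⊔ V : Submodule K (Fin (a + 3) → K)))
    (φ := fun j => Module.finrank K (Z j ⊔ V : Submodule K (Fin (a + 3) → K))) (d := q) hρ hinj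
    (fun t => hq.trans (Submodule.finrank_mono le_sup_right)) (by
      intro j t hj
      refine Submodule.finrank_mono (sup_le_sup_right ?_ V)
      exact le_biSup Z (by simp [hj]))
  rw [Fintype.card_fin] at hsum
  have hpoint : ∀ j : Fin n, (3 - (S j).card) + min (columnRows Y j).card (a + c j) +
      (if j ∈ C then q else 0) ≤ (columnRows Y j).card + (if j ∈ E \ A then 1 else 0) +
        (if j ∈ C then Module.finrank K (Z j ⊔ V : Submodule K (Fin (a + 3) → K)) else 0) := by
    intro j
    have h₁ := card_columnRows_add Y j
    rw [← hS] at h₁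
    by_cases hjC : j ∈ C
    · rw [if_pos hjC, if_pos hjC]
      simp only [C, Finset.mem_filter, Finset.mem_univ, true_and] at hjC
      have h₂ : q + min (columnRows Y j).card (a + c j) ≤
        a + Module.finrank K (Z j ⊔ V : Submodule K (Fin (a + 3) → K)) := hsmall j hjC
      omega
    · rw [if_neg hjC, if_neg hjC]
      simp only [C, Finset.mem_filter, Finset.mem_univ, true_and] at hjC
      by_cases hjE : j ∈ E
      · have hj2 : (S j).card = 2 := by simpa [E] using hjE
        by_cases hjA : j ∈ A
        · rw [hzero j hjA]
          omega
        · rw [if_pos (Finset.mem_sdiff.2 ⟨hjE, hjA⟩)]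
          omega
      · have hj2 : (S j).card ≠ 2 := by simpa [E] using hjE
        omega
  have htot := Finset.sum_le_sum fun j (_ : j ∈ Finset.univ) => hpoint j
  simp only [Finset.sum_add_distrib, Finset.sum_ite_mem, Finset.univ_inter, Finset.sum_const,
    smul_eq_mul, mul_one] at htot
  rw [rankBound_eq_sum, mul_comm]
  simp only [Z] at *
  omega

/-- The two constructions cover everything: if more than `b` columns miss at most one row, then at
most `n - b` columns miss two or more. -/
theorem exists_rankBound_le_columnRank (x : Fin (a + 3) → Fin a → K)
    (hN : InGeneralPosition (LinearMap.ker (Fintype.linearCombination K x)))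
    (Y : Finset (Fin (a + 3) × Fin n)) (hb : b ≤ n) :
    ∃ y : Fin n → Fin b → K, ∃ r ∈ rankBounds Y a b, r ≤ columnRank x y Y := by
  by_cases h : (Finset.univ.filter fun j => (missingRows Y j).card ≤ 1).card ≤ b
  · exact exists_rankBound_le_of_card_small_le x hN Y h
  · refine exists_rankBound_le_of_card_large_le x hN Y (e := n - b) (by omega) ?_
    have := Finset.card_filter_add_card_filter_not (s := Finset.univ)
      fun j : Fin n => (missingRows Y j).card ≤ 1
    simp only [not_le, Finset.card_univ, Fintype.card_fin] at this
    change (Finset.univ.filter fun j => 1 < (missingRows Y j).card).card ≤ n - b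
    omega

end FewSmallColumns

/-! ### Quadratic polynomials as a space in general position. -/

section Parabola

variable {K : Type*} [Field K]

/-- The `x i` are the images of the unit vectors under the quotient map by `N`, whose target is
identified with `Fin a → K`. -/
theorem exists_linearCombination_ker_eq {a d : ℕ} (N : Submodule K (Fin (a + d) → K))
    (hN : Module.finrank K N = d) :
    ∃ x : Fin (a + d) → Fin a → K, LinearMap.ker (Fintype.linearCombination K x) = N := by
  have h : Module.finrank K ((Fin (a + d) → K) ⧸ N) = Module.finrank K (Fin a → K) := by
    have := N.finrank_quotient_add_finrank
    rw [hN, Module.finrank_fintype_fun_eq_card, Fintype.card_fin] at this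
    rw [Module.finrank_fintype_fun_eq_card, Fintype.card_fin]
    omega
  let φ := LinearEquiv.ofFinrankEq _ _ h
  let Φ := φ.toLinearMap.comp N.mkQ
  refine ⟨fun i => Φ (Pi.single i 1), ?_⟩
  have : Fintype.linearCombination K (fun i => Φ (Pi.single i 1)) = Φ := by
    refine LinearMap.pi_ext' fun i => LinearMap.ext_ring ?_
    simp [Fintype.linearCombination_apply_single]
  rw [this, LinearMap.ker_comp, LinearEquiv.ker, Submodule.comap_bot, Submodule.ker_mkQ]

/-- The map that sends the coefficients of a quadratic polynomial to its values at the points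
`t i`. -/
def quadraticValues {ι : Type*} (t : ι → K) : (Fin 3 → K) →ₗ[K] (ι → K) :=
  LinearMap.pi fun i => LinearMap.proj 0 + t i • LinearMap.proj 1 + (t i) ^ 2 • LinearMap.proj 2

theorem quadraticValues_apply {ι : Type*} (t : ι → K) (f : Fin 3 → K) (i : ι) :
    quadraticValues t f i = f 0 + t i * f 1 + t i ^ 2 * f 2 := by
  simp [quadraticValues]

theorem eq_zero_of_quadraticValues_eq_zero {ι : Type*} {t : ι → K} (ht : Function.Injective t)
    {f : Fin 3 → K} {i j k : ι} (hij : i ≠ j) (hik : i ≠ k) (hjk : j ≠ k)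
    (hi : quadraticValues t f i = 0) (hj : quadraticValues t f j = 0)
    (hk : quadraticValues t f k = 0) : f = 0 := by
  rw [quadraticValues_apply] at hi hj hk
  have hij' := sub_ne_zero.2 (ht.ne hij)
  have hik' := sub_ne_zero.2 (ht.ne hik)
  have hjk' := sub_ne_zero.2 (ht.ne hjk)
  have h₁ : f 1 + (t i + t j) * f 2 = 0 := by
    refine (mul_eq_zero.1 (?_ : (t i - t j) * (f 1 + (t i + t j) * f 2) = 0)).resolve_left hij'
    linear_combination hi - hj
  have h₂ : f 1 + (t i + t k) * f 2 = 0 := by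
    refine (mul_eq_zero.1 (?_ : (t i - t k) * (f 1 + (t i + t k) * f 2) = 0)).resolve_left hik'
    linear_combination hi - hk
  have h₃ : f 2 = 0 := by
    refine (mul_eq_zero.1 (?_ : (t j - t k) * f 2 = 0)).resolve_left hjk'
    linear_combination h₁ - h₂
  have h₄ : f 1 = 0 := by simpa [h₃] using h₁
  have h₅ : f 0 = 0 := by simpa [h₃, h₄] using hi
  ext l
  fin_cases l <;> assumption

/-- The determinant of the coefficients of the quadratic polynomials with roots `w 0, w 1`, with
roots `w 2, w 3` and with roots `w 4, w 5`. -/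
def rootPairsDet {R : Type*} [CommRing R] (w : Fin 6 → R) : R :=
  Matrix.det !![w 0 * w 1, w 2 * w 3, w 4 * w 5;
    -(w 0 + w 1), -(w 2 + w 3), -(w 4 + w 5); 1, 1, 1]

/-- A nonzero quadratic polynomial has at most two roots, which gives the first two conditions. The
vectors vanishing on a pair include the values of the quadratic with these two roots, and three such
quadratics form a basis when the determinant of their coefficients is nonzero. -/
theorem inGeneralPosition_range_quadraticValues {ι : Type*} [Fintype ι] [DecidableEq ι]
    (hι : 3 ≤ Fintype.card ι)
    {t : ι → K} (ht : Function.Injective t)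
    (hdet : ∀ w : Fin 6 → ι, Function.Injective w → rootPairsDet (t ∘ w) ≠ 0) :
    InGeneralPosition (LinearMap.range (quadraticValues t)) where
  finrank_eq := by
    obtain ⟨S, -, hS⟩ := Finset.exists_subset_card_eq (s := (Finset.univ : Finset ι)) hι
    obtain ⟨i, j, k, hij, hik, hjk, -⟩ := Finset.card_eq_three.1 hS
    rw [LinearMap.finrank_range_of_inj]
    · simp
    · rw [← LinearMap.ker_eq_bot, LinearMap.ker_eq_bot']
      intro f hf
      exact eq_zero_of_quadraticValues_eq_zero ht hij hik hjk (congrFun hf i) (congrFun hf j)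
        (congrFun hf k)
  vanishOn_eq_bot S hS := by
    obtain ⟨i, j, k, hij, hik, hjk, rfl⟩ := Finset.card_eq_three.1 hS
    rw [eq_bot_iff]
    intro f hf
    obtain ⟨⟨f, rfl⟩, hf⟩ := mem_vanishOn.1 hf
    rw [eq_zero_of_quadraticValues_eq_zero ht hij hik hjk (hf i (by simp)) (hf j (by simp))
      (hf k (by simp)), map_zero]
    exact Submodule.zero_mem _
  sup_eq P Q R hP hQ hR hPQ hPR hQR := by
    obtain ⟨p, p', hp, rfl⟩ := Finset.card_eq_two.1 hP
    obtain ⟨q, q', hq, rfl⟩ := Finset.card_eq_two.1 hQ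
    obtain ⟨r, r', hr, rfl⟩ := Finset.card_eq_two.1 hR
    simp only [Finset.disjoint_insert_left, Finset.disjoint_singleton_left, Finset.mem_insert,
      Finset.mem_singleton, not_or] at hPQ hPR hQR
    have hw : Function.Injective ![p, p', q, q', r, r'] := by
      intro i j
      fin_cases i <;> fin_cases j <;> simp <;> grind
    have hmem : ∀ i i' : ι, quadraticValues t ![t i * t i', -(t i + t i'), 1] ∈
        vanishOn (LinearMap.range (quadraticValues t)) {i, i'} := by
      intro i i'
      refine mem_vanishOn.2 ⟨⟨_, rfl⟩, fun k hk => ?_⟩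
      rw [quadraticValues_apply]
      simp only [Finset.mem_insert, Finset.mem_singleton] at hk
      rcases hk with rfl | rfl <;> simp <;> ring
    rintro _ ⟨f, rfl⟩
    have hunit := (Matrix.isUnit_iff_isUnit_det _).2 (isUnit_iff_ne_zero.2 (hdet _ hw))
    obtain ⟨c, hc⟩ := Matrix.mulVec_surjective_iff_isUnit.2 hunit f
    have hf : f = c 0 • ![t p * t p', -(t p + t p'), 1] + c 1 • ![t q * t q', -(t q + t q'), 1] +
        c 2 • ![t r * t r', -(t r + t r'), 1] := by
      rw [← hc]
      ext l
      fin_cases l <;> simp [Matrix.mulVec, dotProduct, Fin.sum_univ_three] <;> ring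
    rw [hf, map_add, map_add, map_smul, map_smul, map_smul]
    exact Submodule.add_mem _ (Submodule.mem_sup_left (Submodule.add_mem _
      (Submodule.mem_sup_left (Submodule.smul_mem _ _ (hmem p p')))
      (Submodule.mem_sup_right (Submodule.smul_mem _ _ (hmem q q')))))
      (Submodule.mem_sup_right (Submodule.smul_mem _ _ (hmem r r')))

theorem map_rootPairsDet {R R' : Type*} [CommRing R] [CommRing R'] (φ : R →+* R') (w : Fin 6 → R) :
    φ (rootPairsDet w) = rootPairsDet (φ ∘ w) := by
  simp [rootPairsDet, Matrix.det_fin_three]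

/-- All conditions say that certain polynomials in the `t i` do not vanish. None of these
polynomials is zero, so over an infinite field their product is nonzero at some point. -/
theorem exists_injective_rootPairsDet_ne_zero (ι : Type*) [Fintype ι] [Infinite K] :
    ∃ t : ι → K, Function.Injective t ∧
      ∀ w : Fin 6 → ι, Function.Injective w → rootPairsDet (t ∘ w) ≠ 0 := by
  classical
  let p : MvPolynomial ι K :=
    (∏ z : ι × ι, if z.1 = z.2 then 1 else MvPolynomial.X z.1 - MvPolynomial.X z.2) *
      ∏ w : Fin 6 → ι, if Function.Injective w then rootPairsDet (MvPolynomial.X ∘ w) else 1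
  have hdet : ∀ (t : ι → K) (w : Fin 6 → ι),
      MvPolynomial.eval t (rootPairsDet (MvPolynomial.X ∘ w)) = rootPairsDet (t ∘ w) := by
    intro t w
    rw [map_rootPairsDet]
    congr 1
    ext k
    simp
  have hp : p ≠ 0 := by
    refine mul_ne_zero (Finset.prod_ne_zero_iff.2 fun z _ => ?_)
      (Finset.prod_ne_zero_iff.2 fun w _ => ?_)
    · split_ifs with h
      · exact one_ne_zero
      · exact sub_ne_zero.2 fun he => h (MvPolynomial.X_injective he)
    · split_ifs with h
      · intro h0
        -- The root pairs `0, 0`, `1, 0` and `1, -1` belong to `T²`, `T² - T` and `T² - 1`, which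
        -- are independent in every characteristic. That the roots are not distinct does not matter
        -- here.
        have h1 := hdet (Function.extend w ![0, 0, 1, 0, 1, -1] 0) w
        rw [Function.extend_comp h, h0, map_zero] at h1
        simp [rootPairsDet, Matrix.det_fin_three] at h1
      · exact one_ne_zero
  obtain ⟨t, ht⟩ : ∃ t, MvPolynomial.eval t p ≠ 0 := by
    by_contra! h
    exact hp (MvPolynomial.funext fun t => by rw [h t, map_zero])
  rw [map_mul, mul_ne_zero_iff, map_prod, map_prod, Finset.prod_ne_zero_iff,
    Finset.prod_ne_zero_iff] at ht
  refine ⟨t, fun i j hij => ?_, fun w hw => ?_⟩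
  · by_contra hne
    have := ht.1 (i, j) (Finset.mem_univ _)
    simp [hne, hij] at this
  · have := ht.2 w (Finset.mem_univ _)
    rwa [if_pos hw, hdet] at this

theorem exists_inGeneralPosition_ker [Infinite K] (a : ℕ) :
    ∃ x : Fin (a + 3) → Fin a → K,
      InGeneralPosition (LinearMap.ker (Fintype.linearCombination K x)) := by
  obtain ⟨t, ht, hdet⟩ := exists_injective_rootPairsDet_ne_zero (K := K) (Fin (a + 3))
  have hN := inGeneralPosition_range_quadraticValues (by simp) ht hdet
  obtain ⟨x, hx⟩ := exists_linearCombination_ker_eq _ hN.finrank_eq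
  exact ⟨x, hx ▸ hN⟩

end Parabola

/-! ### The min formula for the rank, and the conclusion. -/

/-- The rank in the bipartite rigidity matroid is the least of the bounds `rankBounds`. -/
theorem eRk_eq_of_isLeast_rankBounds {m n a b : ℕ} (hb : b ≤ n) (hma : m - a ≤ 3)
    (X : Finset (Fin m × Fin n)) {r : ℕ} (hr : IsLeast (rankBounds X a b) r) :
    (bipartiteRigidityMatroid m n a b).eRk X = (r : ℕ∞) := by
  have hm : m ≤ a + 3 := by omega
  rw [bipartiteRigidityMatroid_eRk, Nat.cast_inj]
  rw [← rankBounds_padRows hm] at hr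
  apply le_antisymm
  -- The upper bounds hold for arbitrary `x`, so the generic values may be extended by zero to the
  -- added rows.
  · let x : Fin (a + 3) → Fin a → RigidityField m n a b := fun i t =>
      if h : (i : ℕ) < m then rigidityX ⟨i, h⟩ t else 0
    have h := columnRank_le_of_mem_rankBounds x rigidityY (padRows hm X) hr.1
    have hx : (fun i => x (Fin.castLE hm i)) = rigidityX := by
      funext i t
      simp [x]
    rwa [columnRank_padRows, hx] at h
  -- For the lower bound general position is needed on all `a + 3` rows; the values on the first `m`
  -- rows are then a specialization of the generic matrix.
  · obtain ⟨x, hx⟩ := exists_inGeneralPosition_ker (K := ℂ) a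
    obtain ⟨y, s, hs, hle⟩ := exists_rankBound_le_columnRank x hx (padRows hm X) hb
    rw [columnRank_padRows] at hle
    exact (hr.2 hs).trans (hle.trans (columnRank_le_generic _ y X))

/-- There is one deterministic Turing machine `M` and one polynomial `p` such that for all
`0 ≤ a ≤ m` and `0 ≤ b ≤ n` with `m - a ≤ 3` and all `X ⊆ [m] × [n]`, the machine `M`, given
`(m, n, a, b, X)`, outputs the rank of `X` in `ℬ_{m,n}(a,b)` (in unary) within `p (m + n)` steps. -/
theorem theorem1p2 :
    ∃ (M : Turing.TM2ComputableAux Computability.Γ' Bool) (p : Polynomial ℕ),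
      ∀ m n a b : ℕ, a ≤ m → b ≤ n → m - a ≤ 3 → ∀ X : Finset (Fin m × Fin n),
        ∃ r : ℕ, (bipartiteRigidityMatroid m n a b).eRk (X : Set (Fin m × Fin n)) = (r : ℕ∞) ∧
          HaltsWithOutput M (encodeInput m n a b X) (Computability.unaryEncodeNat r)
            (p.eval (m + n)) := by
  obtain ⟨M, p, h⟩ := exists_machine_isLeast_rankBounds
  refine ⟨M, p, fun m n a b ha hb hma X => ?_⟩
  obtain ⟨r, hr, hM⟩ := h m n a b ha hb hma X
  exact ⟨r, eRk_eq_of_isLeast_rankBounds hb hma X hr, hM⟩
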